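/- Let $K$ be a field of characteristic $0$. **Dir-inv modules.** A dir-inv $K$-module is a $K$-module $M$ with submodules $\{F_jM\}_{j\in J}$, increasing in $j$ and indexed by a nonempty directed partially ordered set $J$, and for each $j$ a descending sequence of submodules $F_jM\supseteq G_j^0M\supseteq G_j^1M\supseteq\cdots$, such that for all $j_1\le j_2$ and $i$ there is $i'$ with $G_{j_1}^{i'}M\subseteq G_{j_2}^{i}M$. A linear map $\phi:M\to N$ is continuous if for every $j$ there is $k$ such that $\phi(F_jM)\subseteq F_kN$ and for every $i$ there is $i'$ with $\phi(G_j^{i'}M)\subseteq G_k^iN$. The completion is $\hat M=\varinjlim_j\varprojlim_i F_jM/G_j^iM$. If $A$ is a $K$-module (regarded as discrete: one index $j$, $F_j=A$, all $G_j^i=0$), then $A\otimes M$ is a dir-inv module with $F_j=A\otimes F_jM$ and $G_j^i=A\otimes G_j^iM$, and $A\mathbin{\hat\otimes}M$ is its completion. Finite products of dir-inv modules are indexed by the product of the index sets, with $F$ and $G^i$ formed componentwise. For a topological space $X$, dir-inv $K_X$-modules and their morphisms are defined in the same way, with sheaves of $K$-modules and subsheaves (the same $i'$, $k$ serving for all open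 sets); the sections $\Gamma(V,\mathcal M)$ over an open $V$ then form a dir-inv $K$-module. A dir-inv $K_X$-module is complete if it is isomorphic, as a dir-inv $K_X$-module, to some $\mathcal N$ with $\varinjlim_jF_j\mathcal N=\mathcal N$ and with $F_j\mathcal N\to\varprojlim_iF_j\mathcal N/G_j^i\mathcal N$ bijective for all $j$ (limits and quotients of sheaves). **Normalizations.** Let $B=\{B^l\}$ be a cosimplicial dir-inv $K$-module. Let $\mathrm N^qB\subseteq B^q$ be the intersection of the kernels of the codegeneracies $B^q\to B^{q-1}$, with differential $\sum_i(-1)^i\partial^i$. Let $\Omega^q(\Delta^l)$ be the module of $q$-forms on $\operatorname{Spec}K[t_0,\dots,t_l]/(t_0+\cdots+t_l-1)$, and let $\hat{\tilde{\mathrm N}}{}^qB\subseteq\prod_{l\ge0}\Omega^q(\Delta^l)\mathbin{\hat\otimes}B^l$ consist of the sequences $(u_l)$ such that $(1\otimes\alpha^*)(u_k)=(\alpha_*\otimes1)(u_l)$ for every order preserving $\alpha:[k]\to[l]$, where $\alpha^*:B^k\to B^l$ and $\alpha_*:\Omega^q(\Delta^l)\to\Omega^q(\Delta^k)$ is the pullback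 of forms; its differential is the exterior derivative of forms. If all $B^l$ are complete, $\int_\Delta:\hat{\tilde{\mathrm N}}B\to\mathrm NB$ is the homomorphism of complexes $u\mapsto\int_{\Delta^q}u_q$ in degree $q$, where $\int_{\Delta^q}:\Omega^q(\Delta^q)\to K$ is the usual integration over the simplex, $\int_{\Delta^q}t_0^{a_0}\cdots t_q^{a_q}\,dt_1\wedge\cdots\wedge dt_q=\frac{a_0!\cdots a_q!}{(a_0+\cdots+a_q+q)!}$, extended to $\Omega^q(\Delta^q)\mathbin{\hat\otimes}B^q\to K\mathbin{\hat\otimes}B^q\cong B^q$. **Čech constructions.** Let $X$ be a noetherian topological space with an open covering $\boldsymbol U=\{U_{(i)}\}_{i=0}^m$. For a dir-inv $K_X$-module $\mathcal M$ and an open $V\subseteq X$ let $$\Gamma(V,\mathrm C^q(\boldsymbol U,\mathcal M))=\prod_{0\le i_0\le\cdots\le i_q\le m}\Gamma(V\cap U_{(i_0)}\cap\cdots\cap U_{(i_q)},\mathcal M),$$ a cosimplicial dir-inv $K$-module as $q$ varies. Let $\mathrm N^q\mathrm C(\boldsymbol U,\mathcal M)$ and $\hat{\tilde{\mathrm N}}{}^q\mathrm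 C(\boldsymbol U,\mathcal M)$ be the presheaves $V\mapsto\mathrm N^q\Gamma(V,\mathrm C(\boldsymbol U,\mathcal M))$ and $V\mapsto\hat{\tilde{\mathrm N}}{}^q\Gamma(V,\mathrm C(\boldsymbol U,\mathcal M))$. For a complex $\mathcal M=(\mathcal M^p,d)$ of dir-inv $K_X$-modules let $\hat{\tilde{\mathrm N}}\mathrm C(\boldsymbol U,\mathcal M)$ be the total complex with terms $\bigoplus_{p+q=i}\hat{\tilde{\mathrm N}}{}^q\mathrm C(\boldsymbol U,\mathcal M^p)$ and differential $\partial+(-1)^qd$, and define $\mathrm N\mathrm C(\boldsymbol U,\mathcal M)$ likewise. When all $\mathcal M^p$ are complete there are homomorphisms of complexes, functorial in $\mathcal M$, $$\mathcal M\longrightarrow\hat{\tilde{\mathrm N}}\mathrm C(\boldsymbol U,\mathcal M)\xrightarrow{\ \int_\Delta\ }\mathrm N\mathrm C(\boldsymbol U,\mathcal M),$$ where the first sends a section $s$ of $\mathcal M^p$ over $V$ to the sequence of the elements $1\otimes(s|_{V\cap U_{(i_0)}\cap\cdots\cap U_{(i_l)}})_{(i_0,\dots,i_l)}$, $l\ge0$,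 of $\Omega^0(\Delta^l)\mathbin{\hat\otimes}\Gamma(V,\mathrm C^l(\boldsymbol U,\mathcal M^p))$. **Theorem.** Let $X$ be a noetherian topological space with an open covering $\boldsymbol U=\{U_{(i)}\}_{i=0}^m$, and let $\mathcal M$ be a bounded below complex of complete dir-inv $K_X$-modules. Then: 1. For every open $V\subseteq X$ the homomorphism $\Gamma(V,\int_\Delta):\Gamma(V,\hat{\tilde{\mathrm N}}\mathrm C(\boldsymbol U,\mathcal M))\to\Gamma(V,\mathrm N\mathrm C(\boldsymbol U,\mathcal M))$ is a quasi-isomorphism of complexes of $K$-modules. 2. The terms of $\hat{\tilde{\mathrm N}}\mathrm C(\boldsymbol U,\mathcal M)$ and of $\mathrm N\mathrm C(\boldsymbol U,\mathcal M)$ are sheaves, and the functorial homomorphisms $\mathcal M\to\hat{\tilde{\mathrm N}}\mathrm C(\boldsymbol U,\mathcal M)$ and $\int_\Delta:\hat{\tilde{\mathrm N}}\mathrm C(\boldsymbol U,\mathcal M)\to\mathrm N\mathrm C(\boldsymbol U,\mathcal M)$ are quasi-isomorphisms of complexes of sheaves of $K$-modules. -/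

import Mathlib

open CategoryTheory Opposite Simplicial TensorProduct TopologicalSpace Limits

universe u

noncomputable section

/-! ### Polynomial differential forms on the geometric simplex -/

section Forms

set_option linter.unusedSectionVars false

variable (K : Type u) [Field K] (ι : Type) [Fintype ι]

/-- The ideal `(∑ tᵢ - 1)`. -/
def simplexIdeal : Ideal (MvPolynomial ι K) :=
  Ideal.span {∑ i, MvPolynomial.X i - 1}

/-- The coordinate ring `K[tᵢ]/(∑ tᵢ - 1)` of the geometric simplex with vertex set `ι`. -/
abbrev SimplexRing : Type u := MvPolynomial ι K ⧸ simplexIdeal K ι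

/-- The translation space `{v : ∑ vᵢ = 0}` of the affine space `∑ tᵢ = 1`: the (constant)
tangent space of the geometric simplex. -/
def SimplexTangent : Submodule K (ι → K) :=
  LinearMap.ker (∑ i : ι, (LinearMap.proj i : (ι → K) →ₗ[K] K))

/-- The derivation `∑ vᵢ ∂/∂tᵢ` of `K[tᵢ]`, as a function of `v`. -/
def polyDeriv : (ι → K) →ₗ[K] MvPolynomial ι K →ₗ[K] MvPolynomial ι K :=
  ∑ i : ι, (LinearMap.proj i : (ι → K) →ₗ[K] K).smulRight
    ((MvPolynomial.pderiv i : Derivation K _ _) : MvPolynomial ι K →ₗ[K] MvPolynomial ι K)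

variable {K ι}

theorem mem_simplexTangent {v : ι → K} : v ∈ SimplexTangent K ι ↔ ∑ i, v i = 0 := by
  simp [SimplexTangent]

theorem polyDeriv_apply (v : ι → K) (p : MvPolynomial ι K) :
    polyDeriv K ι v p = ∑ i, v i • MvPolynomial.pderiv i p := by
  simp [polyDeriv]

theorem polyDeriv_mul (v : ι → K) (p q : MvPolynomial ι K) :
    polyDeriv K ι v (p * q) = p * polyDeriv K ι v q + q * polyDeriv K ι v p := by
  simp [polyDeriv_apply, Finset.mul_sum, Finset.sum_add_distrib, smul_add]

theorem polyDeriv_X (v : ι → K) (i : ι) :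
    polyDeriv K ι v (MvPolynomial.X i) = MvPolynomial.C (v i) := by
  classical
  simp [polyDeriv_apply, MvPolynomial.pderiv_X, Pi.single_apply, MvPolynomial.smul_eq_C_mul]

theorem polyDeriv_C (v : ι → K) (c : K) : polyDeriv K ι v (MvPolynomial.C c) = 0 := by
  simp [polyDeriv_apply]

theorem polyDeriv_comm (v w : ι → K) (p : MvPolynomial ι K) :
    polyDeriv K ι v (polyDeriv K ι w p) = polyDeriv K ι w (polyDeriv K ι v p) := by
  induction p using MvPolynomial.induction_on with
  | C a => simp [polyDeriv_C]
  | add p q hp hq => simp only [map_add, hp, hq]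
  | mul_X p i hp =>
    simp only [polyDeriv_mul, map_add, polyDeriv_X, polyDeriv_C, hp]
    ring

theorem polyDeriv_mem (v : SimplexTangent K ι) (p : MvPolynomial ι K)
    (hp : p ∈ simplexIdeal K ι) : polyDeriv K ι v p ∈ simplexIdeal K ι := by
  obtain ⟨a, rfl⟩ := Ideal.mem_span_singleton'.1 hp
  have h1 : polyDeriv K ι v.1 (∑ i, MvPolynomial.X i - 1) = 0 := by
    rw [← MvPolynomial.C_1, map_sub, polyDeriv_C, map_sum]
    simp only [polyDeriv_X]
    rw [← map_sum, mem_simplexTangent.1 v.2]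
    simp
  rw [polyDeriv_mul, h1, mul_zero, zero_add]
  exact Ideal.mul_mem_right _ _ (Ideal.subset_span rfl)

/-- The directional derivative `∂ᵥ` on the coordinate ring, for a fixed tangent vector `v`. -/
def dirDerivAux (v : SimplexTangent K ι) : SimplexRing K ι →ₗ[K] SimplexRing K ι :=
  (Submodule.liftQ ((simplexIdeal K ι).restrictScalars K)
    ((Ideal.Quotient.mkₐ K (simplexIdeal K ι)).toLinearMap ∘ₗ polyDeriv K ι v.1)
    (fun p hp => Ideal.Quotient.eq_zero_iff_mem.2 (polyDeriv_mem v p hp))) ∘ₗ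
      (Submodule.Quotient.restrictScalarsEquiv K (simplexIdeal K ι)).symm.toLinearMap

theorem dirDerivAux_mk (v : SimplexTangent K ι) (p : MvPolynomial ι K) :
    dirDerivAux v (Ideal.Quotient.mk _ p) =
      Ideal.Quotient.mkₐ K (simplexIdeal K ι) (polyDeriv K ι v.1 p) := rfl

variable (K ι) in
/-- The directional derivative `∂ᵥ` on the coordinate ring, linear in the tangent vector `v`. -/
def dirDeriv : SimplexTangent K ι →ₗ[K] SimplexRing K ι →ₗ[K] SimplexRing K ι where
  toFun := dirDerivAux
  map_add' v w := LinearMap.ext fun x => by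
    obtain ⟨p, rfl⟩ := Ideal.Quotient.mk_surjective x
    rw [LinearMap.add_apply, dirDerivAux_mk, dirDerivAux_mk, dirDerivAux_mk, Submodule.coe_add,
      map_add, LinearMap.add_apply, map_add]
  map_smul' c v := LinearMap.ext fun x => by
    obtain ⟨p, rfl⟩ := Ideal.Quotient.mk_surjective x
    rw [RingHom.id_apply, LinearMap.smul_apply, dirDerivAux_mk, dirDerivAux_mk,
      Submodule.coe_smul, map_smul, LinearMap.smul_apply, map_smul]

theorem dirDeriv_mk (v : SimplexTangent K ι) (p : MvPolynomial ι K) :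
    dirDeriv K ι v (Ideal.Quotient.mk _ p) = Ideal.Quotient.mk _ (polyDeriv K ι v.1 p) := rfl

theorem dirDeriv_mul (v : SimplexTangent K ι) (x y : SimplexRing K ι) :
    dirDeriv K ι v (x * y) = x * dirDeriv K ι v y + y * dirDeriv K ι v x := by
  obtain ⟨p, rfl⟩ := Ideal.Quotient.mk_surjective x
  obtain ⟨q, rfl⟩ := Ideal.Quotient.mk_surjective y
  change Ideal.Quotient.mk _ (polyDeriv K ι v.1 (p * q)) =
    Ideal.Quotient.mk _ p * Ideal.Quotient.mk _ (polyDeriv K ι v.1 q) +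
      Ideal.Quotient.mk _ q * Ideal.Quotient.mk _ (polyDeriv K ι v.1 p)
  rw [polyDeriv_mul, map_add, map_mul, map_mul]

theorem dirDeriv_comm (v w : SimplexTangent K ι) (a : SimplexRing K ι) :
    dirDeriv K ι v (dirDeriv K ι w a) = dirDeriv K ι w (dirDeriv K ι v a) := by
  obtain ⟨p, rfl⟩ := Ideal.Quotient.mk_surjective a
  simp only [dirDeriv_mk, polyDeriv_comm]

variable (K ι) in
/-- The module `Ω^q` of polynomial differential `q`-forms on the geometric simplex with vertex
set `ι`: a form is an alternating multilinear function of `q` (constant) tangent vectors with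
values in the coordinate ring; `ω₁ ∧ ⋯ ∧ ω_q` is the function `v ↦ det (ωᵢ(vⱼ))`. -/
abbrev SimplexForm (q : ℕ) : Type u :=
  (SimplexTangent K ι) [⋀^Fin q]→ₗ[K] (SimplexRing K ι)

/-- `v ↦ ∂ᵥ ω`, the derivative of the coefficients of a form. -/
def coeffDeriv {q : ℕ} :
    SimplexForm K ι q →ₗ[K] SimplexTangent K ι →ₗ[K] SimplexForm K ι q where
  toFun ω :=
    { toFun := fun v => (dirDeriv K ι v).compAlternatingMap ω
      map_add' := fun v w => by ext; simp
      map_smul' := fun c v => by ext; simp }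
  map_add' ω η := by ext; simp
  map_smul' c ω := by ext; simp

variable (K ι) in
/-- The exterior derivative,
`(dω)(v₀, …, v_q) = ∑ᵢ (-1)ⁱ ∂_{vᵢ} (ω(v₀, …, v̂ᵢ, …, v_q))`. -/
def extD (q : ℕ) : SimplexForm K ι q →ₗ[K] SimplexForm K ι (q + 1) :=
  AlternatingMap.alternatizeUncurryFinLM ∘ₗ coeffDeriv

theorem extD_apply {q : ℕ} (ω : SimplexForm K ι q) (v : Fin (q + 1) → SimplexTangent K ι) :
    extD K ι q ω v =
      ∑ i : Fin (q + 1), (-1 : ℤ) ^ (i : ℕ) • dirDeriv K ι (v i) (ω (i.removeNth v)) := by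
  simp [extD, AlternatingMap.alternatizeUncurryFin_apply, coeffDeriv]

theorem extD_extD {q : ℕ} (ω : SimplexForm K ι q) : extD K ι (q + 1) (extD K ι q ω) = 0 := by
  have h := AlternatingMap.alternatizeUncurryFin_alternatizeUncurryFinLM_comp_of_symmetric
    (f := coeffDeriv (K := K) (ι := ι) (q := q) ∘ₗ coeffDeriv (K := K) (ι := ι) (q := q) ω) (by
      intro x y
      ext v
      exact dirDeriv_comm y x _)
  rw [← h]
  ext v
  simp only [extD_apply, AlternatingMap.alternatizeUncurryFin_apply]
  refine Finset.sum_congr rfl fun i _ => ?_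
  rw [map_sum]
  simp only [map_zsmul, LinearMap.comp_apply, AlternatingMap.alternatizeUncurryFinLM_apply,
    AlternatingMap.alternatizeUncurryFin_apply]
  congr 1
  refine Finset.sum_congr rfl fun j _ => ?_
  congr 1
  exact dirDeriv_comm _ _ _

variable {κ : Type} [Fintype κ] [DecidableEq ι] [DecidableEq κ]

/-- The linear morphism of simplices that maps the vertex `i` to the vertex `f i`, on coordinate
rings: `tⱼ ↦ ∑_{f i = j} tᵢ`. -/
def simplexRingMap (f : ι → κ) : SimplexRing K κ →ₐ[K] SimplexRing K ι :=
  Ideal.Quotient.liftₐ (simplexIdeal K κ)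
    (MvPolynomial.aeval fun j =>
      Ideal.Quotient.mk (simplexIdeal K ι) (∑ i with f i = j, MvPolynomial.X i)) (by
    intro p hp
    obtain ⟨a, rfl⟩ := Ideal.mem_span_singleton'.1 hp
    have h : (∑ j : κ, Ideal.Quotient.mk (simplexIdeal K ι)
        (∑ i with f i = j, MvPolynomial.X i)) - 1 = 0 := by
      rw [← map_sum, Finset.sum_fiberwise, ← map_one (Ideal.Quotient.mk (simplexIdeal K ι)),
        ← map_sub]
      exact Ideal.Quotient.eq_zero_iff_mem.2 (Ideal.subset_span rfl)
    simp only [map_mul, map_sub, map_sum, MvPolynomial.aeval_X, map_one] at h ⊢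
    rw [h, mul_zero])

/-- The same morphism on tangent vectors: `(f_* v)ⱼ = ∑_{f i = j} vᵢ`. -/
def simplexTangentMap (f : ι → κ) : SimplexTangent K ι →ₗ[K] SimplexTangent K κ where
  toFun v := ⟨fun j => ∑ i with f i = j, v.1 i, by
      rw [mem_simplexTangent, Finset.sum_fiberwise, mem_simplexTangent.1 v.2]⟩
  map_add' v w := by ext; simp [Finset.sum_add_distrib]
  map_smul' c v := by ext; simp [Finset.mul_sum]

theorem simplexTangentMap_apply (f : ι → κ) (v : SimplexTangent K ι) (j : κ) :
    (simplexTangentMap f v).1 j = ∑ i with f i = j, v.1 i := rfl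

theorem simplexRingMap_X (f : ι → κ) (j : κ) :
    simplexRingMap (K := K) f (Ideal.Quotient.mk _ (MvPolynomial.X j)) =
      ∑ i with f i = j, Ideal.Quotient.mk (simplexIdeal K ι) (MvPolynomial.X i) := by
  simp only [simplexRingMap]
  erw [Ideal.Quotient.lift_mk]
  simp only [RingHom.coe_coe, MvPolynomial.aeval_X, map_sum]

theorem simplexRing_hom_ext {R : Type*} [CommRing R] [Algebra K R]
    {φ ψ : SimplexRing K ι →ₐ[K] R}
    (h : ∀ i, φ (Ideal.Quotient.mk _ (MvPolynomial.X i)) =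
      ψ (Ideal.Quotient.mk _ (MvPolynomial.X i))) : φ = ψ := by
  refine Ideal.Quotient.algHom_ext _ ?_
  exact MvPolynomial.algHom_ext h

theorem simplexRingMap_id : simplexRingMap (K := K) (id : ι → ι) = AlgHom.id K _ := by
  refine simplexRing_hom_ext fun i => ?_
  rw [simplexRingMap_X]
  simp [Finset.filter_eq']

theorem simplexRingMap_comp {μ : Type} [Fintype μ] [DecidableEq μ] (g : κ → μ) (f : ι → κ) :
    simplexRingMap (K := K) (g ∘ f) = (simplexRingMap f).comp (simplexRingMap g) := by
  refine simplexRing_hom_ext fun j => ?_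
  rw [AlgHom.comp_apply, simplexRingMap_X, simplexRingMap_X, map_sum]
  simp only [simplexRingMap_X, Function.comp_apply]
  rw [← Finset.sum_fiberwise_of_maps_to (s := Finset.univ.filter fun i => g (f i) = j)
    (t := Finset.univ.filter fun k => g k = j) (g := f) (by simp)]
  refine Finset.sum_congr rfl fun k hk => Finset.sum_congr ?_ fun _ _ => rfl
  ext i
  simp only [Finset.mem_filter, Finset.mem_univ, true_and] at hk ⊢
  constructor
  · rintro ⟨-, h⟩; exact h
  · rintro rfl; exact ⟨hk, rfl⟩

theorem simplexTangentMap_id (v : SimplexTangent K ι) : simplexTangentMap (id : ι → ι) v = v := by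
  ext j
  rw [simplexTangentMap_apply]
  simp [Finset.filter_eq']

theorem simplexTangentMap_comp {μ : Type} [Fintype μ] [DecidableEq μ] (g : κ → μ) (f : ι → κ)
    (v : SimplexTangent K ι) :
    simplexTangentMap (g ∘ f) v = simplexTangentMap g (simplexTangentMap f v) := by
  ext j
  rw [simplexTangentMap_apply, simplexTangentMap_apply]
  simp only [simplexTangentMap_apply, Function.comp_apply]
  rw [← Finset.sum_fiberwise_of_maps_to (s := Finset.univ.filter fun i => g (f i) = j)
    (t := Finset.univ.filter fun k => g k = j) (g := f) (by simp)]
  refine Finset.sum_congr rfl fun k hk => Finset.sum_congr ?_ fun _ _ => rfl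
  ext i
  simp only [Finset.mem_filter, Finset.mem_univ, true_and] at hk ⊢
  constructor
  · rintro ⟨-, h⟩; exact h
  · rintro rfl; exact ⟨hk, rfl⟩

theorem dirDeriv_simplexRingMap (f : ι → κ) (v : SimplexTangent K ι) (a : SimplexRing K κ) :
    dirDeriv K ι v (simplexRingMap f a) =
      simplexRingMap f (dirDeriv K κ (simplexTangentMap f v) a) := by
  have hC : ∀ c : K, dirDeriv K ι v (algebraMap K _ c) = 0 := by
    intro c
    change Ideal.Quotient.mk _ (polyDeriv K ι v (MvPolynomial.C c)) = 0
    rw [polyDeriv_C, map_zero]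
  obtain ⟨p, rfl⟩ := Ideal.Quotient.mk_surjective a
  induction p using MvPolynomial.induction_on with
  | C c =>
    have : (Ideal.Quotient.mk (simplexIdeal K κ)) (MvPolynomial.C c) =
      algebraMap K (SimplexRing K κ) c := rfl
    rw [dirDeriv_mk, polyDeriv_C, map_zero, map_zero, this, AlgHom.commutes, hC]
  | add p q hp hq => simp only [map_add, hp, hq]
  | mul_X p j hp =>
    have hX : dirDeriv K ι v (simplexRingMap f (Ideal.Quotient.mk _ (MvPolynomial.X j))) =
        simplexRingMap f (dirDeriv K κ (simplexTangentMap f v)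
          (Ideal.Quotient.mk _ (MvPolynomial.X j))) := by
      have h1 : dirDeriv K κ (simplexTangentMap f v) (Ideal.Quotient.mk _ (MvPolynomial.X j)) =
          algebraMap K (SimplexRing K κ) ((simplexTangentMap f v).1 j) := by
        rw [dirDeriv_mk, polyDeriv_X]; rfl
      have h2 : ∀ i, dirDeriv K ι v (Ideal.Quotient.mk _ (MvPolynomial.X i)) =
          algebraMap K (SimplexRing K ι) (v.1 i) := fun i => by
        rw [dirDeriv_mk, polyDeriv_X]; rfl
      rw [h1, AlgHom.commutes, simplexTangentMap_apply, simplexRingMap_X, map_sum, map_sum]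
      exact Finset.sum_congr rfl fun i _ => h2 i
    rw [map_mul, map_mul, dirDeriv_mul, dirDeriv_mul, hp, hX, map_add, map_mul, map_mul]

variable (K) in
/-- Pullback of forms along the linear morphism of simplices determined by `f`. -/
def formPullback (f : ι → κ) (q : ℕ) : SimplexForm K κ q →ₗ[K] SimplexForm K ι q where
  toFun ω := (simplexRingMap f).toLinearMap.compAlternatingMap
    (ω.compLinearMap (simplexTangentMap f))
  map_add' ω η := by ext; simp
  map_smul' c ω := by ext; simp

theorem formPullback_apply (f : ι → κ) {q : ℕ} (ω : SimplexForm K κ q)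
    (v : Fin q → SimplexTangent K ι) :
    formPullback K f q ω v = simplexRingMap f (ω fun i => simplexTangentMap f (v i)) := rfl

theorem formPullback_id (q : ℕ) : formPullback K (id : ι → ι) q = LinearMap.id := by
  ext ω v
  simp [formPullback_apply, simplexRingMap_id, simplexTangentMap_id]

theorem formPullback_comp {μ : Type} [Fintype μ] [DecidableEq μ] (g : κ → μ) (f : ι → κ) (q : ℕ) :
    formPullback K (g ∘ f) q = formPullback K f q ∘ₗ formPullback K g q := by
  ext ω v
  simp [formPullback_apply, simplexRingMap_comp, simplexTangentMap_comp]

theorem extD_formPullback (f : ι → κ) (q : ℕ) (ω : SimplexForm K κ q) :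
    extD K ι q (formPullback K f q ω) = formPullback K f (q + 1) (extD K κ q ω) := by
  ext v
  simp only [extD_apply, formPullback_apply, dirDeriv_simplexRingMap, map_sum, map_zsmul]
  rfl

variable (K) in
/-- Integration over the standard `l`-simplex (with coordinates `t₁, …, t_l`) on polynomials:
`∫ t₀^{a₀} ⋯ t_l^{a_l} dt₁ ⋯ dt_l = a₀! ⋯ a_l! / (a₀ + ⋯ + a_l + l)!`. -/
def polyIntegral (l : ℕ) : MvPolynomial (Fin (l + 1)) K →ₗ[K] K :=
  (MvPolynomial.basisMonomials (Fin (l + 1)) K).constr K fun a =>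
    (∏ i, ((a i).factorial : K)) / (((∑ i, a i) + l).factorial : K)

theorem polyIntegral_monomial (l : ℕ) (a : Fin (l + 1) →₀ ℕ) (c : K) :
    polyIntegral K l (MvPolynomial.monomial a c) =
      c * ((∏ i, ((a i).factorial : K)) / (((∑ i, a i) + l).factorial : K)) := by
  have h := (MvPolynomial.basisMonomials (Fin (l + 1)) K).constr_basis K (fun a =>
    (∏ i, ((a i).factorial : K)) / (((∑ i, a i) + l).factorial : K)) a
  rw [MvPolynomial.coe_basisMonomials] at h
  have h2 : MvPolynomial.monomial a c = c • MvPolynomial.monomial a (1 : K) := by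
    rw [MvPolynomial.smul_monomial, smul_eq_mul, mul_one]
  rw [h2, map_smul, smul_eq_mul]
  exact congrArg (c * ·) h

theorem prod_factorial_add_single {l : ℕ} (a : Fin (l + 1) →₀ ℕ) (i : Fin (l + 1)) :
    (∏ k, (((a + Finsupp.single i 1 : Fin (l + 1) →₀ ℕ) k).factorial : K)) =
      ((a i : K) + 1) * ∏ k, ((a k).factorial : K) := by
  rw [← Finset.mul_prod_erase Finset.univ _ (Finset.mem_univ i),
    ← Finset.mul_prod_erase Finset.univ (fun k => ((a k).factorial : K)) (Finset.mem_univ i),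
    ← mul_assoc]
  congr 1
  · simp [Nat.factorial_succ]
  · refine Finset.prod_congr rfl fun k hk => ?_
    have : k ≠ i := Finset.ne_of_mem_erase hk
    simp [this.symm]

theorem sum_add_single {l : ℕ} (a : Fin (l + 1) →₀ ℕ) (i : Fin (l + 1)) :
    ∑ k, (a + Finsupp.single i 1 : Fin (l + 1) →₀ ℕ) k = (∑ k, a k) + 1 := by
  simp [Finset.sum_add_distrib, Finsupp.single_apply]

variable [CharZero K]

theorem polyIntegral_mem (l : ℕ) (p : MvPolynomial (Fin (l + 1)) K)
    (hp : p ∈ simplexIdeal K (Fin (l + 1))) : polyIntegral K l p = 0 := by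
  obtain ⟨b, rfl⟩ := Ideal.mem_span_singleton'.1 hp
  clear hp
  induction b using MvPolynomial.induction_on' with
  | add p q hp hq =>
    rw [add_mul, map_add, hp, hq, add_zero]
  | monomial a c =>
    have h : ∀ i : Fin (l + 1), MvPolynomial.monomial a c * MvPolynomial.X i =
        MvPolynomial.monomial (a + Finsupp.single i 1) c := fun i => by
      rw [MvPolynomial.X, MvPolynomial.monomial_mul, mul_one]
    rw [mul_sub, mul_one, Finset.mul_sum, map_sub, map_sum]
    simp only [h, polyIntegral_monomial, prod_factorial_add_single, sum_add_single]
    rw [← Finset.mul_sum, ← Finset.sum_div, ← Finset.sum_mul, sub_eq_zero]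
    congr 1
    have e : (∑ k, a k) + 1 + l = ((∑ k, a k) + l) + 1 := by ring
    have h1 : (((∑ k, a k) + l).factorial : K) ≠ 0 := Nat.cast_ne_zero.2 (Nat.factorial_ne_zero _)
    have h2 : (((∑ k, a k) + l : ℕ) : K) + 1 ≠ 0 := Nat.cast_add_one_ne_zero _
    rw [e, Nat.factorial_succ, Finset.sum_add_distrib]
    push_cast at h2 ⊢
    simp only [Finset.sum_const, Finset.card_univ, Fintype.card_fin, nsmul_eq_mul, mul_one]
    push_cast
    have e2 : (∑ x, (a x : K)) + (l + 1) = (∑ x, (a x : K)) + l + 1 := by ring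
    rw [e2, mul_div_mul_left _ _ h2]

variable (K) in
/-- Integration over the standard `l`-simplex, on the coordinate ring. -/
def ringIntegral (l : ℕ) : SimplexRing K (Fin (l + 1)) →ₗ[K] K :=
  Submodule.liftQ ((simplexIdeal K (Fin (l + 1))).restrictScalars K) (polyIntegral K l)
    (fun p hp => polyIntegral_mem l p hp) ∘ₗ
      (Submodule.Quotient.restrictScalarsEquiv K (simplexIdeal K (Fin (l + 1)))).symm.toLinearMap

theorem ringIntegral_mk (l : ℕ) (p : MvPolynomial (Fin (l + 1)) K) :
    ringIntegral K l (Ideal.Quotient.mk _ p) = polyIntegral K l p := rfl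

variable (K) in
/-- The tangent vector `e_j - e_i` from the vertex `i` to the vertex `j`. -/
def edgeVec (i j : ι) : SimplexTangent K ι :=
  ⟨Pi.single j 1 - Pi.single i 1, by simp [mem_simplexTangent, Finset.sum_sub_distrib]⟩

variable (K) in
/-- The integral `∫_{Δ^l} : Ω^l(Δ^l) → K` of top forms: the coefficient `f` of
`ω = f dt₁ ∧ ⋯ ∧ dt_l` is `ω(e₁ - e₀, …, e_l - e₀)`. -/
def formIntegral (l : ℕ) : SimplexForm K (Fin (l + 1)) l →ₗ[K] K where
  toFun ω := ringIntegral K l (ω fun i : Fin l => edgeVec K 0 i.succ)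
  map_add' ω η := by simp
  map_smul' c ω := by simp

theorem simplexTangentMap_edgeVec (f : ι → κ) (i j : ι) :
    simplexTangentMap f (edgeVec K i j) = edgeVec K (f i) (f j) := by
  ext k
  rw [simplexTangentMap_apply]
  simp [edgeVec, Finset.sum_sub_distrib, Pi.single_apply, eq_comm]

theorem edgeVec_sub (i j k : ι) : edgeVec K j k = edgeVec K i k - edgeVec K i j := by
  ext; simp [edgeVec]

/-- Restriction to the face `t_b = 0` followed by integration, on monomials. -/
theorem ringIntegral_face (l : ℕ) (b : Fin (l + 2)) (a : Fin (l + 2) →₀ ℕ) (c : K) :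
    ringIntegral K l (simplexRingMap b.succAbove
        (Ideal.Quotient.mk _ (MvPolynomial.monomial a c))) =
      if a b = 0 then c * ((∏ i, ((a i).factorial : K)) / (((∑ i, a i) + l).factorial : K))
      else 0 := by
  have hb : simplexRingMap (K := K) b.succAbove (Ideal.Quotient.mk _ (MvPolynomial.X b)) = 0 := by
    rw [simplexRingMap_X]
    exact Finset.sum_eq_zero fun i hi => absurd (Finset.mem_filter.1 hi).2 (Fin.succAbove_ne b i)
  have hX : ∀ i, simplexRingMap (K := K) b.succAbove
      (Ideal.Quotient.mk _ (MvPolynomial.X (b.succAbove i))) =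
        Ideal.Quotient.mk _ (MvPolynomial.X i) := fun i => by
    rw [simplexRingMap_X]
    simp [Finset.filter_eq']
  have hm : MvPolynomial.monomial a c =
      MvPolynomial.C c * ∏ i, (MvPolynomial.X i : MvPolynomial (Fin (l + 2)) K) ^ a i := by
    rw [MvPolynomial.monomial_eq, Finsupp.prod_fintype _ _ (by simp)]
  have hC : simplexRingMap (K := K) b.succAbove (Ideal.Quotient.mk _ (MvPolynomial.C c)) =
      Ideal.Quotient.mk _ (MvPolynomial.C c) := AlgHom.commutes _ c
  have key : simplexRingMap (K := K) b.succAbove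
      (Ideal.Quotient.mk _ (MvPolynomial.monomial a c)) =
        if a b = 0 then Ideal.Quotient.mk _ (MvPolynomial.monomial
          (Finsupp.equivFunOnFinite.symm fun i => a (b.succAbove i)) c) else 0 := by
    rw [hm, map_mul, map_mul, hC, map_prod, map_prod, Fin.prod_univ_succAbove _ b]
    simp only [map_pow, hb, hX]
    split_ifs with h
    · rw [h, pow_zero, one_mul, MvPolynomial.monomial_eq, Finsupp.prod_fintype _ _ (by simp),
        map_mul, map_prod]
      simp only [map_pow]
      rfl
    · rw [zero_pow h, zero_mul, mul_zero]
  rw [key]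
  split_ifs with h
  · rw [ringIntegral_mk, polyIntegral_monomial, Fin.prod_univ_succAbove _ b,
      Fin.sum_univ_succAbove _ b, h]
    simp
  · rw [map_zero]

theorem polyIntegral_pderiv (l : ℕ) (j : Fin (l + 2)) (a : Fin (l + 2) →₀ ℕ) (c : K) :
    polyIntegral K (l + 1) (MvPolynomial.pderiv j (MvPolynomial.monomial a c)) =
      if a j = 0 then 0
      else c * ((∏ i, ((a i).factorial : K)) / (((∑ i, a i) + l).factorial : K)) := by
  rw [MvPolynomial.pderiv_monomial]
  split_ifs with h
  · simp [h]
  · obtain ⟨a', rfl⟩ : ∃ a', a = a' + Finsupp.single j 1 :=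
      ⟨a - Finsupp.single j 1, (tsub_add_cancel_of_le (by
        rw [Finsupp.single_le_iff]; omega)).symm⟩
    rw [polyIntegral_monomial, add_tsub_cancel_right, prod_factorial_add_single, sum_add_single]
    have e : (∑ k, a' k) + 1 + l = (∑ k, a' k) + (l + 1) := by ring
    rw [e]
    simp
    ring

theorem ringIntegral_dirDeriv (l : ℕ) (i j : Fin (l + 2)) (x : SimplexRing K (Fin (l + 2))) :
    ringIntegral K (l + 1) (dirDeriv K _ (edgeVec K i j) x) =
      ringIntegral K l (simplexRingMap i.succAbove x) -
        ringIntegral K l (simplexRingMap j.succAbove x) := by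
  obtain ⟨p, rfl⟩ := Ideal.Quotient.mk_surjective x
  have hd : ∀ p, polyDeriv K (Fin (l + 2)) (edgeVec K i j).1 p =
      MvPolynomial.pderiv j p - MvPolynomial.pderiv i p := fun p => by
    simp [polyDeriv_apply, edgeVec, Pi.single_apply]
  rw [dirDeriv_mk, ringIntegral_mk, hd]
  induction p using MvPolynomial.induction_on' with
  | add p q hp hq =>
    simp only [map_add] at hp hq ⊢
    rw [add_sub_add_comm, map_add, hp, hq]
    ring
  | monomial a c =>
    rw [map_sub, polyIntegral_pderiv, polyIntegral_pderiv, ringIntegral_face, ringIntegral_face]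
    split_ifs <;> ring

theorem alternating_sub_const {T A : Type*} [AddCommGroup T] [Module K T] [AddCommGroup A]
    [Module K A] {l : ℕ} (ω : T [⋀^Fin l]→ₗ[K] A) (μ : T →ₗ[K] K) (v : Fin (l + 1) → T)
    (hv : ∀ i, μ (v i) = 1) :
    ω (fun k => v k.succ - v 0) = ∑ i : Fin (l + 1), (-1 : ℤ) ^ (i : ℕ) • ω (i.removeNth v) := by
  let g : T [⋀^Fin (l + 1)]→ₗ[K] A := AlternatingMap.alternatizeUncurryFin (μ.smulRight ω)
  have hg : ∀ w, g w = ∑ i : Fin (l + 1), (-1 : ℤ) ^ (i : ℕ) • μ (w i) • ω (i.removeNth w) :=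
    fun w => AlternatingMap.alternatizeUncurryFin_apply _ w
  have h1 : g v = ∑ i : Fin (l + 1), (-1 : ℤ) ^ (i : ℕ) • ω (i.removeNth v) := by
    rw [hg]; simp only [hv, one_smul]
  let G := g.curryLeft (v 0)
  have hG : ∀ s : Finset (Fin l),
      G (s.piecewise (fun k => v k.succ - v 0) fun k => v k.succ) = G fun k => v k.succ := by
    intro s
    induction s using Finset.induction_on with
    | empty => simp
    | insert j s hj ih =>
      rw [Finset.piecewise_insert, AlternatingMap.map_update_sub]
      have e1 : Function.update (s.piecewise (fun k => v k.succ - v 0) fun k => v k.succ) j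
          (v j.succ) = s.piecewise (fun k => v k.succ - v 0) fun k => v k.succ := by
        rw [Function.update_eq_self_iff, Finset.piecewise_eq_of_notMem _ _ _ hj]
      rw [e1, ih, sub_eq_self]
      refine g.map_eq_zero_of_eq _ (i := 0) (j := j.succ) ?_ (Fin.succ_ne_zero j).symm
      simp
  have h2 : G (fun k => v k.succ - v 0) = g v := by
    have := hG Finset.univ
    rw [Finset.piecewise_univ] at this
    rw [this]
    exact congrArg g (Fin.cons_self_tail v)
  rw [← h1, ← h2]
  change _ = g (Matrix.vecCons (v 0) fun k => v k.succ - v 0)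
  rw [hg, Fin.sum_univ_succ]
  have h3 : ∀ k : Fin l, μ (v k.succ - v 0) = 0 := fun k => by rw [map_sub, hv, hv, sub_self]
  simp [h3, hv]

/-- Stokes' theorem on the standard simplex. -/
theorem formIntegral_extD (l : ℕ) (ω : SimplexForm K (Fin (l + 2)) l) :
    formIntegral K (l + 1) (extD K _ l ω) =
      ∑ i : Fin (l + 2), (-1 : ℤ) ^ (i : ℕ) • formIntegral K l (formPullback K i.succAbove l ω) := by
  let v : Fin (l + 1) → SimplexTangent K (Fin (l + 2)) := fun i => edgeVec K 0 i.succ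
  have hL : formIntegral K (l + 1) (extD K _ l ω) = ∑ i : Fin (l + 1), (-1 : ℤ) ^ (i : ℕ) •
      (ringIntegral K l (simplexRingMap (0 : Fin (l + 2)).succAbove (ω (i.removeNth v))) -
        ringIntegral K l (simplexRingMap i.succ.succAbove (ω (i.removeNth v)))) := by
    change ringIntegral K (l + 1) (extD K _ l ω v) = _
    rw [extD_apply, map_sum]
    refine Finset.sum_congr rfl fun i _ => ?_
    rw [map_zsmul, ringIntegral_dirDeriv]
  have h0 : formIntegral K l (formPullback K (0 : Fin (l + 2)).succAbove l ω) =
      ∑ i : Fin (l + 1), (-1 : ℤ) ^ (i : ℕ) •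
        ringIntegral K l (simplexRingMap (0 : Fin (l + 2)).succAbove (ω (i.removeNth v))) := by
    change ringIntegral K l (simplexRingMap _ (ω _)) = _
    have e : (fun k : Fin l => simplexTangentMap (0 : Fin (l + 2)).succAbove
        (edgeVec K 0 k.succ)) = fun k => v k.succ - v 0 := by
      funext k
      rw [simplexTangentMap_edgeVec, edgeVec_sub 0]
      simp [v]
    rw [e, alternating_sub_const ω
      (-((LinearMap.proj 0 : (Fin (l + 2) → K) →ₗ[K] K) ∘ₗ (SimplexTangent K _).subtype)) v
      (fun i => by simp [v, edgeVec])]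
    simp only [map_sum, map_zsmul]
  have hs : ∀ i : Fin (l + 1), formIntegral K l (formPullback K i.succ.succAbove l ω) =
      ringIntegral K l (simplexRingMap i.succ.succAbove (ω (i.removeNth v))) := by
    intro i
    change ringIntegral K l (simplexRingMap _ (ω _)) = _
    congr 3
    funext k
    rw [simplexTangentMap_edgeVec]
    simp [v, Fin.removeNth_apply]
  rw [hL, Fin.sum_univ_succ (n := l + 1), h0]
  simp only [hs, smul_sub, Finset.sum_sub_distrib]
  simp [pow_succ, sub_eq_add_neg]

theorem formIntegral_degenerate (l : ℕ) (f : Fin (l + 1) → ι) (hf : ¬ Function.Injective f)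
    (ω : SimplexForm K ι l) : formIntegral K l (formPullback K f l ω) = 0 := by
  change ringIntegral K l (simplexRingMap _ (ω fun k => simplexTangentMap f (edgeVec K 0 k.succ))) = 0
  simp only [simplexTangentMap_edgeVec]
  suffices h : (ω fun k : Fin l => edgeVec K (f 0) (f k.succ)) = 0 by rw [h, map_zero, map_zero]
  have h0 : ∀ k : Fin l, f k.succ = f 0 → (ω fun k : Fin l => edgeVec K (f 0) (f k.succ)) = 0 :=
    fun k hk => ω.map_coord_zero k (by ext; simp [hk, edgeVec])
  simp only [Function.Injective, not_forall] at hf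
  obtain ⟨a, b, hab, hne⟩ := hf
  induction a using Fin.cases with
  | zero =>
    induction b using Fin.cases with
    | zero => exact absurd rfl hne
    | succ b => exact h0 b hab.symm
  | succ a =>
    induction b using Fin.cases with
    | zero => exact h0 a hab
    | succ b =>
      exact ω.map_eq_zero_of_eq _ (i := a) (j := b) (by simp [hab]) (fun h => hne (by rw [h]))

end Forms

/-! ### Dir-inv modules -/

/-- A dir-inv `K`-module: a `K`-module with a direct system of submodules `F j`, indexed by a
nonempty directed set `J`, each with an inverse system `G j 0 ⊇ G j 1 ⊇ ⋯` of submodules of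
`F j`, such that the inclusions `F j₁ ↪ F j₂` are continuous. -/
structure DirInvMod (K : Type u) [CommRing K] where
  carrier : Type u
  [addCommGroup : AddCommGroup carrier]
  [module : Module K carrier]
  J : Type u
  [partialOrder : PartialOrder J]
  [directed : IsDirectedOrder J]
  [nonempty : Nonempty J]
  F : J → Submodule K carrier
  mono : Monotone F
  G : J → ℕ → Submodule K carrier
  G_le : ∀ j i, G j i ≤ F j
  anti : ∀ j, Antitone (G j)
  incl : ∀ j₁ j₂, j₁ ≤ j₂ → ∀ i, ∃ i', G j₁ i' ≤ G j₂ i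

attribute [instance] DirInvMod.addCommGroup DirInvMod.module DirInvMod.partialOrder
  DirInvMod.directed DirInvMod.nonempty

namespace DirInvMod

variable {K : Type u} [CommRing K]

instance : CoeSort (DirInvMod K) (Type u) := ⟨carrier⟩

/-- A morphism of dir-inv modules is a continuous linear map. -/
@[ext]
structure Hom (M N : DirInvMod K) where
  lin : M →ₗ[K] N
  cont : ∀ j, ∃ k, (∀ x ∈ M.F j, lin x ∈ N.F k) ∧ ∀ i, ∃ i', ∀ x ∈ M.G j i', lin x ∈ N.G k i

instance : Category (DirInvMod K) where
  Hom := Hom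
  id M := ⟨LinearMap.id, fun j => ⟨j, fun _ h => h, fun i => ⟨i, fun _ h => h⟩⟩⟩
  comp {M N P} f g := ⟨g.lin ∘ₗ f.lin, fun j => by
    obtain ⟨k, hk, hk'⟩ := f.cont j
    obtain ⟨l, hl, hl'⟩ := g.cont k
    refine ⟨l, fun x hx => hl _ (hk x hx), fun i => ?_⟩
    obtain ⟨i', h'⟩ := hl' i
    obtain ⟨i'', h''⟩ := hk' i'
    exact ⟨i'', fun x hx => h' _ (h'' x hx)⟩⟩

@[ext]
theorem hom_ext {M N : DirInvMod K} {f g : M ⟶ N} (h : ∀ x, f.lin x = g.lin x) : f = g :=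
  Hom.ext (LinearMap.ext h)

@[simp] theorem id_lin (M : DirInvMod K) : Hom.lin (𝟙 M) = LinearMap.id := rfl

@[simp] theorem comp_lin {M N P : DirInvMod K} (f : M ⟶ N) (g : N ⟶ P) :
    (f ≫ g).lin = g.lin ∘ₗ f.lin := rfl

/-- The functor that forgets the dir-inv structure. -/
def forget : DirInvMod K ⥤ ModuleCat.{u} K where
  obj M := ModuleCat.of K M
  map f := ModuleCat.ofHom f.lin

/-- A module `A` viewed as a discrete inv module: `J` is a point, `F = A` and all `G i` are `0`. -/
abbrev discrete (A : Type u) [AddCommGroup A] [Module K A] : DirInvMod K where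
  carrier := A
  J := PUnit
  F _ := ⊤
  mono _ _ _ := le_rfl
  G _ _ := ⊥
  G_le _ _ := bot_le
  anti _ _ _ _ := le_rfl
  incl _ _ _ _ := ⟨0, le_rfl⟩

/-- A linear map of modules, as a morphism of discrete inv modules. -/
def discreteMap {A B : Type u} [AddCommGroup A] [Module K A] [AddCommGroup B] [Module K B]
    (f : A →ₗ[K] B) : discrete (K := K) A ⟶ discrete B where
  lin := f
  cont _ := ⟨PUnit.unit, fun _ _ => Submodule.mem_top, fun _ => ⟨0, fun x hx => by
    obtain rfl : x = 0 := hx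
    exact (map_zero f : f 0 = 0)⟩⟩

/-- The tensor product of dir-inv modules: `F (j, k)` is the image of `F j ⊗ F k`, and
`G (j, k) i` is the sum of the images of `G j i ⊗ F k` and `F j ⊗ G k i`. -/
abbrev tensor (M N : DirInvMod K) : DirInvMod K where
  carrier := M ⊗[K] N
  J := M.J × N.J
  partialOrder := Prod.instPartialOrder _ _
  directed := ⟨fun a b => by
    obtain ⟨c, hc⟩ := exists_ge_ge a.1 b.1
    obtain ⟨d, hd⟩ := exists_ge_ge a.2 b.2
    exact ⟨(c, d), ⟨hc.1, hd.1⟩, ⟨hc.2, hd.2⟩⟩⟩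
  F jk := Submodule.map₂ (TensorProduct.mk K M N) (M.F jk.1) (N.F jk.2)
  mono _ _ h := Submodule.map₂_le_map₂ (M.mono h.1) (N.mono h.2)
  G jk i := Submodule.map₂ (TensorProduct.mk K M N) (M.G jk.1 i) (N.F jk.2) ⊔
    Submodule.map₂ (TensorProduct.mk K M N) (M.F jk.1) (N.G jk.2 i)
  G_le jk i := sup_le (Submodule.map₂_le_map₂ (M.G_le _ _) le_rfl)
    (Submodule.map₂_le_map₂ le_rfl (N.G_le _ _))
  anti jk _ _ h := sup_le_sup (Submodule.map₂_le_map₂ (M.anti _ h) le_rfl)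
    (Submodule.map₂_le_map₂ le_rfl (N.anti _ h))
  incl jk jk' h i := by
    obtain ⟨i₁, h₁⟩ := M.incl _ _ h.1 i
    obtain ⟨i₂, h₂⟩ := N.incl _ _ h.2 i
    refine ⟨max i₁ i₂, sup_le_sup (Submodule.map₂_le_map₂ ?_ (N.mono h.2))
      (Submodule.map₂_le_map₂ (M.mono h.1) ?_)⟩
    · exact (M.anti _ (le_max_left _ _)).trans h₁
    · exact (N.anti _ (le_max_right _ _)).trans h₂

/-- The tensor product of two continuous linear maps. -/
def tensorMap {M M' N N' : DirInvMod K} (f : M ⟶ M') (g : N ⟶ N') :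
    tensor M N ⟶ tensor M' N' where
  lin := TensorProduct.map f.lin g.lin
  cont jk := by
    have key : ∀ (A A' : Submodule K M) (B B' : Submodule K N) (C : Submodule K M')
        (D : Submodule K N'), (∀ x ∈ A, f.lin x ∈ C) → (∀ y ∈ B, g.lin y ∈ D) →
        Submodule.map₂ (TensorProduct.mk K M N) A B ≤
          (Submodule.map₂ (TensorProduct.mk K M' N') C D).comap
            (TensorProduct.map f.lin g.lin) := by
      intro A A' B B' C D hA hB
      refine Submodule.map₂_le.2 fun x hx y hy => ?_
      exact Submodule.apply_mem_map₂ (TensorProduct.mk K M' N') (hA x hx) (hB y hy)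
    obtain ⟨j', hj, hj'⟩ := f.cont jk.1
    obtain ⟨k', hk, hk'⟩ := g.cont jk.2
    refine ⟨(j', k'), fun x hx => key _ ⊥ _ ⊥ _ _ hj hk hx, fun i => ?_⟩
    obtain ⟨i₁, h₁⟩ := hj' i
    obtain ⟨i₂, h₂⟩ := hk' i
    refine ⟨max i₁ i₂, fun x hx => ?_⟩
    refine (sup_le (a := Submodule.map₂ (TensorProduct.mk K M N) (M.G jk.1 _) (N.F jk.2))
      (c := Submodule.comap (TensorProduct.map f.lin g.lin) ((tensor M' N').G (j', k') i))
      ?_ ?_) hx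
    · exact (key _ ⊥ _ ⊥ _ _ (fun x hx => h₁ x (M.anti _ (le_max_left _ _) hx)) hk).trans
        (Submodule.comap_mono le_sup_left)
    · exact (key _ ⊥ _ ⊥ _ _ hj (fun x hx => h₂ x (N.anti _ (le_max_right _ _) hx))).trans
        (Submodule.comap_mono le_sup_right)

/-- The product of finitely many dir-inv modules. -/
abbrev pi {T : Type} [Finite T] (M : T → DirInvMod K) : DirInvMod K where
  carrier := ∀ t, M t
  J := ∀ t, (M t).J
  partialOrder := Pi.partialOrder
  directed := ⟨fun a b => by
    choose c hc using fun t => exists_ge_ge (a t) (b t)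
    exact ⟨c, fun t => (hc t).1, fun t => (hc t).2⟩⟩
  F j := Submodule.pi Set.univ fun t => (M t).F (j t)
  mono _ _ h _ hx t ht := (M t).mono (h t) (hx t ht)
  G j i := Submodule.pi Set.univ fun t => (M t).G (j t) i
  G_le j i _ hx t ht := (M t).G_le (j t) i (hx t ht)
  anti j _ _ h _ hx t ht := (M t).anti (j t) h (hx t ht)
  incl j j' h i := by
    choose i' hi' using fun t => (M t).incl (j t) (j' t) (h t) i
    obtain ⟨n, hn⟩ := (Set.finite_range i').bddAbove
    exact ⟨n, fun x hx t ht => hi' t ((M t).anti _ (hn ⟨t, rfl⟩) (hx t ht))⟩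

/-! ### Completion -/

/-- The sequences in `M` that lie in some `F j` and are Cauchy for its filtration `G j`. -/
def cauchy (M : DirInvMod K) : Submodule K (ℕ → M) where
  carrier := {x | ∃ j, (∀ n, x n ∈ M.F j) ∧ ∀ i, ∃ n₀, ∀ n ≥ n₀, x n - x n₀ ∈ M.G j i}
  zero_mem' := ⟨Classical.arbitrary _, by simp⟩
  add_mem' := by
    rintro x y ⟨j, hj, hj'⟩ ⟨k, hk, hk'⟩
    obtain ⟨l, hjl, hkl⟩ := exists_ge_ge j k
    refine ⟨l, fun n => add_mem (M.mono hjl (hj n)) (M.mono hkl (hk n)), fun i => ?_⟩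
    obtain ⟨i₁, h₁⟩ := M.incl _ _ hjl i
    obtain ⟨i₂, h₂⟩ := M.incl _ _ hkl i
    obtain ⟨n₁, hn₁⟩ := hj' i₁
    obtain ⟨n₂, hn₂⟩ := hk' i₂
    refine ⟨max n₁ n₂, fun n hn => ?_⟩
    have e : (x + y) n - (x + y) (max n₁ n₂) = ((x n - x n₁) - (x (max n₁ n₂) - x n₁)) +
        ((y n - y n₂) - (y (max n₁ n₂) - y n₂)) := by
      simp only [Pi.add_apply]; abel
    rw [e]
    exact add_mem
      (h₁ (sub_mem (hn₁ n (le_of_max_le_left hn)) (hn₁ _ (le_max_left _ _))))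
      (h₂ (sub_mem (hn₂ n (le_of_max_le_right hn)) (hn₂ _ (le_max_right _ _))))
  smul_mem' := by
    rintro c x ⟨j, hj, hj'⟩
    refine ⟨j, fun n => Submodule.smul_mem _ _ (hj n), fun i => ?_⟩
    obtain ⟨n₀, hn₀⟩ := hj' i
    refine ⟨n₀, fun n hn => ?_⟩
    simp only [Pi.smul_apply, ← smul_sub]
    exact Submodule.smul_mem _ _ (hn₀ n hn)

/-- The sequences in `M` that lie in some `F j` and tend to `0` for its filtration `G j`. -/
def null (M : DirInvMod K) : Submodule K (ℕ → M) where
  carrier := {x | ∃ j, (∀ n, x n ∈ M.F j) ∧ ∀ i, ∃ n₀, ∀ n ≥ n₀, x n ∈ M.G j i}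
  zero_mem' := ⟨Classical.arbitrary _, by simp⟩
  add_mem' := by
    rintro x y ⟨j, hj, hj'⟩ ⟨k, hk, hk'⟩
    obtain ⟨l, hjl, hkl⟩ := exists_ge_ge j k
    refine ⟨l, fun n => add_mem (M.mono hjl (hj n)) (M.mono hkl (hk n)), fun i => ?_⟩
    obtain ⟨i₁, h₁⟩ := M.incl _ _ hjl i
    obtain ⟨i₂, h₂⟩ := M.incl _ _ hkl i
    obtain ⟨n₁, hn₁⟩ := hj' i₁
    obtain ⟨n₂, hn₂⟩ := hk' i₂
    exact ⟨max n₁ n₂, fun n hn => add_mem (h₁ (hn₁ n (le_of_max_le_left hn)))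
      (h₂ (hn₂ n (le_of_max_le_right hn)))⟩
  smul_mem' := by
    rintro c x ⟨j, hj, hj'⟩
    refine ⟨j, fun n => Submodule.smul_mem _ _ (hj n), fun i => ?_⟩
    obtain ⟨n₀, hn₀⟩ := hj' i
    exact ⟨n₀, fun n hn => Submodule.smul_mem _ _ (hn₀ n hn)⟩

/-- The completion of a dir-inv module, `lim_{j →} lim_{← i} F j / G j i`. The inverse limit over
`i` consists of the Cauchy sequences in `F j` modulo the null sequences in `F j`, and so the direct
limit over `j` consists of the sequences that are Cauchy in some `F j` modulo those that are null
in some `F j`. -/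
def Completion (M : DirInvMod K) : Type u :=
  M.cauchy ⧸ M.null.comap M.cauchy.subtype

instance (M : DirInvMod K) : AddCommGroup M.Completion :=
  inferInstanceAs (AddCommGroup (M.cauchy ⧸ M.null.comap M.cauchy.subtype))

instance (M : DirInvMod K) : Module K M.Completion :=
  inferInstanceAs (Module K (M.cauchy ⧸ M.null.comap M.cauchy.subtype))

theorem Hom.cauchy {M N : DirInvMod K} (f : M ⟶ N) {x : ℕ → M} (hx : x ∈ M.cauchy) :
    (fun n => f.lin (x n)) ∈ N.cauchy := by
  obtain ⟨j, hj, hj'⟩ := hx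
  obtain ⟨k, hk, hk'⟩ := f.cont j
  refine ⟨k, fun n => hk _ (hj n), fun i => ?_⟩
  obtain ⟨i', hi'⟩ := hk' i
  obtain ⟨n₀, hn₀⟩ := hj' i'
  refine ⟨n₀, fun n hn => ?_⟩
  rw [← map_sub]
  exact hi' _ (hn₀ n hn)

theorem Hom.null {M N : DirInvMod K} (f : M ⟶ N) {x : ℕ → M} (hx : x ∈ M.null) :
    (fun n => f.lin (x n)) ∈ N.null := by
  obtain ⟨j, hj, hj'⟩ := hx
  obtain ⟨k, hk, hk'⟩ := f.cont j
  refine ⟨k, fun n => hk _ (hj n), fun i => ?_⟩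
  obtain ⟨i', hi'⟩ := hk' i
  obtain ⟨n₀, hn₀⟩ := hj' i'
  exact ⟨n₀, fun n hn => hi' _ (hn₀ n hn)⟩

/-- The map of completions induced by a continuous linear map. -/
def completionMap {M N : DirInvMod K} (f : M ⟶ N) : M.Completion →ₗ[K] N.Completion :=
  Submodule.mapQ (M.null.comap M.cauchy.subtype) (N.null.comap N.cauchy.subtype)
    ((f.lin.compLeft ℕ).restrict (p := M.cauchy) (q := N.cauchy) fun _ hx => Hom.cauchy f hx)
    fun _ hx => Hom.null f hx

/-- The class of a Cauchy sequence in the completion. -/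
def Completion.mk {M : DirInvMod K} (x : ℕ → M) (hx : x ∈ M.cauchy) : M.Completion :=
  Submodule.Quotient.mk (p := M.null.comap M.cauchy.subtype) ⟨x, hx⟩

theorem Completion.ind {M : DirInvMod K} {p : M.Completion → Prop}
    (h : ∀ x hx, p (Completion.mk x hx)) (u : M.Completion) : p u := by
  obtain ⟨⟨x, hx⟩, rfl⟩ := Submodule.Quotient.mk_surjective _ u
  exact h x hx

theorem completionMap_mk {M N : DirInvMod K} (f : M ⟶ N) (x : ℕ → M) (hx : x ∈ M.cauchy) :
    completionMap f (Completion.mk x hx) =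
      Completion.mk (fun n => f.lin (x n)) (Hom.cauchy f hx) := rfl

theorem completionMap_id (M : DirInvMod K) : completionMap (𝟙 M) = LinearMap.id :=
  by
  refine LinearMap.ext fun u => ?_
  induction u using Completion.ind with
  | h x hx => rfl

theorem completionMap_comp {M N P : DirInvMod K} (f : M ⟶ N) (g : N ⟶ P) :
    completionMap (f ≫ g) = completionMap g ∘ₗ completionMap f :=
  by
  refine LinearMap.ext fun u => ?_
  induction u using Completion.ind with
  | h x hx => rfl

theorem completionMap_comp_apply {M N P : DirInvMod K} (f : M ⟶ N) (g : N ⟶ P)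
    (u : M.Completion) : completionMap g (completionMap f u) = completionMap (f ≫ g) u := by
  rw [completionMap_comp]; rfl

/-- The canonical map from a dir-inv module to its completion is defined (that is, `M` is the
union of the `F j`) and it is bijective: `G j` is separated and every Cauchy sequence has a limit.
Complete dir-inv modules have this property. -/
structure EqualsCompletion (M : DirInvMod K) : Prop where
  exhaust : ∀ x : M, ∃ j, x ∈ M.F j
  separated : ∀ (j : M.J) (x : M), (∀ i, x ∈ M.G j i) → x = 0
  converges : ∀ x ∈ M.cauchy, ∃ y : M, (fun n => x n - y) ∈ M.null

theorem EqualsCompletion.const_mem {M : DirInvMod K} (hM : M.EqualsCompletion) (y : M) :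
    (fun _ => y) ∈ M.cauchy := by
  obtain ⟨j, hj⟩ := hM.exhaust y
  exact ⟨j, fun _ => hj, fun i => ⟨0, fun n _ => by simp⟩⟩

/-- The canonical map `M → M̂`, given by the constant sequences. -/
def toCompletion {M : DirInvMod K} (hM : M.EqualsCompletion) : M →ₗ[K] M.Completion where
  toFun y := Completion.mk (fun _ => y) (hM.const_mem y)
  map_add' _ _ := rfl
  map_smul' _ _ := rfl

theorem toCompletion_bijective {M : DirInvMod K} (hM : M.EqualsCompletion) :
    Function.Bijective (toCompletion hM) := by
  constructor
  · refine (injective_iff_map_eq_zero _).2 fun y hy => ?_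
    obtain ⟨j, _, hj⟩ : (fun _ : ℕ => y) ∈ M.null :=
      (Submodule.Quotient.mk_eq_zero (M.null.comap M.cauchy.subtype)).1 hy
    refine hM.separated j y fun i => ?_
    obtain ⟨n₀, hn₀⟩ := hj i
    exact hn₀ n₀ le_rfl
  · intro u
    induction u using Completion.ind with
    | h x hx =>
      obtain ⟨y, hy⟩ := hM.converges x hx
      refine ⟨y, (((Submodule.Quotient.eq _).2 ?_ : Completion.mk x hx = _)).symm⟩
      exact hy

/-- The canonical isomorphism `M ≅ M̂` for a complete dir-inv module. -/
def completionEquiv {M : DirInvMod K} (hM : M.EqualsCompletion) : M ≃ₗ[K] M.Completion :=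
  LinearEquiv.ofBijective (toCompletion hM) (toCompletion_bijective hM)

theorem EqualsCompletion.of_iso {M N : DirInvMod K} (e : M ≅ N) (hN : N.EqualsCompletion) :
    M.EqualsCompletion := by
  have hinv : ∀ x : M, e.inv.lin (e.hom.lin x) = x := fun x =>
    congrArg (fun f : M ⟶ M => f.lin x) e.hom_inv_id
  refine ⟨fun x => ?_, fun j x hx => ?_, fun x hx => ?_⟩
  · obtain ⟨k, hk⟩ := hN.exhaust (e.hom.lin x)
    obtain ⟨j, hj, _⟩ := e.inv.cont k
    exact ⟨j, hinv x ▸ hj _ hk⟩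
  · obtain ⟨k, _, hk⟩ := e.hom.cont j
    rw [← hinv x, hN.separated k (e.hom.lin x), map_zero]
    intro i
    obtain ⟨i', hi'⟩ := hk i
    exact hi' x (hx i')
  · obtain ⟨y, hy⟩ := hN.converges _ (Hom.cauchy e.hom hx)
    refine ⟨e.inv.lin y, ?_⟩
    have := Hom.null e.inv hy
    simpa only [map_sub, hinv] using this

theorem EqualsCompletion.pi {T : Type} [Finite T] {M : T → DirInvMod K}
    (hM : ∀ t, (M t).EqualsCompletion) : (DirInvMod.pi M).EqualsCompletion := by
  refine ⟨fun x => ?_, fun j x hx => ?_, fun x hx => ?_⟩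
  · choose j hj using fun t => (hM t).exhaust (x t)
    exact ⟨j, fun t _ => hj t⟩
  · funext t
    exact (hM t).separated (j t) (x t) fun i => hx i t trivial
  · obtain ⟨j, hj, hj'⟩ := hx
    have hc : ∀ t, (fun n => x n t) ∈ (M t).cauchy := fun t =>
      ⟨j t, fun n => hj n t trivial, fun i => by
        obtain ⟨n₀, hn₀⟩ := hj' i
        exact ⟨n₀, fun n hn => hn₀ n hn t trivial⟩⟩
    choose y hy using fun t => (hM t).converges _ (hc t)
    choose k hk hk' using hy
    refine ⟨y, k, fun n t _ => hk t n, fun i => ?_⟩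
    choose n₀ hn₀ using fun t => hk' t i
    obtain ⟨m, hm⟩ := (Set.finite_range n₀).bddAbove
    exact ⟨m, fun n hn t _ => hn₀ t n ((hm ⟨t, rfl⟩).trans hn)⟩

/-! ### Completed tensor products with discrete modules -/

/-- The completed tensor product `A ⊗̂ M`, with `A` regarded as a discrete inv module. -/
abbrev CTensor (A : Type u) [AddCommGroup A] [Module K A] (M : DirInvMod K) : Type u :=
  (tensor (discrete (K := K) A) M).Completion

section

variable {A B C : Type u} [AddCommGroup A] [Module K A] [AddCommGroup B] [Module K B]
  [AddCommGroup C] [Module K C]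

/-- The map `f ⊗̂ g` on completed tensor products. -/
def ctensorMap {M N : DirInvMod K} (f : A →ₗ[K] B) (g : M ⟶ N) : CTensor A M →ₗ[K] CTensor B N :=
  completionMap (tensorMap (discreteMap f) g)

theorem ctensorMap_id (M : DirInvMod K) :
    ctensorMap (LinearMap.id : A →ₗ[K] A) (𝟙 M) = LinearMap.id := by
  rw [ctensorMap, ← completionMap_id]
  congr 1
  refine hom_ext fun x => ?_
  exact LinearMap.congr_fun (TensorProduct.map_id (R := K) (M := A) (N := M)) x

theorem ctensorMap_ctensorMap {M N P : DirInvMod K} (f : A →ₗ[K] B) (f' : B →ₗ[K] C) (g : M ⟶ N)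
    (g' : N ⟶ P) (u : CTensor A M) :
    ctensorMap f' g' (ctensorMap f g u) = ctensorMap (f' ∘ₗ f) (g ≫ g') u := by
  rw [ctensorMap, ctensorMap, completionMap_comp_apply, ctensorMap]
  congr 2
  refine hom_ext fun x => ?_
  exact (LinearMap.congr_fun (TensorProduct.map_comp f' g'.lin f g.lin) x).symm

theorem ctensorMap_zero {M N : DirInvMod K} (g : M ⟶ N) (u : CTensor A M) :
    ctensorMap (0 : A →ₗ[K] B) g u = 0 := by
  induction u using Completion.ind with
  | h x hx =>
    refine (Submodule.Quotient.mk_eq_zero _).2 ?_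
    have : (fun n => (tensorMap (discreteMap (0 : A →ₗ[K] B)) g).lin (x n)) = 0 := by
      funext n
      exact LinearMap.congr_fun (TensorProduct.map_zero_left g.lin) (x n)
    change (fun n => (tensorMap (discreteMap (0 : A →ₗ[K] B)) g).lin (x n)) ∈ null _
    rw [this]
    exact zero_mem _

/-- The continuous linear map `A ⊗ M → M`, `a ⊗ m ↦ f(a) m`, for a functional `f` on `A`. -/
def contract (f : A →ₗ[K] K) (M : DirInvMod K) : tensor (discrete (K := K) A) M ⟶ M where
  lin := (TensorProduct.lid K M).toLinearMap ∘ₗ f.rTensor M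
  cont jk := by
    have key : ∀ (P : Submodule K A) (Q : Submodule K M),
        Submodule.map₂ (TensorProduct.mk K A M) P Q ≤
          Q.comap ((TensorProduct.lid K M).toLinearMap ∘ₗ f.rTensor M) := by
      refine fun P Q => Submodule.map₂_le.2 fun a _ m hm => ?_
      change f a • m ∈ Q
      exact Submodule.smul_mem _ _ hm
    refine ⟨jk.2, fun x hx => key _ _ hx, fun i => ⟨i, fun x hx => ?_⟩⟩
    refine (sup_le ?_ (key ⊤ _) : _ ≤ (M.G jk.2 i).comap _) hx
    exact Submodule.map₂_le.2 fun a ha m _ => by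
      obtain rfl : a = 0 := ha
      simp

/-- The map `f ⊗̂ 1 : A ⊗̂ M → K ⊗̂ M ≅ M` for a functional `f` on `A` and complete `M`. -/
def cfunctional {M : DirInvMod K} (hM : M.EqualsCompletion) (f : A →ₗ[K] K) :
    CTensor A M →ₗ[K] M :=
  (completionEquiv hM).symm.toLinearMap ∘ₗ completionMap (contract f M)

theorem cfunctional_eq_iff {M : DirInvMod K} (hM : M.EqualsCompletion) (f : A →ₗ[K] K)
    (u : CTensor A M) (m : M) :
    cfunctional hM f u = m ↔ completionMap (contract f M) u = toCompletion hM m := by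
  exact (completionEquiv hM).symm_apply_eq

theorem toCompletion_cfunctional {M : DirInvMod K} (hM : M.EqualsCompletion) (f : A →ₗ[K] K)
    (u : CTensor A M) :
    toCompletion hM (cfunctional hM f u) = completionMap (contract f M) u :=
  ((cfunctional_eq_iff hM f u _).1 rfl).symm

theorem cfunctional_add {M : DirInvMod K} (hM : M.EqualsCompletion) (f g : A →ₗ[K] K)
    (u : CTensor A M) : cfunctional hM (f + g) u = cfunctional hM f u + cfunctional hM g u := by
  rw [cfunctional_eq_iff, map_add, toCompletion_cfunctional, toCompletion_cfunctional]
  induction u using Completion.ind with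
  | h x hx =>
    rw [completionMap_mk, completionMap_mk, completionMap_mk]
    change Completion.mk _ _ = Completion.mk _ (add_mem (Hom.cauchy _ hx) (Hom.cauchy _ hx))
    congr 1
    funext n
    simp [contract, LinearMap.rTensor_add]

theorem cfunctional_smul {M : DirInvMod K} (hM : M.EqualsCompletion) (c : K) (f : A →ₗ[K] K)
    (u : CTensor A M) : cfunctional hM (c • f) u = c • cfunctional hM f u := by
  rw [cfunctional_eq_iff, map_smul, toCompletion_cfunctional]
  induction u using Completion.ind with
  | h x hx =>
    rw [completionMap_mk, completionMap_mk]
    change Completion.mk _ _ = Completion.mk _ (Submodule.smul_mem _ c (Hom.cauchy _ hx))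
    congr 1
    funext n
    simp [contract, LinearMap.rTensor_smul]

/-- `f ↦ f ⊗̂ 1` is linear in the functional `f`. -/
def cfunctionalₗ {M : DirInvMod K} (hM : M.EqualsCompletion) (u : CTensor A M) :
    (A →ₗ[K] K) →ₗ[K] M where
  toFun f := cfunctional hM f u
  map_add' f g := cfunctional_add hM f g u
  map_smul' c f := cfunctional_smul hM c f u

theorem cfunctional_ctensorMap {M N : DirInvMod K} (hM : M.EqualsCompletion)
    (hN : N.EqualsCompletion) (f : A →ₗ[K] B) (g : M ⟶ N) (φ : B →ₗ[K] K) (u : CTensor A M) :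
    cfunctional hN φ (ctensorMap f g u) = g.lin (cfunctional hM (φ ∘ₗ f) u) := by
  have h1 : ∀ m : M, toCompletion hN (g.lin m) = completionMap g (toCompletion hM m) :=
    fun _ => rfl
  rw [cfunctional_eq_iff, h1, toCompletion_cfunctional, ctensorMap, completionMap_comp_apply,
    completionMap_comp_apply]
  congr 2
  refine hom_ext fun x => ?_
  change (TensorProduct.lid K N) (φ.rTensor N (TensorProduct.map f g.lin x)) =
    g.lin ((TensorProduct.lid K M) ((φ ∘ₗ f).rTensor M x))
  induction x using TensorProduct.induction_on with
  | zero => simp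
  | tmul a m => simp
  | add x y hx hy => simp only [map_add, hx, hy]

/-- The map `M → A ⊗̂ M`, `m ↦ a ⊗ m`, for complete `M`. -/
def cmk {M : DirInvMod K} (hM : M.EqualsCompletion) (a : A) : M →ₗ[K] CTensor A M where
  toFun m := Completion.mk (M := tensor (discrete (K := K) A) M) (fun _ => (a ⊗ₜ[K] m : A ⊗[K] M)) (by
    obtain ⟨j, hj⟩ := hM.exhaust m
    refine ⟨(PUnit.unit, j), fun _ => ?_, fun i => ⟨0, fun n _ => by simp⟩⟩
    exact Submodule.apply_mem_map₂ (TensorProduct.mk K A M) (Submodule.mem_top (x := a)) hj)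
  map_add' m m' := by
    change _ = Completion.mk (M := tensor (discrete (K := K) A) M) (_ + _) _
    congr 1
    funext n
    exact TensorProduct.tmul_add _ _ _
  map_smul' c m := by
    change _ = Completion.mk (M := tensor (discrete (K := K) A) M) (c • _) _
    congr 1
    funext n
    exact TensorProduct.tmul_smul _ _ _

theorem ctensorMap_cmk {M N : DirInvMod K} (hM : M.EqualsCompletion) (hN : N.EqualsCompletion)
    (f : A →ₗ[K] B) (g : M ⟶ N) (a : A) (m : M) :
    ctensorMap f g (cmk hM a m) = cmk hN (f a) (g.lin m) := rfl

end

end DirInvMod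

/-! ### Normalizations of cosimplicial modules -/

section Normalization

variable {K : Type u}

section Standard

variable [CommRing K] (B : CosimplicialObject (ModuleCat.{u} K))

/-- `N^q B`, the intersection of the kernels of the codegeneracies `sⁱ : B^q → B^{q-1}`. -/
def normSub (q : ℕ) : Submodule K (B.obj ⦋q⦌) :=
  match q with
  | 0 => ⊤
  | Nat.succ q => ⨅ i : Fin (q + 1), LinearMap.ker (B.σ (n := q) i).hom

theorem mem_normSub_succ {q : ℕ} {x : B.obj ⦋q + 1⦌} :
    x ∈ normSub B (q + 1) ↔ ∀ i : Fin (q + 1), B.σ (n := q) i x = 0 := by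
  simp [normSub]

theorem objD_apply (q : ℕ) (x : B.obj ⦋q⦌) :
    AlgebraicTopology.AlternatingCofaceMapComplex.objD B q x =
      ∑ i : Fin (q + 2), (-1 : ℤ) ^ (i : ℕ) • B.δ i x := by
  simp [AlgebraicTopology.AlternatingCofaceMapComplex.objD]

theorem objD_mem (q : ℕ) {x : B.obj ⦋q⦌} (hx : x ∈ normSub B q) :
    AlgebraicTopology.AlternatingCofaceMapComplex.objD B q x ∈ normSub B (q + 1) := by
  rw [mem_normSub_succ]
  intro j
  rw [objD_apply, map_sum]
  have h1 : B.σ j (B.δ j.castSucc x) = x :=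
    congrArg (fun f : B.obj ⦋q⦌ ⟶ B.obj ⦋q⦌ => f x) (B.δ_comp_σ_self (i := j))
  have h2 : B.σ j (B.δ j.succ x) = x :=
    congrArg (fun f : B.obj ⦋q⦌ ⟶ B.obj ⦋q⦌ => f x) (B.δ_comp_σ_succ (i := j))
  have h3 : ∀ i : Fin (q + 2), i ≠ j.castSucc ∧ i ≠ j.succ → B.σ j (B.δ i x) = 0 := by
    rintro i ⟨hi, hi'⟩
    cases q with
    | zero => fin_cases j; fin_cases i <;> simp_all
    | succ q =>
      rw [mem_normSub_succ] at hx
      rcases lt_or_gt_of_ne hi with hlt | hgt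
      · obtain ⟨j, rfl⟩ := Fin.exists_succ_eq.2 (show j ≠ 0 by rintro rfl; simp at hlt)
        obtain ⟨i, rfl⟩ := Fin.exists_castSucc_eq.2 (show i ≠ Fin.last _ by
          rintro rfl
          exact absurd hlt (Fin.le_last _).not_gt)
        have h := congrArg (fun f : B.obj ⦋q + 1⦌ ⟶ B.obj ⦋q + 1⦌ => f x)
          (B.δ_comp_σ_of_le (i := i) (j := j) (by
            simp only [Fin.lt_def, Fin.le_def, Fin.val_castSucc, Fin.val_succ] at hlt ⊢; omega))
        refine h.trans ?_
        change B.δ i (B.σ j x) = 0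
        rw [hx, map_zero]
      · have hgt' : j.succ < i := by
          have : (i : ℕ) ≠ j + 1 := fun h => hi' (Fin.ext h)
          simp only [Fin.lt_def, Fin.val_castSucc, Fin.val_succ] at hgt ⊢; omega
        have h := congrArg (fun f : B.obj ⦋q + 1⦌ ⟶ B.obj ⦋q + 1⦌ => f x)
          (B.δ_comp_σ_of_gt' hgt')
        refine h.trans ?_
        change B.δ _ (B.σ _ x) = 0
        rw [hx, map_zero]
  rw [Fintype.sum_eq_add j.castSucc j.succ
    (fun h => by simpa using congrArg Fin.val h)
    (fun i hi => by rw [map_zsmul, h3 i hi, smul_zero]),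
    map_zsmul, map_zsmul, h1, h2]
  simp [pow_succ]

/-- The differential `∑ (-1)ⁱ ∂ⁱ : N^q B → N^{q+1} B`. -/
def normD (q : ℕ) : normSub B q →ₗ[K] normSub B (q + 1) :=
  (AlgebraicTopology.AlternatingCofaceMapComplex.objD B q).hom.restrict fun _ hx => objD_mem B q hx

/-- The standard normalization `N B` of a cosimplicial module. -/
def normComplex : CochainComplex (ModuleCat.{u} K) ℕ :=
  CochainComplex.of (fun q => ModuleCat.of K (normSub B q)) (fun q => ModuleCat.ofHom (normD B q))
    fun q => by
      ext x
      exact congrArg (fun f : B.obj ⦋q⦌ ⟶ B.obj ⦋q + 1 + 1⦌ => f x.1)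
        (AlgebraicTopology.AlternatingCofaceMapComplex.d_squared B q)

variable {B}

theorem normSub_map {B' : CosimplicialObject (ModuleCat.{u} K)} (f : B ⟶ B') (q : ℕ)
    {x : B.obj ⦋q⦌} (hx : x ∈ normSub B q) : f.app ⦋q⦌ x ∈ normSub B' q := by
  cases q with
  | zero => trivial
  | succ q =>
    rw [mem_normSub_succ] at hx ⊢
    intro i
    have h := congrArg (fun g : B.obj ⦋q + 1⦌ ⟶ B'.obj ⦋q⦌ => g x)
      (f.naturality (SimplexCategory.σ i))
    refine h.symm.trans ?_
    change f.app ⦋q⦌ (B.σ i x) = 0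
    rw [hx, map_zero]

/-- Functoriality of the standard normalization. -/
def normMap {B' : CosimplicialObject (ModuleCat.{u} K)} (f : B ⟶ B') :
    normComplex B ⟶ normComplex B' :=
  CochainComplex.ofHom
    (fun q => ModuleCat.ofHom ((f.app ⦋q⦌).hom.restrict fun _ hx => normSub_map f q hx)) fun q => by
      simp only [normComplex, CochainComplex.of_d]
      ext x
      change AlgebraicTopology.AlternatingCofaceMapComplex.objD B' q (f.app ⦋q⦌ x.1) =
        f.app ⦋q + 1⦌ (AlgebraicTopology.AlternatingCofaceMapComplex.objD B q x.1)
      rw [objD_apply, objD_apply, map_sum]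
      refine Finset.sum_congr rfl fun i _ => ?_
      rw [map_zsmul]
      exact congrArg _ (congrArg (fun g : B.obj ⦋q⦌ ⟶ B'.obj ⦋q + 1⦌ => g x.1)
        (f.naturality (SimplexCategory.δ i))).symm

variable (K) in
/-- The standard normalization functor `N`. -/
def normFunctor : CosimplicialObject (ModuleCat.{u} K) ⥤ CochainComplex (ModuleCat.{u} K) ℕ where
  obj B := normComplex B
  map f := normMap f

end Standard

section ThomSullivan

variable [Field K] (B : CosimplicialObject (DirInvMod K))

open DirInvMod

/-- `Ω^q` of the geometric simplex `Δ^n`. -/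
def Om (K : Type u) [Field K] (q : ℕ) (n : SimplexCategory) : Type u :=
  SimplexForm K (Fin (n.len + 1)) q

instance (q : ℕ) (n : SimplexCategory) : AddCommGroup (Om K q n) :=
  inferInstanceAs (AddCommGroup (SimplexForm K (Fin (n.len + 1)) q))

instance (q : ℕ) (n : SimplexCategory) : Module K (Om K q n) :=
  inferInstanceAs (Module K (SimplexForm K (Fin (n.len + 1)) q))

/-- The exterior derivative `Ω^q(Δ^n) → Ω^{q+1}(Δ^n)`. -/
def OmD (q : ℕ) (n : SimplexCategory) : Om K q n →ₗ[K] Om K (q + 1) n :=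
  extD K (Fin (n.len + 1)) q

/-- The pullback `α_* : Ω^q(Δ^l) → Ω^q(Δ^k)` for `α : [k] → [l]`. -/
def OmMap (q : ℕ) {k l : SimplexCategory} (α : k ⟶ l) : Om K q l →ₗ[K] Om K q k :=
  formPullback K (α.toOrderHom : Fin (k.len + 1) → Fin (l.len + 1)) q

theorem OmD_comp_OmMap (q : ℕ) {k l : SimplexCategory} (α : k ⟶ l) :
    OmD (K := K) q k ∘ₗ OmMap q α = OmMap (q + 1) α ∘ₗ OmD q l :=
  LinearMap.ext fun ω => extD_formPullback _ _ ω

theorem OmD_comp_OmD (q : ℕ) (n : SimplexCategory) :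
    OmD (K := K) (q + 1) n ∘ₗ OmD q n = 0 :=
  LinearMap.ext fun ω => extD_extD ω

/-- The product `∏_l Ω^q(Δ^l) ⊗̂ B^l`. -/
def TSProd (q : ℕ) : Type u := ∀ n : SimplexCategory, CTensor (Om K q n) (B.obj n)

instance (q : ℕ) : AddCommGroup (TSProd B q) :=
  inferInstanceAs (AddCommGroup (∀ n : SimplexCategory, CTensor (Om K q n) (B.obj n)))

instance (q : ℕ) : Module K (TSProd B q) :=
  inferInstanceAs (Module K (∀ n : SimplexCategory, CTensor (Om K q n) (B.obj n)))

/-- The module of the complete Thom-Sullivan cochains of degree `q`: the sequences `u` with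
`u_l ∈ Ω^q(Δ^l) ⊗̂ B^l` such that `(1 ⊗ α^*)(u_k) = (α_* ⊗ 1)(u_l)` in `Ω^q(Δ^k) ⊗̂ B^l` for every
`α : [k] → [l]`. -/
def tsSub (q : ℕ) : Submodule K (TSProd B q) where
  carrier := {u | ∀ (k l : SimplexCategory) (α : k ⟶ l),
    ctensorMap LinearMap.id (B.map α) (u k) = ctensorMap (OmMap q α) (𝟙 (B.obj l)) (u l)}
  zero_mem' _ l α :=
    (map_zero (ctensorMap LinearMap.id (B.map α))).trans
      (map_zero (ctensorMap (OmMap q α) (𝟙 (B.obj l)))).symm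
  add_mem' {u v} hu hv k l α :=
    (map_add (ctensorMap LinearMap.id (B.map α)) (u k) (v k)).trans
      ((congrArg₂ (· + ·) (hu k l α) (hv k l α)).trans
        (map_add (ctensorMap (OmMap q α) (𝟙 (B.obj l))) (u l) (v l)).symm)
  smul_mem' c u hu k l α :=
    (map_smul (ctensorMap LinearMap.id (B.map α)) c (u k)).trans
      ((congrArg (c • ·) (hu k l α)).trans
        (map_smul (ctensorMap (OmMap q α) (𝟙 (B.obj l))) c (u l)).symm)

/-- The coboundary operator, given by the exterior derivative of forms. -/
def tsD (q : ℕ) : tsSub B q →ₗ[K] tsSub B (q + 1) where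
  toFun u := ⟨fun n => ctensorMap (OmD q n) (𝟙 (B.obj n)) (u.1 n), fun k l α => by
    have h := congrArg (ctensorMap (OmD q k) (𝟙 (B.obj l))) (u.2 k l α)
    rw [ctensorMap_ctensorMap, ctensorMap_ctensorMap, Category.comp_id, OmD_comp_OmMap] at h
    rw [ctensorMap_ctensorMap, ctensorMap_ctensorMap, Category.id_comp]
    exact h⟩
  map_add' u v := Subtype.ext (funext fun n => map_add (ctensorMap (OmD q n) _) (u.1 n) (v.1 n))
  map_smul' c u := Subtype.ext (funext fun n => map_smul (ctensorMap (OmD q n) _) c (u.1 n))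

/-- The complete Thom-Sullivan normalization of a cosimplicial dir-inv module. -/
def tsComplex : CochainComplex (ModuleCat.{u} K) ℕ :=
  CochainComplex.of (fun q => ModuleCat.of K (tsSub B q)) (fun q => ModuleCat.ofHom (tsD B q))
    fun q => by
      refine ModuleCat.hom_ext (LinearMap.ext fun u => Subtype.ext (funext fun n => ?_))
      change ctensorMap _ _ (ctensorMap _ _ (u.1 n)) = 0
      rw [ctensorMap_ctensorMap]
      rw [OmD_comp_OmD, ctensorMap_zero]

variable {B}

/-- Functoriality of the complete Thom-Sullivan normalization, in each degree. -/
def tsMapAux {B' : CosimplicialObject (DirInvMod K)} (f : B ⟶ B') (q : ℕ) :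
    tsSub B q →ₗ[K] tsSub B' q where
  toFun u := ⟨fun n => ctensorMap LinearMap.id (f.app n) (u.1 n), fun k l α => by
    have h := congrArg (ctensorMap LinearMap.id (f.app l)) (u.2 k l α)
    rw [ctensorMap_ctensorMap, ctensorMap_ctensorMap, Category.id_comp] at h
    rw [ctensorMap_ctensorMap, ctensorMap_ctensorMap, Category.comp_id, ← f.naturality]
    exact h⟩
  map_add' u v := Subtype.ext (funext fun n =>
    map_add (ctensorMap LinearMap.id (f.app n)) (u.1 n) (v.1 n))
  map_smul' c u := Subtype.ext (funext fun n =>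
    map_smul (ctensorMap LinearMap.id (f.app n)) c (u.1 n))

theorem tsMapAux_apply {B' : CosimplicialObject (DirInvMod K)} (f : B ⟶ B') (q : ℕ)
    (u : tsSub B q) (n : SimplexCategory) :
    (tsMapAux f q u).1 n = ctensorMap LinearMap.id (f.app n) (u.1 n) := rfl

/-- Functoriality of the complete Thom-Sullivan normalization. -/
def tsMap {B' : CosimplicialObject (DirInvMod K)} (f : B ⟶ B') : tsComplex B ⟶ tsComplex B' :=
  CochainComplex.ofHom (fun q => ModuleCat.ofHom (tsMapAux f q)) fun q => by
    simp only [tsComplex, CochainComplex.of_d]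
    refine ModuleCat.hom_ext (LinearMap.ext fun u => Subtype.ext (funext fun n => ?_))
    change ctensorMap _ _ (ctensorMap _ _ (u.1 n)) = ctensorMap _ _ (ctensorMap _ _ (u.1 n))
    rw [ctensorMap_ctensorMap, ctensorMap_ctensorMap, Category.id_comp, Category.comp_id]
    rfl

variable (K) in
/-- The complete Thom-Sullivan normalization functor. -/
def tsFunctor : CosimplicialObject (DirInvMod K) ⥤ CochainComplex (ModuleCat.{u} K) ℕ where
  obj B := tsComplex B
  map f := tsMap f
  map_id B := by
    ext q u
    refine Subtype.ext (funext fun n => ?_)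
    change ctensorMap LinearMap.id (𝟙 (B.obj n)) (u.1 n) = u.1 n
    rw [ctensorMap_id]
    rfl
  map_comp f g := by
    ext q u
    refine Subtype.ext (funext fun n => ?_)
    change ctensorMap _ _ (u.1 n) = ctensorMap _ _ (ctensorMap _ _ (u.1 n))
    rw [ctensorMap_ctensorMap]
    rfl

/-- The underlying cosimplicial module of a cosimplicial dir-inv module. -/
abbrev underlying (B : CosimplicialObject (DirInvMod K)) : CosimplicialObject (ModuleCat.{u} K) :=
  B ⋙ DirInvMod.forget

variable (hB : ∀ n, (B.obj n).EqualsCompletion)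

theorem map_cfunctional (q : ℕ) (u : tsSub B q) {k l : SimplexCategory} (α : k ⟶ l)
    (φ : Om K q k →ₗ[K] K) :
    (B.map α).lin (cfunctional (hB k) φ (u.1 k)) =
      cfunctional (hB l) (φ ∘ₗ OmMap q α) (u.1 l) := by
  have h1 := cfunctional_ctensorMap (hB k) (hB l) LinearMap.id (B.map α) φ (u.1 k)
  have h2 := cfunctional_ctensorMap (hB l) (hB l) (OmMap q α) (𝟙 (B.obj l)) φ (u.1 l)
  rw [u.2 k l α, h2] at h1
  exact h1.symm

variable [CharZero K]

variable (K) in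
/-- The integral `∫_{Δ^q} : Ω^q(Δ^q) → K`. -/
def OmInt (q : ℕ) : Om K q ⦋q⦌ →ₗ[K] K := formIntegral K q

theorem OmInt_comp_σ (q : ℕ) (i : Fin (q + 1)) :
    OmInt K (q + 1) ∘ₗ OmMap (q + 1) (SimplexCategory.σ (n := q) i) = 0 :=
  LinearMap.ext fun ω => formIntegral_degenerate (q + 1) _ (fun h => by
    have := Fintype.card_le_of_injective _ h
    simp at this) ω

theorem OmInt_comp_OmD (q : ℕ) :
    OmInt K (q + 1) ∘ₗ OmD q ⦋q + 1⦌ =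
      ∑ i : Fin (q + 2), (-1 : ℤ) ^ (i : ℕ) • (OmInt K q ∘ₗ OmMap q (SimplexCategory.δ i)) := by
  refine LinearMap.ext fun ω => (formIntegral_extD q ω).trans ?_
  rw [LinearMap.sum_apply]
  rfl

theorem integral_mem (q : ℕ) (u : tsSub B q) :
    cfunctional (hB ⦋q⦌) (OmInt K q) (u.1 ⦋q⦌) ∈ normSub (underlying B) q := by
  cases q with
  | zero => trivial
  | succ q =>
    refine (mem_normSub_succ (underlying B)).2 fun i => ?_
    refine (map_cfunctional hB (q + 1) u (SimplexCategory.σ (n := q) i) (OmInt K (q + 1))).trans ?_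
    rw [OmInt_comp_σ]
    exact map_zero (cfunctionalₗ (hB ⦋q⦌) (u.1 ⦋q⦌))

/-- The map `u ↦ ∫_{Δ^q} u_q` from complete Thom-Sullivan cochains to normalized cochains. -/
def integralAux (q : ℕ) : tsSub B q →ₗ[K] normSub (underlying B) q where
  toFun u := ⟨cfunctional (hB ⦋q⦌) (OmInt K q) (u.1 ⦋q⦌), integral_mem hB q u⟩
  map_add' u v := Subtype.ext (map_add (cfunctional (hB ⦋q⦌) (OmInt K q)) (u.1 ⦋q⦌) (v.1 ⦋q⦌))
  map_smul' c u := Subtype.ext (map_smul (cfunctional (hB ⦋q⦌) (OmInt K q)) c (u.1 ⦋q⦌))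

theorem integralAux_tsD (q : ℕ) (u : tsSub B q) :
    integralAux hB (q + 1) (tsD B q u) = normD (underlying B) q (integralAux hB q u) := by
  refine Subtype.ext ?_
  change cfunctional (hB ⦋q + 1⦌) (OmInt K (q + 1))
      (ctensorMap (OmD q ⦋q + 1⦌) (𝟙 (B.obj ⦋q + 1⦌)) (u.1 ⦋q + 1⦌)) =
    AlgebraicTopology.AlternatingCofaceMapComplex.objD (underlying B) q
      (cfunctional (hB ⦋q⦌) (OmInt K q) (u.1 ⦋q⦌))
  rw [cfunctional_ctensorMap (hB ⦋q + 1⦌), OmInt_comp_OmD]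
  refine Eq.trans ?_ (objD_apply (underlying B) q _).symm
  refine (map_sum (cfunctionalₗ (hB ⦋q + 1⦌) (u.1 ⦋q + 1⦌)) _ _).trans ?_
  refine Finset.sum_congr rfl fun i _ => ?_
  rw [map_zsmul]
  congr 1
  exact (map_cfunctional hB q u (SimplexCategory.δ i) (OmInt K q)).symm

/-- The integration map `∫_Δ` from the complete Thom-Sullivan normalization to the standard
normalization, for a cosimplicial dir-inv module all of whose terms are complete. -/
def integral : (tsFunctor K).obj B ⟶ (normFunctor K).obj (underlying B) :=
  CochainComplex.ofHom (fun q => ModuleCat.ofHom (integralAux hB q)) fun q => by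
    simp only [tsFunctor, normFunctor, tsComplex, normComplex, CochainComplex.of_d]
    exact ModuleCat.hom_ext (LinearMap.ext fun u => (integralAux_tsD hB q u).symm)

theorem integral_naturality {B' : CosimplicialObject (DirInvMod K)}
    (hB' : ∀ n, (B'.obj n).EqualsCompletion) (f : B ⟶ B') :
    (tsFunctor K).map f ≫ integral hB' =
      integral hB ≫ (normFunctor K).map (Functor.whiskerRight f DirInvMod.forget) := by
  ext q u
  refine Subtype.ext ?_
  exact cfunctional_ctensorMap (hB ⦋q⦌) (hB' ⦋q⦌) LinearMap.id (f.app ⦋q⦌) (OmInt K q) (u.1 ⦋q⦌)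

end ThomSullivan

end Normalization

/-! ### Dir-inv sheaves of modules -/

/-- Presheaves of `K`-modules on `X`. -/
abbrev ModPsh (K : Type u) [CommRing K] (X : TopCat.{u}) := (Opens X)ᵒᵖ ⥤ ModuleCat.{u} K

/-- Sheaves of `K`-modules on `X`, that is, modules over the constant sheaf `K_X`. -/
abbrev ModSheaf (K : Type u) [CommRing K] (X : TopCat.{u}) :=
  Sheaf (Opens.grothendieckTopology X) (ModuleCat.{u} K)

section Sheaves

variable {K : Type u} [CommRing K] {X : TopCat.{u}}

/-- The restriction of a section to a smaller open set. -/
def ModPsh.res (P : ModPsh K X) {V W : Opens X} (h : V ≤ W) :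
    P.obj (op W) →ₗ[K] P.obj (op V) := (P.map (homOfLE h).op).hom

theorem ModPsh.res_res (P : ModPsh K X) {V W Z : Opens X} (h : V ≤ W) (h' : W ≤ Z)
    (s : P.obj (op Z)) : P.res h (P.res h' s) = P.res (h.trans h') s :=
  (congrArg (fun f : P.obj (op Z) ⟶ P.obj (op V) => f s)
    (P.map_comp (homOfLE h').op (homOfLE h).op)).symm

theorem ModPsh.res_self (P : ModPsh K X) {V : Opens X} (h : V ≤ V) (s : P.obj (op V)) :
    P.res h s = s :=
  congrArg (fun f : P.obj (op V) ⟶ P.obj (op V) => f s) (P.map_id (op V))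

theorem ModPsh.res_app {P Q : ModPsh K X} (f : P ⟶ Q) {V W : Opens X} (h : V ≤ W)
    (s : P.obj (op W)) : f.app (op V) (P.res h s) = Q.res h (f.app (op W) s) :=
  congrArg (fun g : P.obj (op W) ⟶ Q.obj (op V) => g s) (f.naturality (homOfLE h).op)

/-- A subsheaf of submodules: a submodule of the sections over each open set, stable under
restriction and determined locally. -/
structure Subsheaf (P : ModPsh K X) where
  sec : ∀ V : Opens X, Submodule K (P.obj (op V))
  res_mem : ∀ {V W : Opens X} (h : V ≤ W) {s : P.obj (op W)}, s ∈ sec W → P.res h s ∈ sec V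
  mem_of_local : ∀ (V : Opens X) (s : P.obj (op V)),
    (∀ x ∈ V, ∃ (W : Opens X) (h : W ≤ V), x ∈ W ∧ P.res h s ∈ sec W) → s ∈ sec V

/-- Let `F` be a subsheaf with a descending sequence of subsheaves `G i ⊆ F`. This says that the
map of sheaves `F → lim_{← i} F / G i` is an isomorphism, that is, bijective on sections over every
open set `V`. A section of the quotient sheaf `F / G i` over `V` is given by sections `s i x` of
`F` on neighbourhoods `W i x ⊆ V` of the points `x` of `V`, any two of which differ by a section of
`G i` where both are defined. -/
structure Subsheaf.IsCompleteInv {P : ModPsh K X} (F : Subsheaf P) (G : ℕ → Subsheaf P) : Prop where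
  inj : ∀ (V : Opens X) (s : P.obj (op V)), (∀ i, s ∈ (G i).sec V) → s = 0
  surj : ∀ (V : Opens X) (W : ℕ → V → Opens X) (hW : ∀ i x, W i x ≤ V) (_ : ∀ i x, x.1 ∈ W i x)
    (s : ∀ i x, P.obj (op (W i x))) (_ : ∀ i x, s i x ∈ F.sec (W i x))
    (_ : ∀ i i', i ≤ i' → ∀ x y,
      P.res inf_le_left (s i' x) - P.res inf_le_right (s i y) ∈ (G i).sec (W i' x ⊓ W i y)),
    ∃ t ∈ F.sec V, ∀ i x, P.res (hW i x) t - s i x ∈ (G i).sec (W i x)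

variable (K X) in
/-- A dir-inv `K_X`-module: a sheaf of `K`-modules with a direct system of subsheaves `F j`,
indexed by a nonempty directed set `J`, each with an inverse system `G j 0 ⊇ G j 1 ⊇ ⋯` of
subsheaves of `F j`, such that the inclusions `F j₁ ↪ F j₂` are continuous. -/
structure DirInvSheaf where
  sheaf : ModSheaf K X
  J : Type u
  [partialOrder : PartialOrder J]
  [directed : IsDirectedOrder J]
  [nonempty : Nonempty J]
  F : J → Subsheaf sheaf.obj
  mono : ∀ j₁ j₂, j₁ ≤ j₂ → ∀ V, (F j₁).sec V ≤ (F j₂).sec V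
  G : J → ℕ → Subsheaf sheaf.obj
  G_le : ∀ j i V, (G j i).sec V ≤ (F j).sec V
  anti : ∀ j i₁ i₂, i₁ ≤ i₂ → ∀ V, (G j i₂).sec V ≤ (G j i₁).sec V
  incl : ∀ j₁ j₂, j₁ ≤ j₂ → ∀ i, ∃ i', ∀ V, (G j₁ i').sec V ≤ (G j₂ i).sec V

end Sheaves

attribute [instance] DirInvSheaf.partialOrder DirInvSheaf.directed DirInvSheaf.nonempty

namespace DirInvSheaf

variable {K : Type u} [CommRing K] {X : TopCat.{u}}

/-- A morphism of dir-inv `K_X`-modules is a continuous homomorphism of sheaves. -/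
@[ext]
structure Hom (M N : DirInvSheaf K X) where
  hom : M.sheaf ⟶ N.sheaf
  cont : ∀ j, ∃ k, (∀ V, ∀ s ∈ (M.F j).sec V, hom.hom.app (op V) s ∈ (N.F k).sec V) ∧
    ∀ i, ∃ i', ∀ V, ∀ s ∈ (M.G j i').sec V, hom.hom.app (op V) s ∈ (N.G k i).sec V

instance : Category (DirInvSheaf K X) where
  Hom := Hom
  id M := ⟨𝟙 M.sheaf, fun j => ⟨j, fun _ _ h => h, fun i => ⟨i, fun _ _ h => h⟩⟩⟩
  comp {M N P} f g := ⟨f.hom ≫ g.hom, fun j => by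
    obtain ⟨k, hk, hk'⟩ := f.cont j
    obtain ⟨l, hl, hl'⟩ := g.cont k
    refine ⟨l, fun V s hs => hl V _ (hk V s hs), fun i => ?_⟩
    obtain ⟨i', h'⟩ := hl' i
    obtain ⟨i'', h''⟩ := hk' i'
    exact ⟨i'', fun V s hs => h' V _ (h'' V s hs)⟩⟩
  id_comp f := Hom.ext (Category.id_comp f.hom)
  comp_id f := Hom.ext (Category.comp_id f.hom)
  assoc f g h := Hom.ext (Category.assoc f.hom g.hom h.hom)

@[simp] theorem id_hom (M : DirInvSheaf K X) : Hom.hom (𝟙 M) = 𝟙 M.sheaf := rfl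

@[simp] theorem comp_hom {M N P : DirInvSheaf K X} (f : M ⟶ N) (g : N ⟶ P) :
    (f ≫ g).hom = f.hom ≫ g.hom := rfl

instance : HasZeroMorphisms (DirInvSheaf K X) where
  zero _ _ := ⟨⟨0, fun _ => ⟨Classical.arbitrary _, fun _ _ _ => zero_mem _,
    fun _ => ⟨0, fun _ _ _ => zero_mem _⟩⟩⟩⟩
  comp_zero f _ := Hom.ext (comp_zero (f := f.hom))
  zero_comp _ _ _ f := Hom.ext (zero_comp (f := f.hom))

@[simp] theorem zero_hom (M N : DirInvSheaf K X) : Hom.hom (0 : M ⟶ N) = 0 := rfl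

/-- The underlying presheaf of modules. -/
abbrev psh (M : DirInvSheaf K X) : ModPsh K X := M.sheaf.obj

/-- The sections of a dir-inv `K_X`-module over an open set, a dir-inv `K`-module. -/
def sections (M : DirInvSheaf K X) (V : Opens X) : DirInvMod K where
  carrier := M.psh.obj (op V)
  J := M.J
  F j := (M.F j).sec V
  mono _ _ h := M.mono _ _ h V
  G j i := (M.G j i).sec V
  G_le j i := M.G_le j i V
  anti j _ _ h := M.anti j _ _ h V
  incl j₁ j₂ h i := (M.incl j₁ j₂ h i).imp fun _ h' => h' V

/-- Restriction of sections, as a morphism of dir-inv modules. -/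
def res (M : DirInvSheaf K X) {V W : Opens X} (h : V ≤ W) : M.sections W ⟶ M.sections V where
  lin := M.psh.res h
  cont j := ⟨j, fun _ hs => (M.F j).res_mem h hs, fun i => ⟨i, fun _ hs => (M.G j i).res_mem h hs⟩⟩

/-- A morphism of dir-inv `K_X`-modules on sections. -/
def sectionsMap {M N : DirInvSheaf K X} (f : M ⟶ N) (V : Opens X) :
    M.sections V ⟶ N.sections V where
  lin := (f.hom.hom.app (op V)).hom
  cont j := (f.cont j).imp fun _ h => ⟨h.1 V, fun i => (h.2 i).imp fun _ h' => h' V⟩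

/-- `M` is the direct limit of the `F j`, and each `F j` is a complete inv module. -/
structure IsStrictlyComplete (M : DirInvSheaf K X) : Prop where
  complete : ∀ j, (M.F j).IsCompleteInv (M.G j)
  exhaust : ∀ (V : Opens X) (s : M.psh.obj (op V)), ∀ x ∈ V,
    ∃ (W : Opens X) (h : W ≤ V), x ∈ W ∧ ∃ j, M.psh.res h s ∈ (M.F j).sec W

variable (K X) in
/-- A dir-inv `K_X`-module is complete if it is isomorphic to one that is the direct limit of its
`F j` and in which each `F j` is a complete inv module. -/
def isComplete : ObjectProperty (DirInvSheaf K X) :=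
  fun M => ∃ N : DirInvSheaf K X, Nonempty (M ≅ N) ∧ N.IsStrictlyComplete

theorem IsStrictlyComplete.sections [NoetherianSpace X] {M : DirInvSheaf K X}
    (hM : M.IsStrictlyComplete) (V : Opens X) : (M.sections V).EqualsCompletion := by
  refine ⟨fun s => ?_, fun j s hs => (hM.complete j).inj V s hs, fun x hx => ?_⟩
  · choose W hW hxW j hj using fun x : V => hM.exhaust V s x.1 x.2
    obtain ⟨t, ht⟩ := (NoetherianSpace.isCompact (V : Set X)).elim_finite_subcover
      (fun x : V => (W x : Set X)) (fun x => (W x).isOpen)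
      (fun x hx => Set.mem_iUnion.2 ⟨⟨x, hx⟩, hxW _⟩)
    classical
    obtain ⟨k, hk⟩ := Finset.exists_le (t.image j)
    refine ⟨k, (M.F k).mem_of_local V s fun x hx => ?_⟩
    obtain ⟨y, hy, hxy⟩ := Set.mem_iUnion₂.1 (ht hx)
    exact ⟨W y, hW y, hxy, M.mono _ _ (hk _ (Finset.mem_image_of_mem j hy)) _ (hj y)⟩
  · change ℕ → M.psh.obj (op V) at x
    obtain ⟨j, hj, hj'⟩ := hx
    change ∀ n, x n ∈ (M.F j).sec V at hj
    change ∀ i, ∃ n₀, ∀ n ≥ n₀, x n - x n₀ ∈ (M.G j i).sec V at hj'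
    choose n hn using hj'
    have hcomp : ∀ i i', i ≤ i' → x (n i') - x (n i) ∈ (M.G j i).sec V := by
      intro i i' hi
      have h1 := hn i (max (n i) (n i')) (le_max_left _ _)
      have h2 := M.anti j _ _ hi V (hn i' (max (n i) (n i')) (le_max_right _ _))
      have := sub_mem h1 h2
      rwa [sub_sub_sub_cancel_left] at this
    obtain ⟨t, ht, ht'⟩ := (hM.complete j).surj V (fun _ _ => V) (fun _ _ => le_rfl)
      (fun _ x => x.2) (fun i _ => x (n i)) (fun i _ => hj (n i)) (fun i i' hi _ _ => by
        have h := (M.G j i).res_mem (inf_le_left : V ⊓ V ≤ V) (hcomp i i' hi)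
        rwa [map_sub] at h)
    have key : ∀ i, t - x (n i) ∈ (M.G j i).sec V := fun i =>
      (M.G j i).mem_of_local V _ fun y hy => ⟨V, le_rfl, hy, by
        have h := ht' i ⟨y, hy⟩
        rw [ModPsh.res_self] at h ⊢
        exact h⟩
    refine ⟨t, j, fun k => sub_mem (H := (M.F j).sec V) (hj k) ht, fun i => ⟨n i, fun k hk => ?_⟩⟩
    have := sub_mem (hn i k hk) (key i)
    rwa [sub_sub_sub_cancel_right] at this

end DirInvSheaf

/-! ### The Čech construction -/

section Cech

variable {K : Type u} [CommRing K] {X : TopCat.{u}}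

/-- The morphism between finite products given by a map of index sets and morphisms of factors. -/
def DirInvMod.piMap {T T' : Type} [Finite T] [Finite T'] {M : T → DirInvMod K}
    {N : T' → DirInvMod K} (e : T' → T) (f : ∀ t, M (e t) ⟶ N t) :
    DirInvMod.pi M ⟶ DirInvMod.pi N where
  lin := LinearMap.pi fun t => (f t).lin ∘ₗ LinearMap.proj (e t)
  cont j := by
    choose k hk hk' using fun t => (f t).cont (j (e t))
    refine ⟨k, fun x hx t _ => hk t _ (hx (e t) trivial), fun i => ?_⟩
    choose i' hi' using fun t => hk' t i
    obtain ⟨m, hm⟩ := (Set.finite_range i').bddAbove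
    exact ⟨m, fun x hx t _ => hi' t _ ((M (e t)).anti _ (hm ⟨t, rfl⟩) (hx (e t) trivial))⟩

theorem DirInvMod.piMap_apply {T T' : Type} [Finite T] [Finite T'] {M : T → DirInvMod K}
    {N : T' → DirInvMod K} (e : T' → T) (f : ∀ t, M (e t) ⟶ N t) (x : DirInvMod.pi M) (t : T') :
    (DirInvMod.piMap e f).lin x t = (f t).lin (x (e t)) := rfl

variable {m : ℕ} (U : Fin (m + 1) → Opens X)

/-- The intersection `U_{i₀} ∩ ⋯ ∩ U_{i_q}` for a simplex `i : [q] → [m]`. -/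
def cechOpen {n : SimplexCategory} (i : n ⟶ ⦋m⦌) : Opens X :=
  ⨅ a : Fin (n.len + 1), U (i.toOrderHom a)

theorem cechOpen_comp {n n' : SimplexCategory} (α : n ⟶ n') (i : n' ⟶ ⦋m⦌) :
    cechOpen U i ≤ cechOpen U (α ≫ i) :=
  le_iInf fun a => iInf_le (fun b => U (i.toOrderHom b)) (α.toOrderHom a)

/-- `Γ(V, C^n(U, M)) = ∏_i Γ(V ∩ U_i, M)`, the product over all simplices `i : [n] → [m]`. -/
def cechObj (M : DirInvSheaf K X) (V : Opens X) (n : SimplexCategory) : DirInvMod K :=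
  DirInvMod.pi fun i : n ⟶ ⦋m⦌ => M.sections (V ⊓ cechOpen U i)

/-- The cosimplicial dir-inv module `Γ(V, C(U, M))`. -/
def cechCosimplicial (M : DirInvSheaf K X) (V : Opens X) : CosimplicialObject (DirInvMod K) where
  obj n := cechObj U M V n
  map α := DirInvMod.piMap (fun i => α ≫ i) fun i =>
    M.res (inf_le_inf_left V (cechOpen_comp U α i))
  map_id n := DirInvMod.hom_ext fun x => funext fun i => by
    have key : ∀ (i' : n ⟶ ⦋m⦌) (_ : i' = i) (h : V ⊓ cechOpen U i ≤ V ⊓ cechOpen U i'),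
        (M.res h).lin (x i') = x i := by
      rintro _ rfl h
      exact M.psh.res_self _ _
    exact key _ (Category.id_comp i) _
  map_comp α β := DirInvMod.hom_ext fun x => funext fun i => by
    exact (M.psh.res_res _ _ _).symm

/-- The functor `(M, V) ↦ Γ(V, C(U, M))` to cosimplicial dir-inv modules. -/
def cech : DirInvSheaf K X ⥤ (Opens X)ᵒᵖ ⥤ CosimplicialObject (DirInvMod K) where
  obj M :=
    { obj := fun V => cechCosimplicial U M V.unop
      map := fun {V W} f =>
        { app := fun n => DirInvMod.piMap id fun i => M.res (inf_le_inf_right _ (leOfHom f.unop))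
          naturality := fun n n' α => DirInvMod.hom_ext fun x => funext fun i => by
            exact (M.psh.res_res _ _ _).trans (M.psh.res_res _ _ _).symm }
      map_id := fun V => NatTrans.ext (funext fun n => DirInvMod.hom_ext fun x => funext fun i =>
        M.psh.res_self _ _)
      map_comp := fun f g => NatTrans.ext (funext fun n => DirInvMod.hom_ext fun x =>
        funext fun i => (M.psh.res_res _ _ _).symm) }
  map {M N} f :=
    { app := fun V =>
        { app := fun n => DirInvMod.piMap id fun i => DirInvSheaf.sectionsMap f _
          naturality := fun n n' α => DirInvMod.hom_ext fun x => funext fun i => by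
            exact ModPsh.res_app f.hom.hom _ _ }
      naturality := fun V W g => NatTrans.ext (funext fun n => DirInvMod.hom_ext fun x =>
        funext fun i => ModPsh.res_app f.hom.hom _ _) }
  map_id M := rfl
  map_comp f g := rfl

theorem cech_equalsCompletion [NoetherianSpace X] {M : DirInvSheaf K X}
    (hM : DirInvSheaf.isComplete K X M) (V : (Opens X)ᵒᵖ) (n : SimplexCategory) :
    ((((cech U).obj M).obj V).obj n).EqualsCompletion := by
  obtain ⟨N, ⟨e⟩, hN⟩ := hM
  have e' : (((cech U).obj M).obj V).obj n ≅ (((cech U).obj N).obj V).obj n :=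
    (((cech U).mapIso e).app V).app n
  exact DirInvMod.EqualsCompletion.of_iso e'
    (DirInvMod.EqualsCompletion.pi fun i => hN.sections _)

end Cech

/-! ### Total complexes -/

/-- In the total complex of a double complex `L^{q,p}` the differential on `L^{q,p}` is
`∂ + (-1)^q d`, where `∂` raises `q` and `d` raises `p`. -/
instance : TotalComplexShape (ComplexShape.up ℕ) (ComplexShape.up ℤ) (ComplexShape.up ℤ) where
  π qp := qp.1 + qp.2
  ε₁ _ := 1
  ε₂ qp := (-1) ^ qp.1
  rel₁ {q q'} h p := by
    obtain rfl : q + 1 = q' := h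
    change ((q : ℤ) + p) + 1 = ((q + 1 : ℕ) : ℤ) + p
    push_cast; ring
  rel₂ q {p p'} h := by
    obtain rfl : p + 1 = p' := h
    change ((q : ℤ) + p) + 1 = (q : ℤ) + (p + 1)
    ring
  ε₂_ε₁ {q q' p p'} h _ := by
    obtain rfl : q + 1 = q' := h
    simp [pow_succ]

theorem totalAugmentation_aux {V : Type*} [Category* V] [Preadditive V]
    {A A' B B' T T' E : V} {a : A ⟶ B} {a' : A' ⟶ B'} {b : B ⟶ T}
    {b' : B' ⟶ T'} {c : T ⟶ T'} {e : B ⟶ E} {x : E ⟶ T'} {d : A ⟶ A'} {g : B ⟶ B'}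
    (h : b ≫ c = e ≫ x + g ≫ b') (h0 : a ≫ e = 0) (h1 : d ≫ a' = a ≫ g) :
    (a ≫ b) ≫ c = d ≫ a' ≫ b' := by
  rw [Category.assoc, h, Preadditive.comp_add, reassoc_of% h0, zero_comp, zero_add, reassoc_of% h1]

theorem totalAugmentation_aux' {V : Type*} [Category* V] [Preadditive V]
    {A A' B B' T T' : V} {a : A ⟶ B} {a' : A' ⟶ B'} {b : B ⟶ T}
    {b' : B' ⟶ T'} {c : T ⟶ T'} {d : A ⟶ A'} {g : B ⟶ B'}
    (h : b ≫ c = g ≫ b') (h1 : d ≫ a' = a ≫ g) : d ≫ a' ≫ b' = (a ≫ b) ≫ c := by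
  rw [Category.assoc, h, reassoc_of% h1]

section Total

variable {C V : Type*} [Category* C] [Category* V] [HasZeroMorphisms C] [Preadditive V]
  [∀ L : HomologicalComplex₂ V (ComplexShape.up ℕ) (ComplexShape.up ℤ),
    L.HasTotal (ComplexShape.up ℤ)]

/-- Extension of a functor `F` from objects to complexes: `M` goes to the total complex of the
double complex with terms `F^q(M^p)`, with differential `∂ + (-1)^q d_M`. -/
def totalExtension (F : C ⥤ CochainComplex V ℕ) [F.PreservesZeroMorphisms] :
    CochainComplex C ℤ ⥤ CochainComplex V ℤ :=
  F.mapHomologicalComplex (ComplexShape.up ℤ) ⋙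
    HomologicalComplex₂.flipFunctor V (ComplexShape.up ℤ) (ComplexShape.up ℕ) ⋙
    HomologicalComplex₂.totalFunctor V (ComplexShape.up ℕ) (ComplexShape.up ℤ) (ComplexShape.up ℤ)

/-- Extension of a natural transformation from objects to complexes. -/
def totalExtensionMap {F F' : C ⥤ CochainComplex V ℕ} [F.PreservesZeroMorphisms]
    [F'.PreservesZeroMorphisms] (τ : F ⟶ F') : totalExtension F ⟶ totalExtension F' :=
  Functor.whiskerRight (NatTrans.mapHomologicalComplex τ (ComplexShape.up ℤ)) _

/-- Extension of an augmentation `η : G → F^0` with `∂ η = 0` from objects to complexes. -/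
def totalAugmentation {F : C ⥤ CochainComplex V ℕ} [F.PreservesZeroMorphisms]
    {G : C ⥤ V} [G.PreservesZeroMorphisms]
    (η : G ⟶ F ⋙ HomologicalComplex.eval V (ComplexShape.up ℕ) 0)
    (hη : ∀ M, η.app M ≫ (F.obj M).d 0 1 = 0) :
    G.mapHomologicalComplex (ComplexShape.up ℤ) ⟶ totalExtension F where
  app M :=
    { f := fun p => η.app (M.X p) ≫ HomologicalComplex₂.ιTotal
        (HomologicalComplex₂.flip ((F.mapHomologicalComplex (ComplexShape.up ℤ)).obj M))
        (ComplexShape.up ℤ) 0 p p (zero_add p)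
      comm' := fun p p' h => by
        have h0 : (ComplexShape.up ℕ).Rel 0 1 := rfl
        have e1 := HomologicalComplex₂.d₁_eq'
          (HomologicalComplex₂.flip ((F.mapHomologicalComplex (ComplexShape.up ℤ)).obj M))
          (ComplexShape.up ℤ) h0 p p'
        have e2 := HomologicalComplex₂.d₂_eq
          (HomologicalComplex₂.flip ((F.mapHomologicalComplex (ComplexShape.up ℤ)).obj M))
          (ComplexShape.up ℤ) 0 h p' (zero_add p')
        have n := η.naturality (M.d p p')
        have h1 := hη (M.X p)
        have e3 : HomologicalComplex₂.ιTotal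
            (HomologicalComplex₂.flip ((F.mapHomologicalComplex (ComplexShape.up ℤ)).obj M))
            (ComplexShape.up ℤ) 0 p p (zero_add p) ≫ ((totalExtension F).obj M).d p p' =
            (F.obj (M.X p)).d 0 1 ≫ HomologicalComplex₂.ιTotalOrZero
              (HomologicalComplex₂.flip ((F.mapHomologicalComplex (ComplexShape.up ℤ)).obj M))
              (ComplexShape.up ℤ) 1 p p' +
            (F.map (M.d p p')).f 0 ≫ HomologicalComplex₂.ιTotal
              (HomologicalComplex₂.flip ((F.mapHomologicalComplex (ComplexShape.up ℤ)).obj M))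
              (ComplexShape.up ℤ) 0 p' p' (zero_add p') := by
          refine (Preadditive.comp_add _ _ _ _ _ _).trans (congrArg₂ (· + ·) ?_ ?_)
          · exact (HomologicalComplex₂.ι_D₁ _ _ _ _ _ _ _).trans (e1.trans (one_smul _ _))
          · exact (HomologicalComplex₂.ι_D₂ _ _ _ _ _ _ _).trans (e2.trans (one_smul _ _))
        exact totalAugmentation_aux e3 h1 n }
  naturality M N f := by
    refine HomologicalComplex.Hom.ext (funext fun p => ?_)
    have n := η.naturality (f.f p)
    exact totalAugmentation_aux' (HomologicalComplex₂.ιTotal_map _ _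
      ((HomologicalComplex₂.flipFunctor V (ComplexShape.up ℤ) (ComplexShape.up ℕ)).map
        ((F.mapHomologicalComplex (ComplexShape.up ℤ)).map f)) (ComplexShape.up ℤ) 0 p p
        (zero_add p)) n

end Total

section Commutative

/-- A functor to complexes, viewed as a complex of functors. -/
def complexOfFunctor (C V : Type*) [Category* C] [Category* V] [HasZeroMorphisms V] {ι : Type*}
    (c : ComplexShape ι) : (C ⥤ HomologicalComplex V c) ⥤ HomologicalComplex (C ⥤ V) c where
  obj G :=
    { X := fun i => G ⋙ HomologicalComplex.eval V c i
      d := fun i j =>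
        { app := fun Z => (G.obj Z).d i j
          naturality := fun Z Z' f => (G.map f).comm i j }
      shape := fun i j h => NatTrans.ext (funext fun Z => (G.obj Z).shape i j h)
      d_comp_d' := fun i j k _ _ => NatTrans.ext (funext fun Z => (G.obj Z).d_comp_d i j k) }
  map τ :=
    { f := fun i => Functor.whiskerRight τ (HomologicalComplex.eval V c i)
      comm' := fun i j _ => NatTrans.ext (funext fun Z => (τ.app Z).comm i j) }

/-! ### Commutative Čech resolutions -/

variable (K : Type u) [Field K] (X : TopCat.{u})

/-- The category of complete dir-inv `K_X`-modules. -/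
abbrev CompleteDirInvSheaf := (DirInvSheaf.isComplete K X).FullSubcategory

/-- The underlying sheaf of a complete dir-inv `K_X`-module, as a presheaf. -/
def forgetDirInv : CompleteDirInvSheaf K X ⥤ ModPsh K X where
  obj M := M.obj.psh
  map f := f.hom.hom.hom

instance : (forgetDirInv K X).PreservesZeroMorphisms where
  map_zero _ _ := rfl

variable {K X}

section Resolution

variable {m : ℕ} (U : Fin (m + 1) → Opens X)

/-- The complex of presheaves `N C(U, M)`. -/
def normCech : CompleteDirInvSheaf K X ⥤ CochainComplex (ModPsh K X) ℕ :=
  (DirInvSheaf.isComplete K X).ι ⋙ cech U ⋙ (Functor.whiskeringRight _ _ _).obj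
    ((Functor.whiskeringRight _ _ _).obj DirInvMod.forget ⋙ normFunctor K) ⋙
    complexOfFunctor _ _ _

/-- The complex of presheaves `Ñ̂ C(U, M)`, whose sections over `V` are the complete
Thom-Sullivan normalization of the cosimplicial dir-inv module `Γ(V, C(U, M))`. -/
def commCech : CompleteDirInvSheaf K X ⥤ CochainComplex (ModPsh K X) ℕ :=
  (DirInvSheaf.isComplete K X).ι ⋙ cech U ⋙ (Functor.whiskeringRight _ _ _).obj (tsFunctor K) ⋙
    complexOfFunctor _ _ _

theorem ctensorMap_of_lin_eq_zero {A B : Type u} [AddCommGroup A] [Module K A] [AddCommGroup B]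
    [Module K B] {M N : DirInvMod K} (f : A →ₗ[K] B) (g : M ⟶ N) (hg : g.lin = 0)
    (u : DirInvMod.CTensor A M) : DirInvMod.ctensorMap f g u = 0 := by
  induction u using DirInvMod.Completion.ind with
  | h x hx =>
    refine (Submodule.Quotient.mk_eq_zero _).2 ?_
    have : (fun n => (DirInvMod.tensorMap (DirInvMod.discreteMap f) g).lin (x n)) = 0 := by
      funext n
      change TensorProduct.map f g.lin (x n) = 0
      rw [hg, TensorProduct.map_zero_right]
      rfl
    change (fun n => (DirInvMod.tensorMap (DirInvMod.discreteMap f) g).lin (x n)) ∈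
      DirInvMod.null _
    rw [this]
    exact zero_mem _

instance : (normCech (K := K) U).PreservesZeroMorphisms where
  map_zero M N := by
    refine HomologicalComplex.Hom.ext (funext fun q => NatTrans.ext (funext fun V =>
      ModuleCat.hom_ext (LinearMap.ext fun u => Subtype.ext ?_)))
    rfl

instance : (commCech (K := K) U).PreservesZeroMorphisms where
  map_zero M N := by
    refine HomologicalComplex.Hom.ext (funext fun q => NatTrans.ext (funext fun V =>
      ModuleCat.hom_ext (LinearMap.ext fun u => Subtype.ext (funext fun n => ?_))))
    refine ctensorMap_of_lin_eq_zero _ _ ?_ (u.1 n)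
    rfl

variable (K) in
/-- The constant function `1` in `Ω^0(Δ^n)`. -/
def OmOne (n : SimplexCategory) : Om K 0 n :=
  AlternatingMap.constOfIsEmpty K (SimplexTangent K (Fin (n.len + 1))) (Fin 0)
    (1 : SimplexRing K (Fin (n.len + 1)))

theorem OmMap_OmOne {k l : SimplexCategory} (α : k ⟶ l) : OmMap 0 α (OmOne K l) = OmOne K k :=
  AlternatingMap.ext fun _ => map_one (simplexRingMap (K := K)
    (α.toOrderHom : Fin (k.len + 1) → Fin (l.len + 1)))

theorem OmD_OmOne (n : SimplexCategory) : OmD 0 n (OmOne K n) = 0 := by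
  refine AlternatingMap.ext fun v => (extD_apply _ v).trans ?_
  refine Finset.sum_eq_zero fun i _ => ?_
  have h : dirDeriv K (Fin (n.len + 1)) (v i) 1 = 0 := by
    have := dirDeriv_mul (v i) (1 : SimplexRing K (Fin (n.len + 1))) 1
    simpa using this
  exact (congrArg _ h).trans (smul_zero _)

/-- For an augmentation `e` of a cosimplicial dir-inv module `B` with complete terms by a
module `A`, the map from `A` to the complete Thom-Sullivan cochains of degree `0` that sends `a`
to the sequence of the `1 ⊗ e_l(a)`. -/
def tsUnit {B : CosimplicialObject (DirInvMod K)} (hB : ∀ n, (B.obj n).EqualsCompletion)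
    {A : Type u} [AddCommGroup A] [Module K A] (e : ∀ n, A →ₗ[K] B.obj n)
    (he : ∀ {k l : SimplexCategory} (α : k ⟶ l) (a : A), (B.map α).lin (e k a) = e l a) :
    A →ₗ[K] tsSub B 0 where
  toFun a := ⟨fun n => DirInvMod.cmk (hB n) (OmOne K n) (e n a), fun k l α => by
    rw [DirInvMod.ctensorMap_cmk _ (hB l), DirInvMod.ctensorMap_cmk _ (hB l), OmMap_OmOne, he]
    rfl⟩
  map_add' a b := Subtype.ext (funext fun n =>
    (congrArg (DirInvMod.cmk (hB n) (OmOne K n)) (map_add (e n) a b)).trans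
      (map_add (DirInvMod.cmk (hB n) (OmOne K n)) _ _))
  map_smul' c a := Subtype.ext (funext fun n =>
    (congrArg (DirInvMod.cmk (hB n) (OmOne K n)) (map_smul (e n) c a)).trans
      (map_smul (DirInvMod.cmk (hB n) (OmOne K n)) _ _))

theorem tsD_tsUnit {B : CosimplicialObject (DirInvMod K)} (hB : ∀ n, (B.obj n).EqualsCompletion)
    {A : Type u} [AddCommGroup A] [Module K A] (e : ∀ n, A →ₗ[K] B.obj n)
    (he : ∀ {k l : SimplexCategory} (α : k ⟶ l) (a : A), (B.map α).lin (e k a) = e l a) (a : A) :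
    tsD B 0 (tsUnit hB e he a) = 0 := by
  refine Subtype.ext (funext fun n => ?_)
  change DirInvMod.ctensorMap (OmD 0 n) (𝟙 (B.obj n)) (DirInvMod.cmk (hB n) (OmOne K n) (e n a)) = 0
  rw [DirInvMod.ctensorMap_cmk _ (hB n), OmD_OmOne]
  refine congrArg (Submodule.Quotient.mk (p := Submodule.comap _ _)) (Subtype.ext (funext fun _ => ?_))
  exact TensorProduct.zero_tmul _ _

/-- The augmentation `Γ(V, M) → Γ(V, C^n(U, M))`, `s ↦ (s|_{V ∩ U_i})_i`. -/
def cechAugmentation (M : DirInvSheaf K X) (V : Opens X) (n : SimplexCategory) :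
    M.psh.obj (op V) →ₗ[K] cechObj U M V n :=
  LinearMap.pi fun i => M.psh.res (inf_le_left : V ⊓ cechOpen U i ≤ V)

theorem cech_map_augmentation (M : DirInvSheaf K X) (V : (Opens X)ᵒᵖ) {k l : SimplexCategory}
    (α : k ⟶ l) (s : M.psh.obj V) :
    ((((cech U).obj M).obj V).map α).lin (cechAugmentation U M V.unop k s) =
      cechAugmentation U M V.unop l s :=
  funext fun _ => M.psh.res_res _ _ _

/-- The embedding `M → Ñ̂^0 C(U, M)`, which sends a section `s` over `V` to the sequence of the
`1 ⊗ (s|_{V ∩ U_i})_i` in `Ω^0(Δ^l) ⊗̂ Γ(V, C^l(U, M))`. -/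
def commCechUnit [NoetherianSpace X] : forgetDirInv K X ⟶
    commCech U ⋙ HomologicalComplex.eval _ (ComplexShape.up ℕ) 0 where
  app M :=
    { app := fun V => ModuleCat.ofHom (tsUnit (cech_equalsCompletion U M.property V)
        (cechAugmentation U M.obj V.unop) (cech_map_augmentation U M.obj V))
      naturality := fun _ W f => ModuleCat.hom_ext (LinearMap.ext fun s => Subtype.ext (funext
        fun n => congrArg (DirInvMod.cmk (cech_equalsCompletion U M.property W n) (OmOne K n))
          (funext fun _ => (M.obj.psh.res_res inf_le_left (leOfHom f.unop) s).trans
            (M.obj.psh.res_res _ _ s).symm))) }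
  naturality _ N f := NatTrans.ext (funext fun V => ModuleCat.hom_ext (LinearMap.ext fun s =>
    Subtype.ext (funext fun n => congrArg
      (DirInvMod.cmk (cech_equalsCompletion U N.property V n) (OmOne K n))
      (funext fun _ => (ModPsh.res_app f.hom.hom.hom inf_le_left s).symm))))

theorem commCechUnit_d [NoetherianSpace X] (M : CompleteDirInvSheaf K X) :
    (commCechUnit U).app M ≫ ((commCech U).obj M).d 0 1 = 0 := by
  refine NatTrans.ext (funext fun V => ?_)
  have h : (tsComplex (((cech U).obj M.obj).obj V)).d 0 1 =
      ModuleCat.ofHom (tsD (((cech U).obj M.obj).obj V) 0) := by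
    simp only [tsComplex]
    exact CochainComplex.of_d _ _ 0
  refine (congrArg (fun g => ((commCechUnit U).app M).app V ≫ g) h).trans ?_
  exact ModuleCat.hom_ext (LinearMap.ext fun s => tsD_tsUnit _ _
    (cech_map_augmentation U M.obj V) s)

/-- The integration map `∫_Δ : Ñ̂ C(U, M) → N C(U, M)`. -/
def cechIntegral [CharZero K] [NoetherianSpace X] : commCech (K := K) U ⟶ normCech U where
  app M := (complexOfFunctor _ _ _).map
    { app := fun V => integral (cech_equalsCompletion U M.property V)
      naturality := fun _ _ f => integral_naturality _ _ (((cech U).obj M.obj).map f) }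
  naturality M N f := HomologicalComplex.Hom.ext (funext fun q => NatTrans.ext (funext fun V =>
    congrArg (fun g => g.f q) (integral_naturality (cech_equalsCompletion U M.property V)
      (cech_equalsCompletion U N.property V) (((cech U).map f.hom).app V))))

end Resolution


/-- The complex of sheaves given by a complex of presheaves whose terms are sheaves. -/
def toSheafComplex (P : CochainComplex (ModPsh K X) ℤ)
    (hP : ∀ i, Presheaf.IsSheaf (Opens.grothendieckTopology X) (P.X i)) :
    CochainComplex (ModSheaf K X) ℤ where
  X i := ⟨P.X i, hP i⟩
  d i j := ⟨P.d i j⟩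
  shape i j h := Sheaf.hom_ext (P.shape i j h)
  d_comp_d' i j k _ _ := Sheaf.hom_ext (P.d_comp_d i j k)

/-- The morphism of complexes of sheaves given by a morphism of complexes of presheaves whose
terms are sheaves. -/
def toSheafHom {P Q : CochainComplex (ModPsh K X) ℤ} (f : P ⟶ Q)
    (hP : ∀ i, Presheaf.IsSheaf (Opens.grothendieckTopology X) (P.X i))
    (hQ : ∀ i, Presheaf.IsSheaf (Opens.grothendieckTopology X) (Q.X i)) :
    toSheafComplex P hP ⟶ toSheafComplex Q hQ where
  f i := ⟨f.f i⟩
  comm' i j _ := Sheaf.hom_ext (f.comm i j)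

variable {m : ℕ} (U : Fin (m + 1) → Opens X)

/-- The complex of presheaves underlying a complex of complete dir-inv `K_X`-modules. -/
def underlyingComplex : CochainComplex (CompleteDirInvSheaf K X) ℤ ⥤
    CochainComplex (ModPsh K X) ℤ :=
  (forgetDirInv K X).mapHomologicalComplex (ComplexShape.up ℤ)

theorem underlyingComplex_isSheaf (M : CochainComplex (CompleteDirInvSheaf K X) ℤ) (i : ℤ) :
    Presheaf.IsSheaf (Opens.grothendieckTopology X) ((underlyingComplex.obj M).X i) :=
  (M.X i).obj.sheaf.property

/-- `N C(U, M)` for a complex `M`: the total complex of the `N^q C(U, M^p)`. -/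
def totalNormCech : CochainComplex (CompleteDirInvSheaf K X) ℤ ⥤ CochainComplex (ModPsh K X) ℤ :=
  totalExtension (normCech U)

/-- `Ñ̂ C(U, M)` for a complex `M`: the total complex of the `Ñ̂^q C(U, M^p)`. -/
def totalCommCech : CochainComplex (CompleteDirInvSheaf K X) ℤ ⥤ CochainComplex (ModPsh K X) ℤ :=
  totalExtension (commCech U)

/-- The functorial homomorphism `M → Ñ̂ C(U, M)` for complexes `M`. -/
def totalUnit [NoetherianSpace X] : underlyingComplex (K := K) ⟶ totalCommCech U :=
  totalAugmentation (commCechUnit U) (commCechUnit_d U)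

/-- The functorial homomorphism `∫_Δ : Ñ̂ C(U, M) → N C(U, M)` for complexes `M`. -/
def totalIntegral [CharZero K] [NoetherianSpace X] :
    totalCommCech (K := K) U ⟶ totalNormCech U :=
  totalExtensionMap (cechIntegral U)

end Commutative

end

/-! The heart of the matter is the category of simplicial `K`-vector spaces, before any `B` or any
sheaf enters. The polynomial forms `Ω^q(Δ^•)` and the normalized simplicial cochains of the standard
simplices are two complexes in that category, and both are injective resolutions of the constant
object `K`. They resolve `K` by the polynomial Poincaré lemma (Euler vector field, characteristic
`0`) and by coning off a simplex from the vertex `0`. Their terms are injective because functions on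
the vertices act on them compatibly with the simplicial structure
(`SimplicialObject.injective_of_vertex_mul`): this kills the homology of the normalized Moore
complex, and an acyclic nonnegative chain complex over a field is injective, so Dold–Kan applies.
Integration is a morphism of resolutions by Stokes, hence a homotopy equivalence
(`formToCochainEquiv`).

For a cosimplicial dir-inv module `B` with complete terms, send a simplicial space `A` to the
compatible families in `∏ A_n ⊗̂ B^n`. This functor is additive. On forms it gives the Thom–Sullivan
normalization; on normalized cochains, which are finite dimensional on each simplex, a Yoneda
argument gives `N B` (`endSubEval_bijective`). Additive functors preserve homotopy equivalences, so
`∫_Δ` is a quasi-isomorphism for every such `B` (`quasiIso_integral`), and no exactness of `⊗̂` is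
ever needed.

For a bounded below complex `M` the total complexes are filtered by the degree `p` of `M`; in each
total degree the filtration is finite, and the graded pieces are the columns. A column by column
statement therefore passes to the totals (`quasiIso_of_columns`, `quasiIso_of_augmentation`). This
proves part 1.

For part 2, over an open set inside a member `U v` of the covering the normalized Čech complex is
contracted by inserting the vertex `v` at its place in a simplex. Hence `M → N C` is a resolution
there, and `∫_Δ` transfers the exactness to the Thom–Sullivan side. Such open sets form a basis, and
sheafification is exact, so sectionwise quasi-isomorphisms over them give quasi-isomorphisms of
sheaves (`quasiIso_toSheafHom`).

The terms are sheaves because an element of `A ⊗̂ M`, in coordinates for a basis of `A`, is a family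
in a single `F j` with only finitely many members outside each `G j k`. Such families glue over
finite coverings, and on a noetherian space finite coverings suffice (`hasGluing_ctensor`). -/

noncomputable section

/-! ### Injective simplicial vector spaces -/

section InjectiveSimplicial

variable {K : Type u} [Field K]

/-- Over a field an exact complex has a contraction `t` with `d t + t d = 1`. A degreewise linear
extension `g` of a chain map is then corrected to the chain map `d t g + t g d`. The hypothesis at
`n = 0` says that `d : A_1 → A_0` is onto, since every element of `A_0` is a cycle. -/
theorem ChainComplex.injective_of_exact (A : ChainComplex (ModuleCat.{u} K) ℕ)
    (hA : ∀ n (x : A.X n), (∀ m, A.d n m x = 0) → ∃ y : A.X (n + 1), A.d (n + 1) n y = x) :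
    Injective A := by
  -- `s n` is a linear section of `d` over its image, extended arbitrarily to all of `A_n`; only its
  -- values on cycles matter.
  have hs : ∀ n, ∃ s : A.X n →ₗ[K] A.X (n + 1),
      ∀ x, (∀ m, A.d n m x = 0) → A.d (n + 1) n (s x) = x := by
    intro n
    obtain ⟨s, hs⟩ := (A.d (n + 1) n).hom.rangeRestrict.exists_rightInverse_of_surjective
      (LinearMap.range_rangeRestrict _)
    obtain ⟨e, he⟩ := LinearMap.exists_extend s
    refine ⟨e, fun x hx => ?_⟩
    obtain ⟨y, rfl⟩ := hA n x hx
    have h1 := LinearMap.congr_fun he ⟨(A.d (n + 1) n).hom y, ⟨y, rfl⟩⟩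
    have h2 := LinearMap.congr_fun hs ⟨(A.d (n + 1) n).hom y, ⟨y, rfl⟩⟩
    have h3 := congrArg Subtype.val h2
    refine Eq.trans ?_ h3
    exact congrArg (A.d (n + 1) n) h1
  choose s hs using hs
  have dd : ∀ (i j k : ℕ) (x : A.X i), A.d j k (A.d i j x) = 0 := fun i j k x =>
    congrArg (fun f : A.X i ⟶ A.X k => f x) (A.d_comp_d i j k)
  have dne : ∀ (i j : ℕ) (x : A.X i), j + 1 ≠ i → A.d i j x = 0 := fun i j x hij => by
    rw [A.shape i j hij]; rfl
  -- Subtracting `s d x` turns `x` into a cycle, to which `s` may be applied. On boundaries `t` and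
  -- `s` agree, which is what makes `d t + t d` the identity.
  let t : ∀ n, A.X n →ₗ[K] A.X (n + 1) := fun n => match n with
    | 0 => s 0
    | n + 1 => s (n + 1) ∘ₗ (LinearMap.id - s n ∘ₗ (A.d (n + 1) n).hom)
  have t0 : ∀ x : A.X 0, A.d 1 0 (t 0 x) = x := fun x => hs 0 x fun m => dne _ _ _ (by omega)
  have ht : ∀ n (x : A.X (n + 1)),
      A.d (n + 2) (n + 1) (t (n + 1) x) + t n (A.d (n + 1) n x) = x := by
    intro n x
    have hc : ∀ m, A.d (n + 1) m (x - s n (A.d (n + 1) n x)) = 0 := by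
      intro m
      by_cases hm : m + 1 = n + 1
      · obtain rfl : m = n := by omega
        rw [map_sub, hs _ _ (fun k => dd _ _ _ _), sub_self]
      · exact dne _ _ _ hm
    have e1 : A.d (n + 2) (n + 1) (t (n + 1) x) = x - s n (A.d (n + 1) n x) := hs _ _ hc
    have e2 : t n (A.d (n + 1) n x) = s n (A.d (n + 1) n x) := by
      cases n with
      | zero => rfl
      | succ n =>
        change s (n + 1) (A.d (n + 2) (n + 1) x - s n (A.d (n + 1) n (A.d (n + 2) (n + 1) x))) = _
        rw [dd, map_zero, sub_zero]
    rw [e1, e2, sub_add_cancel]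
  refine ⟨fun {X Y} f i hi => ?_⟩
  have hg : ∀ n, ∃ g : Y.X n →ₗ[K] A.X n, ∀ x : X.X n, g (i.f n x) = f.f n x := by
    intro n
    have hm : Function.Injective (i.f n) := (ModuleCat.mono_iff_injective _).1 inferInstance
    obtain ⟨r, hr⟩ := (i.f n).hom.exists_leftInverse_of_injective (LinearMap.ker_eq_bot.2 hm)
    exact ⟨(f.f n).hom ∘ₗ r, fun x => congrArg (f.f n) (LinearMap.congr_fun hr x)⟩
  choose g hg using hg
  -- Being `d (t g) + (t g) d`, this commutes with `d` whatever `g` is. Along the monomorphism it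
  -- restricts to `(d t + t d) f = f`.
  let g' : ∀ n, Y.X n →ₗ[K] A.X n := fun n => match n with
    | 0 => (A.d 1 0).hom ∘ₗ t 0 ∘ₗ g 0
    | n + 1 => (A.d (n + 2) (n + 1)).hom ∘ₗ t (n + 1) ∘ₗ g (n + 1) +
        t n ∘ₗ g n ∘ₗ (Y.d (n + 1) n).hom
  have ddY : ∀ (i j k : ℕ) (x : Y.X i), Y.d j k (Y.d i j x) = 0 := fun i j k x =>
    congrArg (fun f : Y.X i ⟶ Y.X k => f x) (Y.d_comp_d i j k)
  have comm : ∀ {P Q : ChainComplex (ModuleCat.{u} K) ℕ} (φ : P ⟶ Q) (a b : ℕ) (x : P.X a),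
      φ.f b (P.d a b x) = Q.d a b (φ.f a x) := fun {P Q} φ a b x =>
    congrArg (fun h : P.X a ⟶ Q.X b => h x) (φ.comm a b).symm
  refine ⟨{ f := fun n => ModuleCat.ofHom (g' n), comm' := ?_ }, ?_⟩
  · rintro a n rfl
    refine ModuleCat.hom_ext (LinearMap.ext fun y => ?_)
    change A.d (n + 1) n (A.d (n + 2) (n + 1) (t (n + 1) (g (n + 1) y)) +
      t n (g n (Y.d (n + 1) n y))) = g' n (Y.d (n + 1) n y)
    rw [map_add, dd, zero_add]
    cases n with
    | zero => rfl
    | succ n =>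
      change _ = A.d (n + 2) (n + 1) (t (n + 1) (g (n + 1) (Y.d (n + 2) (n + 1) y))) +
        t n (g n (Y.d (n + 1) n (Y.d (n + 2) (n + 1) y)))
      rw [ddY, map_zero, map_zero, add_zero]
  · refine HomologicalComplex.Hom.ext (funext fun n =>
      ModuleCat.hom_ext (LinearMap.ext fun x => ?_))
    cases n with
    | zero =>
      change A.d 1 0 (t 0 (g 0 (i.f 0 x))) = f.f 0 x
      rw [hg, t0]
    | succ n =>
      change A.d (n + 2) (n + 1) (t (n + 1) (g (n + 1) (i.f (n + 1) x))) +
        t n (g n (Y.d (n + 1) n (i.f (n + 1) x))) = f.f (n + 1) x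
      rw [hg, ← comm, hg, comm, ht]

open AlgebraicTopology in
-- The terms of the Moore complex are intersections of kernel subobjects; an element is moved into
-- them by factoring the morphism `K → A_{n+1}` that it spans.
theorem exists_normalizedMoore_lift (A : SimplicialObject (ModuleCat.{u} K)) (n : ℕ)
    (x : A.obj (op ⦋n + 1⦌)) (hx : ∀ k : Fin (n + 1), A.δ k.succ x = 0) :
    ∃ y : ((NormalizedMooreComplex.objX A (n + 1) : Subobject _) : ModuleCat K),
      (NormalizedMooreComplex.objX A (n + 1)).arrow y = x := by
  let φ : ModuleCat.of K K ⟶ A.obj (op ⦋n + 1⦌) := ModuleCat.ofHom (LinearMap.toSpanSingleton K _ x)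
  have hφ : (NormalizedMooreComplex.objX A (n + 1)).Factors φ := by
    refine (Subobject.finset_inf_factors _).2 fun k _ => kernelSubobject_factors _ _ ?_
    refine ModuleCat.hom_ext (LinearMap.ext fun c => ?_)
    change A.δ k.succ (c • x) = 0
    rw [map_smul, hx, smul_zero]
  refine ⟨(Subobject.factorThru _ φ hφ) (1 : K), ?_⟩
  have h := congrArg (fun g : ModuleCat.of K K ⟶ _ => g (1 : K))
    (Subobject.factorThru_arrow _ φ hφ)
  refine Eq.trans h ?_
  exact one_smul K x

open AlgebraicTopology in
-- In degree `0` the target subobject is `⊤`, whose arrow is an isomorphism that has to be cancelled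
-- against its inverse; hence the separate case.
theorem normalizedMoore_d_arrow (A : SimplicialObject (ModuleCat.{u} K)) (n : ℕ) :
    ((normalizedMooreComplex _).obj A).d (n + 1) n ≫ (NormalizedMooreComplex.objX A n).arrow =
      (NormalizedMooreComplex.objX A (n + 1)).arrow ≫ A.δ 0 := by
  rw [normalizedMooreComplex_objD]
  cases n with
  | zero => exact (Category.assoc _ _ _).trans (congrArg _ ((Category.assoc _ _ _).trans
      ((congrArg _ (IsIso.inv_hom_id (⊤ : Subobject (A.obj (op ⦋0⦌))).arrow)).trans
        (Category.comp_id _))))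
  | succ n =>
    unfold NormalizedMooreComplex.objD
    exact Subobject.factorThru_arrow (NormalizedMooreComplex.objX A (n + 1)) _ _

/-- A simplicial vector space with a compatible multiplication by functions on the vertices is
contractible, and hence injective. -/
theorem SimplicialObject.injective_of_vertex_mul (A : SimplicialObject (ModuleCat.{u} K))
    (μ : ∀ n : ℕ, (Fin (n + 1) → K) →ₗ[K] A.obj (op ⦋n⦌) →ₗ[K] A.obj (op ⦋n⦌))
    (μ_one : ∀ n a, μ n 1 a = a)
    (μ_nat : ∀ {k n : ℕ} (α : ⦋k⦌ ⟶ ⦋n⦌) (f : Fin (n + 1) → K) (a : A.obj (op ⦋n⦌)),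
      A.map α.op (μ n f a) = μ k (fun i => f (α.toOrderHom i)) (A.map α.op a)) :
    Injective A := by
  -- Under Dold–Kan it is enough that the normalized Moore complex is exact in every degree.
  refine (Equivalence.map_injective_iff Abelian.DoldKan.equivalence A).1 ?_
  change Injective ((AlgebraicTopology.normalizedMooreComplex _).obj A)
  refine ChainComplex.injective_of_exact _ fun n x hx => ?_
  have hmono : ∀ k, Function.Injective
      (AlgebraicTopology.NormalizedMooreComplex.objX A k).arrow := fun k =>
    (ModuleCat.mono_iff_injective _).1 inferInstance
  have harr := fun k (y : ((AlgebraicTopology.normalizedMooreComplex _).obj A).X (k + 1)) =>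
    congrArg (fun f : ((AlgebraicTopology.normalizedMooreComplex _).obj A).X (k + 1) ⟶ _ => f y)
      (normalizedMoore_d_arrow A k)
  let a : A.obj (op ⦋n⦌) := (AlgebraicTopology.NormalizedMooreComplex.objX A n).arrow x
  -- A Moore cycle is killed by all faces, so by the simplicial identities the only faces of a
  -- degeneracy `σ_j a` that survive are the two with value `a`.
  have hface : ∀ (j : Fin (n + 1)) (i : Fin (n + 2)), i ≠ j.castSucc → i ≠ j.succ →
      A.δ i (A.σ j a) = 0 := by
    intro j i hi hi'
    cases n with
    | zero => fin_cases j; fin_cases i <;> simp_all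
    | succ n =>
      have ha : ∀ i : Fin (n + 2), A.δ i a = 0 := by
        intro i
        induction i using Fin.cases with
        | zero =>
          refine (harr n x).symm.trans ?_
          change (AlgebraicTopology.NormalizedMooreComplex.objX A n).arrow
            (((AlgebraicTopology.normalizedMooreComplex _).obj A).d (n + 1) n x) = 0
          rw [hx]
          exact map_zero (AlgebraicTopology.NormalizedMooreComplex.objX A n).arrow.hom
        | succ i =>
          have h : (AlgebraicTopology.NormalizedMooreComplex.objX A (n + 1)).arrow ≫ A.δ i.succ = 0 := by
            rw [AlgebraicTopology.NormalizedMooreComplex.objX_add_one,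
              ← Subobject.factorThru_arrow _ _ (Subobject.finset_inf_arrow_factors Finset.univ
              (fun k : Fin (n + 1) => kernelSubobject (A.δ k.succ)) i (by simp)), Category.assoc,
              kernelSubobject_arrow_comp, comp_zero]
          exact congrArg (fun f : ((AlgebraicTopology.normalizedMooreComplex _).obj A).X (n + 1) ⟶ _
            => f x) h
      rcases lt_or_gt_of_ne hi with hlt | hgt
      · obtain ⟨j, rfl⟩ := Fin.exists_succ_eq.2 (show j ≠ 0 by rintro rfl; simp at hlt)
        obtain ⟨i, rfl⟩ := Fin.exists_castSucc_eq.2 (show i ≠ Fin.last _ by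
          rintro rfl
          exact absurd hlt (Fin.le_last _).not_gt)
        have h := congrArg (fun f : A.obj (op ⦋n + 1⦌) ⟶ A.obj (op ⦋n + 1⦌) => f a)
          (A.δ_comp_σ_of_le (i := i) (j := j) (by
            simp only [Fin.lt_def, Fin.le_def, Fin.val_castSucc, Fin.val_succ] at hlt ⊢; omega))
        refine h.trans ?_
        change A.σ j (A.δ i a) = 0
        rw [ha, map_zero]
      · have hgt' : j.succ < i := by
          have : (i : ℕ) ≠ j + 1 := fun h => hi' (Fin.ext h)
          simp only [Fin.lt_def, Fin.val_castSucc, Fin.val_succ] at hgt ⊢; omega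
        have h := congrArg (fun f : A.obj (op ⦋n + 1⦌) ⟶ A.obj (op ⦋n + 1⦌) => f a)
          (A.δ_comp_σ_of_gt' hgt')
        refine h.trans ?_
        change A.σ _ (A.δ _ a) = 0
        rw [ha, map_zero]
  -- `c j` is the indicator of the vertices after `j`. In the zeroth face of `b` only `j = 0`
  -- survives, with function `1`. In the face `k + 1` the terms `j = k` and `j = k + 1` survive,
  -- with the same function of the vertices and opposite signs. So `b` is a Moore chain with
  -- boundary `a`.
  let c : Fin (n + 1) → Fin (n + 2) → K := fun j i => if j.castSucc < i then 1 else 0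
  let b : A.obj (op ⦋n + 1⦌) := ∑ j : Fin (n + 1), (-1 : ℤ) ^ (j : ℕ) • μ (n + 1) (c j) (A.σ j a)
  have hb : ∀ i : Fin (n + 2), A.δ i b = ∑ j : Fin (n + 1), (-1 : ℤ) ^ (j : ℕ) •
      μ n (fun k => c j (i.succAbove k)) (A.δ i (A.σ j a)) := by
    intro i
    rw [map_sum]
    refine Finset.sum_congr rfl fun j _ => ?_
    rw [map_zsmul]
    exact congrArg _ (μ_nat (SimplexCategory.δ i) (c j) (A.σ j a))
  have hself : ∀ j : Fin (n + 1), A.δ j.castSucc (A.σ j a) = a := fun j =>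
    congrArg (fun f : A.obj (op ⦋n⦌) ⟶ A.obj (op ⦋n⦌) => f a) (A.δ_comp_σ_self (i := j))
  have hsucc : ∀ j : Fin (n + 1), A.δ j.succ (A.σ j a) = a := fun j =>
    congrArg (fun f : A.obj (op ⦋n⦌) ⟶ A.obj (op ⦋n⦌) => f a) (A.δ_comp_σ_succ (i := j))
  have hb0 : A.δ 0 b = a := by
    rw [hb, Finset.sum_eq_single 0]
    · have e : (fun k : Fin (n + 1) => c 0 ((0 : Fin (n + 2)).succAbove k)) = 1 := by
        funext k
        simp [c]
      have h := hself 0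
      rw [Fin.castSucc_zero] at h
      rw [e, μ_one, h]
      simp
    · intro j _ hj
      rw [hface j 0 (fun h => hj (Fin.castSucc_eq_zero_iff.1 h.symm)) (Fin.succ_ne_zero j).symm,
        map_zero, smul_zero]
    · simp
  have hbs : ∀ k : Fin (n + 1), A.δ k.succ b = 0 := by
    intro k
    rw [hb]
    have e1 : ∀ j : Fin (n + 1), j ≠ k → (j : ℕ) ≠ k + 1 →
        (-1 : ℤ) ^ (j : ℕ) • μ n (fun l => c j (k.succ.succAbove l)) (A.δ k.succ (A.σ j a)) = 0 := by
      intro j hj hj'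
      rw [hface j k.succ (fun h => hj' (by simpa using (congrArg Fin.val h).symm))
        (fun h => hj (Fin.succ_injective _ h).symm), map_zero, smul_zero]
    have hc : ∀ l : Fin (n + 1), c k (k.succ.succAbove l) = if k < l then 1 else 0 := by
      intro l
      simp only [c, Fin.succAbove, Fin.lt_def, Fin.val_castSucc, Fin.val_succ]
      by_cases h : (l : ℕ) < k + 1
      · simp [h, show ¬ (k : ℕ) < l by omega]
      · simp [h, show (k : ℕ) < l by omega, show (k : ℕ) < l + 1 by omega]
    -- For the last face `k = n` there is no partner `j = k + 1`, but the function of the remaining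
    -- term vanishes.
    by_cases hk : (k : ℕ) + 1 < n + 1
    · let k' : Fin (n + 1) := ⟨k + 1, hk⟩
      have hkk : k ≠ k' := fun h => by simpa [k'] using congrArg Fin.val h
      rw [Fintype.sum_eq_add k k' hkk
        (fun j hj => e1 j hj.1 fun h => hj.2 (Fin.ext h))]
      have hc' : ∀ l : Fin (n + 1), c k' (k.succ.succAbove l) = if k < l then 1 else 0 := by
        intro l
        simp only [c, k', Fin.succAbove, Fin.lt_def, Fin.val_castSucc, Fin.val_succ]
        by_cases h : (l : ℕ) < k + 1
        · simp [h, show ¬ (k : ℕ) < l by omega, show ¬ (k : ℕ) + 1 < l by omega]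
        · simp [h, show (k : ℕ) < l by omega]
      have h2 : A.δ k.succ (A.σ k' a) = a := hself k'
      rw [hsucc, h2]
      simp only [hc, hc', k', pow_succ]
      simp
    · rw [Fintype.sum_eq_single k (fun j hj => e1 j hj (by have := j.2; omega))]
      have e : (fun l : Fin (n + 1) => c k (k.succ.succAbove l)) = 0 := by
        funext l
        rw [hc, if_neg (by have := l.2; simp only [Fin.lt_def]; omega)]
        rfl
      rw [e, map_zero, LinearMap.zero_apply, smul_zero]
  obtain ⟨y, hy⟩ := exists_normalizedMoore_lift A n b hbs
  refine ⟨y, hmono n ((harr n y).trans ?_)⟩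
  change A.δ 0 ((AlgebraicTopology.NormalizedMooreComplex.objX A (n + 1)).arrow y) = _
  rw [hy, hb0]

end InjectiveSimplicial

/-! ### The Poincaré lemma for polynomial forms on the simplex -/

section Poincare

variable {K : Type u} [Field K] {n : ℕ}

variable (K n) in
/-- The coordinate functions on the simplex. -/
def simplexCoord (i : Fin (n + 1)) : SimplexRing K (Fin (n + 1)) :=
  Ideal.Quotient.mk _ (MvPolynomial.X i)

theorem dirDeriv_simplexCoord (v : SimplexTangent K (Fin (n + 1))) (i : Fin (n + 1)) :
    dirDeriv K _ v (simplexCoord K n i) = algebraMap K _ (v.1 i) := by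
  rw [simplexCoord, dirDeriv_mk, polyDeriv_X]; rfl

theorem dirDeriv_algebraMap (v : SimplexTangent K (Fin (n + 1))) (c : K) :
    dirDeriv K _ v (algebraMap K _ c) = 0 := by
  change dirDeriv K _ v (Ideal.Quotient.mk _ (MvPolynomial.C c)) = 0
  rw [dirDeriv_mk, polyDeriv_C, map_zero]

theorem sum_simplexCoord : ∑ i, simplexCoord K n i = 1 := by
  rw [← sub_eq_zero, ← map_one (Ideal.Quotient.mk (simplexIdeal K (Fin (n + 1))))]
  simp only [simplexCoord]
  rw [← map_sum, ← map_sub]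
  exact Ideal.Quotient.eq_zero_iff_mem.2 (Ideal.subset_span rfl)

variable (K n) in
/-- The Euler operator of the vector field that points away from the vertex `0`. -/
def eulerOp : SimplexRing K (Fin (n + 1)) →ₗ[K] SimplexRing K (Fin (n + 1)) :=
  ∑ i : Fin n, LinearMap.mulLeft K (simplexCoord K n i.succ) ∘ₗ dirDeriv K _ (edgeVec K 0 i.succ)

theorem eulerOp_apply (x : SimplexRing K (Fin (n + 1))) :
    eulerOp K n x = ∑ i : Fin n, simplexCoord K n i.succ * dirDeriv K _ (edgeVec K 0 i.succ) x := by
  simp [eulerOp]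

variable (K n) in
/-- The affine parametrization of the simplex by the coordinates other than the zeroth. -/
def affineParam : MvPolynomial (Fin n) K →ₐ[K] SimplexRing K (Fin (n + 1)) :=
  MvPolynomial.aeval fun i => simplexCoord K n i.succ

/-- The inverse substitutes `1 - ∑ t_i` for `t_0`. Working in a polynomial ring gives access to
monomials and coefficients. -/
theorem affineParam_bijective : Function.Bijective (affineParam K n) := by
  let φ₀ : MvPolynomial (Fin (n + 1)) K →ₐ[K] MvPolynomial (Fin n) K :=
    MvPolynomial.aeval (Fin.cons (1 - ∑ i, MvPolynomial.X i) MvPolynomial.X)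
  let φ : SimplexRing K (Fin (n + 1)) →ₐ[K] MvPolynomial (Fin n) K :=
    Ideal.Quotient.liftₐ (simplexIdeal K (Fin (n + 1))) φ₀ (by
      intro p hp
      obtain ⟨a, rfl⟩ := Ideal.mem_span_singleton'.1 hp
      have : φ₀ (∑ i, MvPolynomial.X i - 1) = 0 := by
        rw [map_sub, map_sum, map_one, Fin.sum_univ_succ]
        simp [φ₀]
      rw [map_mul, this, mul_zero])
  have hφ : ∀ i, φ (simplexCoord K n i) =
      (Fin.cons (1 - ∑ i, MvPolynomial.X i) MvPolynomial.X : Fin (n + 1) → MvPolynomial (Fin n) K) i :=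
    fun i => (Ideal.Quotient.lift_mk _ _ _).trans (MvPolynomial.aeval_X _ _)
  have h1 : φ.comp (affineParam K n) = AlgHom.id K _ := by
    refine MvPolynomial.algHom_ext fun i => ?_
    rw [AlgHom.comp_apply, affineParam, MvPolynomial.aeval_X, hφ]
    rfl
  have h2 : (affineParam K n).comp φ = AlgHom.id K _ := by
    refine simplexRing_hom_ext fun i => ?_
    change affineParam K n (φ (simplexCoord K n i)) = simplexCoord K n i
    rw [hφ]
    induction i using Fin.cases with
    | zero =>
      rw [Fin.cons_zero, map_sub, map_one, map_sum, sub_eq_iff_eq_add, ← sum_simplexCoord,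
        Fin.sum_univ_succ]
      simp [affineParam]
    | succ i => rw [Fin.cons_succ, affineParam, MvPolynomial.aeval_X]
  exact Function.bijective_iff_has_inverse.2 ⟨φ, fun x => DFunLike.congr_fun h1 x,
    fun x => DFunLike.congr_fun h2 x⟩

theorem eulerOp_mul (x y : SimplexRing K (Fin (n + 1))) :
    eulerOp K n (x * y) = x * eulerOp K n y + y * eulerOp K n x := by
  simp only [eulerOp_apply, dirDeriv_mul, Finset.mul_sum, ← Finset.sum_add_distrib]
  refine Finset.sum_congr rfl fun i _ => ?_
  ring

theorem eulerOp_simplexCoord (j : Fin n) :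
    eulerOp K n (simplexCoord K n j.succ) = simplexCoord K n j.succ := by
  rw [eulerOp_apply, Finset.sum_eq_single j]
  · rw [dirDeriv_simplexCoord]
    simp [edgeVec]
  · intro i _ hi
    rw [dirDeriv_simplexCoord]
    simp [edgeVec, Ne.symm hi]
  · simp

theorem eulerOp_algebraMap (c : K) : eulerOp K n (algebraMap K _ c) = 0 := by
  simp [eulerOp_apply, dirDeriv_algebraMap]

/-- Euler's identity: the operator is a derivation that fixes each `t_1, …, t_n`, so it multiplies a
monomial in these variables by its degree. -/
theorem eulerOp_affineParam_monomial (a : Fin n →₀ ℕ) (c : K) :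
    eulerOp K n (affineParam K n (MvPolynomial.monomial a c)) =
      (a.degree : K) • affineParam K n (MvPolynomial.monomial a c) := by
  have hC : ∀ c : K, affineParam K n (MvPolynomial.C c) = algebraMap K _ c :=
    (affineParam K n).commutes
  induction a using Finsupp.induction_linear generalizing c with
  | zero =>
    change eulerOp K n (affineParam K n (MvPolynomial.C c)) = _
    rw [hC, eulerOp_algebraMap]
    simp
  | add a b ha hb =>
    have e : MvPolynomial.monomial (a + b) c =
        MvPolynomial.monomial a c * MvPolynomial.monomial b (1 : K) := by
      rw [MvPolynomial.monomial_mul, mul_one]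
    rw [e, map_mul, eulerOp_mul, ha, hb]
    rw [mul_smul_comm, mul_smul_comm, mul_comm (affineParam K n (MvPolynomial.monomial b 1)),
      ← add_smul, map_add, Nat.cast_add,
      add_comm (a.degree : K)]
  | single i k =>
    rw [← zero_add (Finsupp.single i k), MvPolynomial.monomial_add_single, MvPolynomial.monomial_zero', map_mul, map_pow,
      hC, eulerOp_mul, eulerOp_algebraMap,
      affineParam, MvPolynomial.aeval_X, mul_zero, add_zero, zero_add,
      Finsupp.degree_single]
    have : eulerOp K n (simplexCoord K n i.succ ^ k) = (k : K) • simplexCoord K n i.succ ^ k := by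
      induction k with
      | zero =>
        rw [pow_zero, ← map_one (algebraMap K (SimplexRing K (Fin (n + 1)))), eulerOp_algebraMap]
        simp
      | succ k ih =>
        rw [pow_succ, eulerOp_mul, ih, eulerOp_simplexCoord]
        rw [mul_smul_comm, mul_comm (simplexCoord K n i.succ), Nat.cast_add, Nat.cast_one, add_smul,
          one_smul]
        exact add_comm _ _
    rw [this, mul_smul_comm]

/-- The operator `f ↦ E f + c f`, where `E` is the Euler operator. -/
def eulerAdd (K : Type u) [Field K] (n c : ℕ) :
    SimplexRing K (Fin (n + 1)) →ₗ[K] SimplexRing K (Fin (n + 1)) :=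
  eulerOp K n + (c : K) • LinearMap.id

/-- The operator on polynomials that multiplies the monomials of degree `d` by `d + c`. -/
theorem exists_eulerAdd_affineParam (c : ℕ) (p : MvPolynomial (Fin n) K) :
    ∃ p' : MvPolynomial (Fin n) K, eulerAdd K n c (affineParam K n p) = affineParam K n p' ∧
      ∀ a, p'.coeff a = ((a.degree + c : ℕ) : K) * p.coeff a := by
  induction p using MvPolynomial.induction_on' with
  | monomial a r =>
    refine ⟨MvPolynomial.monomial a (((a.degree + c : ℕ) : K) * r), ?_, fun b => ?_⟩
    · rw [eulerAdd, LinearMap.add_apply, eulerOp_affineParam_monomial, LinearMap.smul_apply,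
        LinearMap.id_apply, ← add_smul, ← map_smul, MvPolynomial.smul_monomial]
      simp
    · classical
      rw [MvPolynomial.coeff_monomial, MvPolynomial.coeff_monomial]
      split_ifs with h
      · rw [h]
      · simp
  | add p q hp hq =>
    obtain ⟨p', hp, hp'⟩ := hp
    obtain ⟨q', hq, hq'⟩ := hq
    refine ⟨p' + q', by rw [map_add, map_add, map_add, hp, hq], fun a => ?_⟩
    rw [MvPolynomial.coeff_add, MvPolynomial.coeff_add, hp', hq', mul_add]

variable (K n) in
/-- Contraction of a form with the Euler vector field. -/
def eulerContract (q : ℕ) (ω : SimplexForm K (Fin (n + 1)) (q + 1)) :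
    SimplexForm K (Fin (n + 1)) q :=
  ∑ i : Fin n, (LinearMap.mulLeft K (simplexCoord K n i.succ)).compAlternatingMap
    (ω.curryLeft (edgeVec K 0 i.succ))

theorem AlternatingMap.sum_apply' {R M N ι κ : Type*} [CommSemiring R] [AddCommMonoid M] [Module R M]
    [AddCommMonoid N] [Module R N] (s : Finset κ) (f : κ → M [⋀^ι]→ₗ[R] N) (v : ι → M) :
    (∑ k ∈ s, f k) v = ∑ k ∈ s, f k v := by
  classical
  induction s using Finset.induction_on with
  | empty => simp
  | insert a s ha ih => rw [Finset.sum_insert ha, Finset.sum_insert ha, AlternatingMap.add_apply, ih]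

theorem eulerContract_apply {q : ℕ} (ω : SimplexForm K (Fin (n + 1)) (q + 1))
    (v : Fin q → SimplexTangent K (Fin (n + 1))) :
    eulerContract K n q ω v =
      ∑ i : Fin n, simplexCoord K n i.succ * ω (Matrix.vecCons (edgeVec K 0 i.succ) v) := by
  rw [eulerContract, AlternatingMap.sum_apply']
  rfl

/-- The coordinates of a tangent vector sum to zero, so the zeroth is determined by the others. -/
theorem sum_smul_edgeVec (v : SimplexTangent K (Fin (n + 1))) :
    ∑ i : Fin n, v.1 i.succ • edgeVec K 0 i.succ = v := by
  ext j
  have hv := mem_simplexTangent.1 v.2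
  rw [Fin.sum_univ_succ] at hv
  induction j using Fin.cases with
  | zero =>
    simp only [edgeVec, Submodule.coe_sum, Submodule.coe_smul, Finset.sum_apply]
    simp
    linear_combination -hv
  | succ j =>
    simp only [edgeVec, Submodule.coe_sum, Submodule.coe_smul, Finset.sum_apply]
    simp [Pi.single_apply]

/-- Cartan's formula on functions, where the term `d ι_E` is absent. -/
theorem contract_extD_zero (ω : SimplexForm K (Fin (n + 1)) 0)
    (v : Fin 0 → SimplexTangent K (Fin (n + 1))) :
    eulerContract K n 0 (extD K _ 0 ω) v = eulerOp K n (ω v) := by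
  rw [eulerContract_apply, eulerOp_apply]
  refine Finset.sum_congr rfl fun i _ => ?_
  rw [extD_apply]
  rw [Fin.sum_univ_succ, Finset.sum_eq_zero (fun i _ => i.elim0), add_zero, Fin.val_zero, pow_zero,
    one_smul, Matrix.cons_val_zero]
  congr 3

/-- Cartan's formula for the Euler vector field. -/
theorem extD_contract_add_contract_extD {q : ℕ} (ω : SimplexForm K (Fin (n + 1)) (q + 1)) :
    extD K _ q (eulerContract K n q ω) + eulerContract K n (q + 1) (extD K _ (q + 1) ω) =
      (eulerAdd K n (q + 1)).compAlternatingMap ω := by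
  ext v
  -- By the product rule the derivative also hits the coefficients `t_i` of the Euler field. For
  -- each argument `v_a` these extra terms reassemble `v_a` out of the edge vectors and give back `ω
  -- v`, so altogether `(q + 1) ω v`.
  have h1 : extD K _ q (eulerContract K n q ω) v = ∑ a : Fin (q + 1), (-1 : ℤ) ^ (a : ℕ) •
      ∑ i : Fin n, simplexCoord K n i.succ *
        dirDeriv K _ (v a) (ω (Matrix.vecCons (edgeVec K 0 i.succ) (a.removeNth v))) +
      ((q + 1 : ℕ) : K) • ω v := by
    have h2 : ∀ a : Fin (q + 1), (-1 : ℤ) ^ (a : ℕ) • ∑ i : Fin n,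
        (v a).1 i.succ • ω (Matrix.vecCons (edgeVec K 0 i.succ) (a.removeNth v)) = ω v := by
      intro a
      have h3 : ∑ i : Fin n, (v a).1 i.succ •
          ω (Matrix.vecCons (edgeVec K 0 i.succ) (a.removeNth v)) =
            ω (Matrix.vecCons (v a) (a.removeNth v)) := by
        have h4 := congrArg (fun w => ω.curryLeft w (a.removeNth v)) (sum_smul_edgeVec (v a))
        refine Eq.trans ?_ h4
        simp only [map_sum, map_smul]
        rw [AlternatingMap.sum_apply']
        rfl
      rw [h3, ← AlternatingMap.map_insertNth, Fin.insertNth_self_removeNth]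
    have h5 : ((q + 1 : ℕ) : K) • ω v = ∑ a : Fin (q + 1), (-1 : ℤ) ^ (a : ℕ) • ∑ i : Fin n,
        (v a).1 i.succ • ω (Matrix.vecCons (edgeVec K 0 i.succ) (a.removeNth v)) := by
      simp only [h2, Finset.sum_const, Finset.card_univ, Fintype.card_fin, Nat.cast_smul_eq_nsmul]
    rw [h5, ← Finset.sum_add_distrib, extD_apply]
    refine Finset.sum_congr rfl fun a _ => ?_
    rw [← smul_add, ← Finset.sum_add_distrib, eulerContract_apply, map_sum]
    congr 1
    refine Finset.sum_congr rfl fun i _ => ?_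
    rw [dirDeriv_mul, dirDeriv_simplexCoord, mul_comm _ (algebraMap K _ _), ← Algebra.smul_def]
  -- The derivative in the inserted Euler direction is `E (ω v)`; the derivatives in the other
  -- directions are the remaining sum of `h1` with the opposite sign.
  have h6 : eulerContract K n (q + 1) (extD K _ (q + 1) ω) v = eulerOp K n (ω v) -
      ∑ a : Fin (q + 1), (-1 : ℤ) ^ (a : ℕ) • ∑ i : Fin n, simplexCoord K n i.succ *
        dirDeriv K _ (v a) (ω (Matrix.vecCons (edgeVec K 0 i.succ) (a.removeNth v))) := by
    rw [eulerContract_apply, eulerOp_apply]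
    simp only [Finset.smul_sum]
    rw [Finset.sum_comm, ← Finset.sum_sub_distrib]
    refine Finset.sum_congr rfl fun i _ => ?_
    rw [extD_apply, Fin.sum_univ_succ, mul_add, sub_eq_add_neg]
    congr 1
    · simp only [Fin.val_zero, pow_zero, one_smul, Matrix.cons_val_zero]
      rfl
    · rw [Finset.mul_sum, ← Finset.sum_neg_distrib]
      refine Finset.sum_congr rfl fun a _ => ?_
      have e : (a.succ.removeNth (Matrix.vecCons (edgeVec K 0 i.succ) v) :
          Fin (q + 1) → SimplexTangent K (Fin (n + 1))) =
            Matrix.vecCons (edgeVec K 0 i.succ) (a.removeNth v) := by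
        funext b
        induction b using Fin.cases with
        | zero => simp [Fin.removeNth_apply]
        | succ b => simp [Fin.removeNth_apply]
      rw [e, Matrix.cons_val_succ, Fin.val_succ, pow_succ, mul_smul_comm]
      simp
  rw [AlternatingMap.add_apply, h1, h6, LinearMap.compAlternatingMap_apply, eulerAdd,
    LinearMap.add_apply, LinearMap.smul_apply, LinearMap.id_apply]
  abel

variable [CharZero K]

/-- On a monomial of degree `d` the operator is multiplication by `d + c + 1`, a nonzero scalar in
characteristic `0`. -/
theorem eulerAdd_bijective (c : ℕ) : Function.Bijective (eulerAdd K n (c + 1)) := by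
  have hne : ∀ a : Fin n →₀ ℕ, ((a.degree + (c + 1) : ℕ) : K) ≠ 0 := fun a =>
    Nat.cast_ne_zero.2 (by omega)
  constructor
  · refine (injective_iff_map_eq_zero _).2 fun x hx => ?_
    obtain ⟨p, rfl⟩ := affineParam_bijective.2 x
    obtain ⟨p', hp, hp'⟩ := exists_eulerAdd_affineParam (c + 1) p
    have h0 : p' = 0 := affineParam_bijective.1 (by rw [← hp, hx, map_zero])
    have : p = 0 := by
      ext a
      have := hp' a
      rw [h0, MvPolynomial.coeff_zero] at this
      rw [MvPolynomial.coeff_zero]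
      exact (mul_eq_zero.1 this.symm).resolve_left (hne a)
    rw [this, map_zero]
  · intro x
    obtain ⟨p, rfl⟩ := affineParam_bijective.2 x
    induction p using MvPolynomial.induction_on' with
    | monomial a r =>
      refine ⟨affineParam K n (MvPolynomial.monomial a (((a.degree + (c + 1) : ℕ) : K)⁻¹ * r)), ?_⟩
      rw [eulerAdd, LinearMap.add_apply, eulerOp_affineParam_monomial, LinearMap.smul_apply,
        LinearMap.id_apply, ← add_smul, ← map_smul, MvPolynomial.smul_monomial, smul_eq_mul,
        ← mul_assoc, ← Nat.cast_add, mul_inv_cancel₀ (hne a), one_mul]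
    | add p q hp hq =>
      obtain ⟨x, hx⟩ := hp
      obtain ⟨y, hy⟩ := hq
      exact ⟨x + y, by rw [map_add, map_add, hx, hy]⟩

/-- A monomial of degree `d` is multiplied by `d`, which in characteristic `0` vanishes only for
constants. -/
theorem exists_algebraMap_of_eulerOp_eq_zero (x : SimplexRing K (Fin (n + 1)))
    (hx : eulerOp K n x = 0) : ∃ c : K, x = algebraMap K _ c := by
  obtain ⟨p, rfl⟩ := affineParam_bijective.2 x
  obtain ⟨p', hp, hp'⟩ := exists_eulerAdd_affineParam 0 p
  have h0 : p' = 0 := affineParam_bijective.1 (by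
    rw [← hp, map_zero, eulerAdd, LinearMap.add_apply, hx]; simp)
  refine ⟨p.coeff 0, ?_⟩
  have : p = MvPolynomial.C (p.coeff 0) := by
    classical
    ext a
    rw [MvPolynomial.coeff_C]
    split_ifs with h
    · rw [h]
    · have := hp' a
      rw [h0, MvPolynomial.coeff_zero] at this
      refine (mul_eq_zero.1 this.symm).resolve_left (Nat.cast_ne_zero.2 ?_)
      rw [add_zero]
      exact fun h' => h ((Finsupp.degree_eq_zero_iff a).1 h').symm
  exact (congrArg _ this).trans ((affineParam K n).commutes _)

/-- The Poincaré lemma in degree `0`. -/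
theorem exists_const_of_extD_eq_zero (ω : SimplexForm K (Fin (n + 1)) 0) (hω : extD K _ 0 ω = 0) :
    ∃ c : K, ∀ v, ω v = algebraMap K _ c := by
  obtain ⟨c, hc⟩ := exists_algebraMap_of_eulerOp_eq_zero (ω 0) (by
    rw [← contract_extD_zero, hω, eulerContract_apply]
    simp)
  exact ⟨c, fun v => by rw [← hc, Subsingleton.elim v 0]⟩

/-- The Poincaré lemma in positive degrees. -/
theorem exists_extD_eq {q : ℕ} (ω : SimplexForm K (Fin (n + 1)) (q + 1))
    (hω : extD K _ (q + 1) ω = 0) : ∃ η, extD K _ q η = ω := by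
  let e := LinearEquiv.ofBijective _ (eulerAdd_bijective (K := K) (n := n) q)
  -- With `η = (E + q + 1)⁻¹ ω`, Cartan's formula for `η` reads `d ι η + ι d η = ω`. Applying `d`
  -- gives `d ι d η = 0`, and Cartan's formula for `d η` becomes `(E + q + 2) d η = 0`. Hence `d η =
  -- 0` and `ω = d (ι η)`.
  let η := e.symm.toLinearMap.compAlternatingMap ω
  have hη : (eulerAdd K n (q + 1)).compAlternatingMap η = ω := by
    ext v
    exact e.apply_symm_apply (ω v)
  have h1 := extD_contract_add_contract_extD η
  have h2 := extD_contract_add_contract_extD (extD K _ (q + 1) η)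
  rw [hη] at h1
  have h3 := congrArg (extD K _ (q + 1)) h1
  have h0 : eulerContract K n (q + 2) (0 : SimplexForm K (Fin (n + 1)) (q + 3)) = 0 := by
    ext v
    simp [eulerContract_apply]
  rw [map_add, extD_extD, zero_add, hω] at h3
  rw [h3, extD_extD, h0, add_zero] at h2
  have h4 : extD K _ (q + 1) η = 0 := by
    ext v
    refine (eulerAdd_bijective (K := K) (n := n) (q + 1)).1 ?_
    rw [AlternatingMap.zero_apply, map_zero]
    exact (DFunLike.congr_fun h2 v).symm
  have h5 : eulerContract K n (q + 1) (0 : SimplexForm K (Fin (n + 1)) (q + 2)) = 0 := by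
    ext v
    simp [eulerContract_apply]
  rw [h4, h5, add_zero] at h1
  exact ⟨_, h1⟩

end Poincare

/-! ### Quasi-isomorphisms of complexes of modules -/

section QuasiIsoElements

variable {R : Type u} [Ring R]

/-- The two conditions are injectivity and surjectivity on cycles modulo boundaries. All later
quasi-isomorphisms of complexes of modules that are checked by hand go through this criterion. -/
theorem CategoryTheory.ShortComplex.quasiIso_iff_of_moduleCat {S T : ShortComplex (ModuleCat.{u} R)}
    (φ : S ⟶ T) : ShortComplex.QuasiIso φ ↔
      (∀ x : S.X₂, S.g x = 0 → (∃ y : T.X₁, T.f y = φ.τ₂ x) → ∃ w : S.X₁, S.f w = x) ∧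
      ∀ y : T.X₂, T.g y = 0 → ∃ x : S.X₂, S.g x = 0 ∧ ∃ z : T.X₁, T.f z = y - φ.τ₂ x := by
  let γ : ShortComplex.LeftHomologyMapData φ S.moduleCatLeftHomologyData
    T.moduleCatLeftHomologyData := default
  rw [γ.quasiIso_iff]
  have hi : ∀ k : LinearMap.ker S.g.hom, (γ.φK k).1 = φ.τ₂ k.1 := fun k =>
    congrArg (fun h : S.moduleCatLeftHomologyData.K ⟶ T.X₂ => h k) γ.commi
  have hπ : ∀ k : LinearMap.ker S.g.hom, γ.φH (Submodule.Quotient.mk k) =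
      Submodule.Quotient.mk (p := LinearMap.range T.moduleCatToCycles) (γ.φK k) := fun k =>
    (congrArg (fun h : S.moduleCatLeftHomologyData.K ⟶ _ => h k) γ.commπ).symm
  have hS : ∀ k : LinearMap.ker S.g.hom,
      (Submodule.Quotient.mk k : _ ⧸ LinearMap.range S.moduleCatToCycles) = 0 ↔
        ∃ w : S.X₁, S.f w = k.1 := fun k => by
    rw [Submodule.Quotient.mk_eq_zero]
    exact ⟨fun ⟨w, hw⟩ => ⟨w, congrArg Subtype.val hw⟩, fun ⟨w, hw⟩ => ⟨w, Subtype.ext hw⟩⟩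
  have hT : ∀ k : LinearMap.ker T.g.hom,
      (Submodule.Quotient.mk k : _ ⧸ LinearMap.range T.moduleCatToCycles) = 0 ↔
        ∃ w : T.X₁, T.f w = k.1 := fun k => by
    rw [Submodule.Quotient.mk_eq_zero]
    exact ⟨fun ⟨w, hw⟩ => ⟨w, congrArg Subtype.val hw⟩, fun ⟨w, hw⟩ => ⟨w, Subtype.ext hw⟩⟩
  rw [ConcreteCategory.isIso_iff_bijective]
  refine and_congr ?_ ?_
  · refine (injective_iff_map_eq_zero γ.φH.hom).trans ⟨fun h x hx hy => ?_, fun h a ha => ?_⟩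
    · refine (hS ⟨x, hx⟩).1 (h _ ((hπ ⟨x, hx⟩).trans ((hT _).2 ?_)))
      rw [hi]
      exact hy
    · obtain ⟨k, rfl⟩ := Submodule.Quotient.mk_surjective _ a
      have h1 := (hT _).1 ((hπ k).symm.trans ha)
      rw [hi] at h1
      exact (hS k).2 (h k.1 k.2 h1)
  · constructor
    · intro h y hy
      obtain ⟨a, ha⟩ := h (Submodule.Quotient.mk (⟨y, hy⟩ : LinearMap.ker T.g.hom))
      obtain ⟨k, rfl⟩ := Submodule.Quotient.mk_surjective _ a
      let b : LinearMap.ker T.g.hom := γ.φK k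
      have h1 : (Submodule.Quotient.mk ((⟨y, hy⟩ : LinearMap.ker T.g.hom) - b) :
          _ ⧸ LinearMap.range T.moduleCatToCycles) = 0 := by
        rw [Submodule.Quotient.mk_sub, sub_eq_zero]
        exact ha.symm.trans (hπ k)
      obtain ⟨z, hz⟩ := (hT _).1 h1
      refine ⟨k.1, k.2, z, hz.trans ?_⟩
      rw [← hi]
      rfl
    · intro h a
      obtain ⟨k, rfl⟩ := Submodule.Quotient.mk_surjective _ a
      obtain ⟨x, hx, z, hz⟩ := h k.1 k.2
      refine ⟨Submodule.Quotient.mk (⟨x, hx⟩ : LinearMap.ker S.g.hom), (hπ _).trans ?_⟩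
      refine ((Submodule.Quotient.eq _).2 ((Submodule.Quotient.mk_eq_zero _).1 ((hT _).2 ⟨z, ?_⟩))).symm
      rw [hz, ← hi ⟨x, hx⟩]
      rfl

theorem quasiIsoAt_iff_of_moduleCat {ι : Type*} {c : ComplexShape ι}
    {A B : HomologicalComplex (ModuleCat.{u} R) c} (f : A ⟶ B) (i : ι) :
    QuasiIsoAt f i ↔
      (∀ x : A.X i, A.d i (c.next i) x = 0 → (∃ y, B.d (c.prev i) i y = f.f i x) →
        ∃ w, A.d (c.prev i) i w = x) ∧
      ∀ y : B.X i, B.d i (c.next i) y = 0 →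
        ∃ x, A.d i (c.next i) x = 0 ∧ ∃ z, B.d (c.prev i) i z = y - f.f i x := by
  rw [quasiIsoAt_iff]
  exact ShortComplex.quasiIso_iff_of_moduleCat _

/-- Nothing maps into degree `0`: `prev 0` takes its default value `0`, and `d 0 0 = 0`, so the
boundary conditions become equations. -/
theorem CochainComplex.quasiIsoAt_zero_iff_of_moduleCat {A B : CochainComplex (ModuleCat.{u} R) ℕ}
    (f : A ⟶ B) : QuasiIsoAt f 0 ↔
      (∀ x : A.X 0, A.d 0 1 x = 0 → f.f 0 x = 0 → x = 0) ∧
      ∀ y : B.X 0, B.d 0 1 y = 0 → ∃ x, A.d 0 1 x = 0 ∧ f.f 0 x = y := by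
  have hn : (ComplexShape.up ℕ).next 0 = 1 := by simp
  have hA : ∀ w, A.d ((ComplexShape.up ℕ).prev 0) 0 w = 0 := fun w => by
    rw [A.shape _ _ (by simp)]; rfl
  have hB : ∀ w, B.d ((ComplexShape.up ℕ).prev 0) 0 w = 0 := fun w => by
    rw [B.shape _ _ (by simp)]; rfl
  rw [quasiIsoAt_iff_of_moduleCat, hn]
  simp only [hA, hB]
  refine and_congr ?_ ?_
  · refine forall_congr' fun x => forall_congr' fun hx => ⟨fun h h0 => ?_, fun h h0 => ?_⟩
    · obtain ⟨_, h⟩ := h ⟨0, h0.symm⟩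
      exact h.symm
    · obtain ⟨_, h0⟩ := h0
      exact ⟨0, (h h0.symm).symm⟩
  · refine forall_congr' fun y => forall_congr' fun hy => exists_congr fun x => and_congr_right fun _ =>
      ⟨fun ⟨_, h⟩ => (sub_eq_zero.1 h.symm).symm, fun h => ⟨0, (sub_eq_zero.2 h.symm).symm⟩⟩

theorem CochainComplex.quasiIsoAt_succ_iff_of_moduleCat {A B : CochainComplex (ModuleCat.{u} R) ℕ}
    (f : A ⟶ B) (i : ℕ) : QuasiIsoAt f (i + 1) ↔
      (∀ x : A.X (i + 1), A.d (i + 1) (i + 2) x = 0 →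
        (∃ y, B.d i (i + 1) y = f.f (i + 1) x) → ∃ w, A.d i (i + 1) w = x) ∧
      ∀ y : B.X (i + 1), B.d (i + 1) (i + 2) y = 0 →
        ∃ x, A.d (i + 1) (i + 2) x = 0 ∧ ∃ z, B.d i (i + 1) z = y - f.f (i + 1) x := by
  have hn : (ComplexShape.up ℕ).next (i + 1) = i + 2 := by simp
  have hp : (ComplexShape.up ℕ).prev (i + 1) = i := by simp
  rw [quasiIsoAt_iff_of_moduleCat, hn, hp]

theorem CochainComplex.quasiIsoAt_iff_of_moduleCat_int {A B : CochainComplex (ModuleCat.{u} R) ℤ}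
    (f : A ⟶ B) (i : ℤ) : QuasiIsoAt f i ↔
      (∀ x : A.X i, A.d i (i + 1) x = 0 →
        (∃ y, B.d (i - 1) i y = f.f i x) → ∃ w, A.d (i - 1) i w = x) ∧
      ∀ y : B.X i, B.d i (i + 1) y = 0 →
        ∃ x, A.d i (i + 1) x = 0 ∧ ∃ z, B.d (i - 1) i z = y - f.f i x := by
  have hn : (ComplexShape.up ℤ).next i = i + 1 := by simp
  have hp : (ComplexShape.up ℤ).prev i = i - 1 := by simp
  rw [quasiIsoAt_iff_of_moduleCat, hn, hp]

end QuasiIsoElements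

/-! ### Injective resolutions in categories of functors to vector spaces -/

section Resolutions

variable {K : Type u} [Field K]

/-- A pointwise exact coaugmented complex of injective functors is an injective resolution. -/
def InjectiveResolution.ofPointwiseExact {T : Type*} [Category* T] {Z : T ⥤ ModuleCat.{u} K}
    (E : CochainComplex (T ⥤ ModuleCat.{u} K) ℕ) (hE : ∀ q, Injective (E.X q)) (η : Z ⟶ E.X 0)
    (hη : η ≫ E.d 0 1 = 0) (inj : ∀ n, Function.Injective (η.app n))
    (exact₀ : ∀ n (x : (E.X 0).obj n), (E.d 0 1).app n x = 0 → ∃ z, η.app n z = x)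
    (exact_succ : ∀ q n (x : (E.X (q + 1)).obj n), (E.d (q + 1) (q + 2)).app n x = 0 →
      ∃ y, (E.d q (q + 1)).app n y = x) : InjectiveResolution Z where
  cocomplex := E
  injective := hE
  ι := (CochainComplex.fromSingle₀Equiv _ _).symm ⟨η, hη⟩
  quasiIso := by
    rw [HomologicalComplex.quasiIso_iff_evaluation]
    refine fun n => ⟨fun q => ?_⟩
    have key : ((CochainComplex.fromSingle₀Equiv E Z).symm ⟨η, hη⟩).f 0 = η :=
      CochainComplex.fromSingle₀Equiv_symm_apply_f_zero η hη
    cases q with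
    | zero =>
      rw [CochainComplex.quasiIsoAt_zero_iff_of_moduleCat]
      refine ⟨fun x _ hx => ?_, fun y hy => ?_⟩
      · have h : (η.app n) x = 0 := (congrArg (fun g : Z ⟶ E.X 0 => g.app n x) key).symm.trans hx
        exact inj n (h.trans (map_zero (η.app n).hom).symm)
      · obtain ⟨z, hz⟩ := exact₀ n y hy
        refine ⟨z, ?_, ((congrArg (fun g : Z ⟶ E.X 0 => g.app n z) key)).trans hz⟩
        have h : ((CochainComplex.single₀ (T ⥤ ModuleCat.{u} K)).obj Z).d 0 1 = 0 :=
          HomologicalComplex.single_obj_d _ _ _ _ _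
        exact congrArg (fun g : ((CochainComplex.single₀ (T ⥤ ModuleCat.{u} K)).obj Z).X 0 ⟶
          ((CochainComplex.single₀ (T ⥤ ModuleCat.{u} K)).obj Z).X 1 => g.app n z) h
    | succ q =>
      rw [CochainComplex.quasiIsoAt_succ_iff_of_moduleCat]
      have hz : IsZero (((CochainComplex.single₀ (T ⥤ ModuleCat.{u} K)).obj Z).X (q + 1)) :=
        HomologicalComplex.isZero_single_obj_X _ _ _ _ (by simp)
      have hx : ∀ x : (((CochainComplex.single₀ (T ⥤ ModuleCat.{u} K)).obj Z).X (q + 1)).obj n,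
          x = 0 := fun x =>
        congrArg (fun g : ((CochainComplex.single₀ (T ⥤ ModuleCat.{u} K)).obj Z).X (q + 1) ⟶
          ((CochainComplex.single₀ (T ⥤ ModuleCat.{u} K)).obj Z).X (q + 1) => g.app n x)
          (hz.eq_of_src (𝟙 _) 0)
      refine ⟨fun x _ _ => ⟨0, (map_zero _).trans (hx x).symm⟩, fun y hy => ?_⟩
      obtain ⟨w, hw⟩ := exact_succ q n y hy
      exact ⟨0, map_zero _, w, hw.trans ((congrArg (y - ·) (map_zero _)).trans (sub_zero y)).symm⟩

theorem InjectiveResolution.ofPointwiseExact_ι_f_zero {T : Type*} [Category* T]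
    {Z : T ⥤ ModuleCat.{u} K}
    (E : CochainComplex (T ⥤ ModuleCat.{u} K) ℕ) (hE : ∀ q, Injective (E.X q)) (η : Z ⟶ E.X 0)
    (hη : η ≫ E.d 0 1 = 0) (inj : ∀ n, Function.Injective (η.app n))
    (exact₀ : ∀ n (x : (E.X 0).obj n), (E.d 0 1).app n x = 0 → ∃ z, η.app n z = x)
    (exact_succ : ∀ q n (x : (E.X (q + 1)).obj n), (E.d (q + 1) (q + 2)).app n x = 0 →
      ∃ y, (E.d q (q + 1)).app n y = x) :
    (InjectiveResolution.ofPointwiseExact E hE η hη inj exact₀ exact_succ).ι.f 0 = η :=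
  CochainComplex.fromSingle₀Equiv_symm_apply_f_zero η hη

/-- A morphism between two injective resolutions of the same object that is compatible with the
coaugmentations is a homotopy equivalence. -/
def InjectiveResolution.homotopyEquivOfHom {C : Type*} [Category* C] [Abelian C] {Z : C}
    (I J : InjectiveResolution Z) (f : I.cocomplex ⟶ J.cocomplex) (hf : I.ι ≫ f = J.ι) :
    HomotopyEquiv I.cocomplex J.cocomplex where
  hom := f
  -- Both composites cover the identity of `Z`, and morphisms of injective resolutions covering the
  -- same map are homotopic.
  inv := InjectiveResolution.desc (𝟙 Z) I J
  homotopyHomInvId := InjectiveResolution.descHomotopy (𝟙 Z) _ _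
    (by rw [reassoc_of% hf, InjectiveResolution.desc_commutes]) (by simp)
  homotopyInvHomId := InjectiveResolution.descHomotopy (𝟙 Z) _ _
    (by rw [InjectiveResolution.desc_commutes_assoc, hf]) (by simp)

end Resolutions

/-! ### Forms and cochains on the standard simplices as injective resolutions -/

section SimplicialForms

variable (K : Type u) [Field K]

/-- The simplicial vector space of polynomial `q`-forms on the standard simplices. -/
def formObj (q : ℕ) : SimplicialObject (ModuleCat.{u} K) where
  obj n := ModuleCat.of K (Om K q n.unop)
  map α := ModuleCat.ofHom (OmMap q α.unop)
  map_id _ := ModuleCat.hom_ext (formPullback_id q)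
  map_comp α β := ModuleCat.hom_ext (formPullback_comp (K := K)
    (α.unop.toOrderHom : _ → _) (β.unop.toOrderHom : _ → _) q)

/-- The complex of simplicial vector spaces of polynomial forms on the standard simplices. -/
def formComplex : CochainComplex (SimplicialObject (ModuleCat.{u} K)) ℕ :=
  CochainComplex.of (formObj K)
    (fun q => { app := fun n => ModuleCat.ofHom (OmD q n.unop)
                naturality := fun _ _ α => ModuleCat.hom_ext (OmD_comp_OmMap q α.unop) })
    fun q => NatTrans.ext (funext fun n => ModuleCat.hom_ext (OmD_comp_OmD q n.unop))

theorem formComplex_d_app (q : ℕ) (n : SimplexCategoryᵒᵖ) :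
    ((formComplex K).d q (q + 1)).app n = ModuleCat.ofHom (OmD q n.unop) := by
  simp only [formComplex]
  rw [CochainComplex.of_d]

/-- The cosimplicial vector space of functions on the simplices of the standard simplex `n`. -/
def simplexFunctions (n : SimplexCategory) : CosimplicialObject (ModuleCat.{u} K) where
  obj q := ModuleCat.of K ((q ⟶ n) → K)
  map α := ModuleCat.ofHom (LinearMap.funLeft K K fun β => α ≫ β)
  map_id _ := ModuleCat.hom_ext (LinearMap.ext fun c => funext fun β =>
    congrArg c (Category.id_comp β))
  map_comp α α' := ModuleCat.hom_ext (LinearMap.ext fun c => funext fun β =>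
    congrArg c (Category.assoc α α' β))

/-- Functions on the simplices of the standard simplices, as a simplicial cosimplicial space. -/
def simplexFunctionsFunctor :
    SimplexCategoryᵒᵖ ⥤ CosimplicialObject (ModuleCat.{u} K) where
  obj n := simplexFunctions K n.unop
  map γ :=
    { app := fun _ => ModuleCat.ofHom (LinearMap.funLeft K K fun β => β ≫ γ.unop)
      naturality := fun _ _ α => ModuleCat.hom_ext (LinearMap.ext fun c => funext fun β =>
        (congrArg c (Category.assoc α β γ.unop)).symm) }
  map_id _ := NatTrans.ext (funext fun _ => ModuleCat.hom_ext (LinearMap.ext fun c =>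
    funext fun β => congrArg c (Category.comp_id β)))
  map_comp γ γ' := NatTrans.ext (funext fun _ => ModuleCat.hom_ext (LinearMap.ext fun c =>
    funext fun β => congrArg c (Category.assoc β γ'.unop γ.unop).symm))

/-- The complex of simplicial vector spaces of normalized cochains on the standard simplices. -/
def cochainComplex : CochainComplex (SimplicialObject (ModuleCat.{u} K)) ℕ :=
  (complexOfFunctor _ _ _).obj (simplexFunctionsFunctor K ⋙ normFunctor K)

variable {K}

theorem cochainComplex_d_apply (q : ℕ) (n : SimplexCategoryᵒᵖ)
    (c : normSub (simplexFunctions K n.unop) q) (β : ⦋q + 1⦌ ⟶ n.unop) :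
    ((((cochainComplex K).d q (q + 1)).app n c :
      normSub (simplexFunctions K n.unop) (q + 1)).1 : (⦋q + 1⦌ ⟶ n.unop) → K) β =
      ∑ i : Fin (q + 2), (-1 : ℤ) ^ (i : ℕ) • (c.1 : (⦋q⦌ ⟶ n.unop) → K) (SimplexCategory.δ i ≫ β) := by
  have h : ((cochainComplex K).d q (q + 1)).app n =
      ModuleCat.ofHom (normD (simplexFunctions K n.unop) q) := by
    change (normComplex (simplexFunctions K n.unop)).d q (q + 1) = _
    simp only [normComplex]
    exact CochainComplex.of_d _ _ _
  rw [h]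
  change AlgebraicTopology.AlternatingCofaceMapComplex.objD (simplexFunctions K n.unop) q c.1 β = _
  rw [objD_apply]
  exact Finset.sum_apply β _ _

/-- A simplex that is not injective factors through some degeneracy `σ_i`, and composites with `σ_i`
are never injective. -/
theorem normSub_simplexFunctions {q : ℕ} {n : SimplexCategory} (c : (⦋q⦌ ⟶ n) → K) :
    c ∈ normSub (simplexFunctions K n) q ↔
      ∀ β : ⦋q⦌ ⟶ n, ¬ Function.Injective β.toOrderHom → c β = 0 := by
  cases q with
  | zero =>
    refine ⟨fun _ β hβ => absurd (fun a b _ => Subsingleton.elim (α := Fin 1) a b) hβ, fun _ => trivial⟩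
  | succ q =>
    refine (mem_normSub_succ (simplexFunctions K n)).trans ⟨fun h β hβ => ?_, fun h i => ?_⟩
    · obtain ⟨i, β', rfl⟩ := SimplexCategory.eq_σ_comp_of_not_injective β hβ
      exact congrFun (h i) β'
    · funext β
      refine h (SimplexCategory.σ i ≫ β) fun hinj => ?_
      have h3 : Function.Injective (SimplexCategory.σ i).toOrderHom := fun a b hab =>
        hinj (congrArg β.toOrderHom hab)
      have := Fintype.card_le_of_injective _ h3
      simp at this

variable (K) in
/-- Multiplication of forms by affine functions, which are given by their values at the vertices. -/
def formVertexMul (n q : ℕ) :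
    (Fin (n + 1) → K) →ₗ[K] SimplexForm K (Fin (n + 1)) q →ₗ[K] SimplexForm K (Fin (n + 1)) q :=
  LinearMap.mk₂ K (fun f ω =>
      (LinearMap.mulLeft K (∑ i, f i • simplexCoord K n i)).compAlternatingMap ω)
    (fun f g ω => by ext v; simp [add_smul, Finset.sum_add_distrib, add_mul])
    (fun c f ω => by ext v; simp [mul_smul, ← Finset.smul_sum, smul_mul_assoc])
    (fun f ω η => by ext v; simp)
    (fun c f ω => by ext v; simp)

theorem formVertexMul_apply {n q : ℕ} (f : Fin (n + 1) → K) (ω : SimplexForm K (Fin (n + 1)) q)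
    (v : Fin q → SimplexTangent K (Fin (n + 1))) :
    formVertexMul K n q f ω v = (∑ i, f i • simplexCoord K n i) * ω v := rfl

/-- The pullback of an affine function along a linear map of simplices is the affine function whose
vertex values are pulled back. -/
theorem formPullback_formVertexMul {k n q : ℕ} (α : Fin (k + 1) → Fin (n + 1)) (f : Fin (n + 1) → K)
    (ω : SimplexForm K (Fin (n + 1)) q) :
    formPullback K α q (formVertexMul K n q f ω) =
      formVertexMul K k q (fun i => f (α i)) (formPullback K α q ω) := by
  ext v
  rw [formVertexMul_apply, formPullback_apply, formVertexMul_apply, formPullback_apply, map_mul]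
  congr 1
  rw [map_sum, ← Finset.sum_fiberwise (s := Finset.univ) (g := α)]
  refine Finset.sum_congr rfl fun j _ => ?_
  rw [map_smul, simplexCoord, simplexRingMap_X, Finset.smul_sum]
  refine Finset.sum_congr rfl fun i hi => ?_
  rw [(Finset.mem_filter.1 hi).2]
  rfl

/-- The function with all vertex values `1` is `∑ t_i = 1`, so it acts as the identity. -/
instance formComplex_injective (q : ℕ) : Injective ((formComplex K).X q) :=
  SimplicialObject.injective_of_vertex_mul (formObj K q) (fun n => formVertexMul K n q)
    (fun n ω => AlternatingMap.ext fun v => by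
      refine (formVertexMul_apply (1 : Fin (n + 1) → K) ω v).trans ?_
      simp only [Pi.one_apply, one_smul, sum_simplexCoord, one_mul])
    (fun α f ω => formPullback_formVertexMul α.toOrderHom f ω)

/-- A function on the vertices acts on a cochain through its value at the first vertex of each
simplex. This is natural because maps of standard simplices act on simplices by composition, and it
preserves vanishing on degenerate simplices. -/
instance cochainComplex_injective (q : ℕ) : Injective ((cochainComplex K).X q) := by
  refine SimplicialObject.injective_of_vertex_mul _
    (fun n => LinearMap.mk₂ K (fun (f : Fin (n + 1) → K)
        (c : normSub (simplexFunctions K ⦋n⦌) q) =>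
      (⟨fun β : ⦋q⦌ ⟶ ⦋n⦌ => f (β.toOrderHom 0) * (c.1 : (⦋q⦌ ⟶ ⦋n⦌) → K) β,
        (normSub_simplexFunctions _).2 fun β hβ => by
          rw [(normSub_simplexFunctions _).1 c.2 β hβ, mul_zero]⟩ :
          normSub (simplexFunctions K ⦋n⦌) q))
      (fun f g ω => ?_) (fun c f ω => ?_) (fun f ω η => ?_) (fun c f ω => ?_))
    (fun n ω => ?_) (fun {k n} α f ω => ?_)
  · exact Subtype.ext (funext fun β => add_mul _ _ _)
  · exact Subtype.ext (funext fun β => mul_assoc _ _ _)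
  · exact Subtype.ext (funext fun β => mul_add _ _ _)
  · exact Subtype.ext (funext fun β => mul_left_comm _ _ _)
  · exact Subtype.ext (funext fun β => one_mul _)
  · exact Subtype.ext (funext fun β => rfl)

/-- The cone over a simplex of the standard simplex `n`, with the vertex `0` as apex. -/
def coneSimplex {q : ℕ} {n : SimplexCategory} (β : ⦋q⦌ ⟶ n) : ⦋q + 1⦌ ⟶ n :=
  SimplexCategory.Hom.mk
    { toFun := Fin.cons (α := fun _ => Fin (n.len + 1)) 0 (fun i => β.toOrderHom i)
      monotone' := by
        intro a b hab
        induction a using Fin.cases with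
        | zero => exact Fin.zero_le _
        | succ a =>
          induction b using Fin.cases with
          | zero => exact absurd hab (not_le.2 (Fin.succ_pos a))
          | succ b => exact β.toOrderHom.monotone (Fin.succ_le_succ_iff.1 hab) }

theorem δ_zero_coneSimplex {q : ℕ} {n : SimplexCategory} (β : ⦋q⦌ ⟶ n) :
    SimplexCategory.δ 0 ≫ coneSimplex β = β :=
  SimplexCategory.Hom.ext _ _ (OrderHom.ext _ _ (funext fun _ => rfl))

theorem δ_succ_coneSimplex {q : ℕ} {n : SimplexCategory} (β : ⦋q + 1⦌ ⟶ n) (i : Fin (q + 2)) :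
    SimplexCategory.δ i.succ ≫ coneSimplex β = coneSimplex (SimplexCategory.δ i ≫ β) := by
  refine SimplexCategory.Hom.ext _ _ (OrderHom.ext _ _ (funext fun a => ?_))
  change (coneSimplex β).toOrderHom (i.succ.succAbove a) = _
  induction a using Fin.cases with
  | zero => rw [Fin.succ_succAbove_zero]; rfl
  | succ a => rw [Fin.succ_succAbove_succ]; rfl

theorem not_injective_coneSimplex {q : ℕ} {n : SimplexCategory} (β : ⦋q⦌ ⟶ n)
    (hβ : ¬ Function.Injective β.toOrderHom) : ¬ Function.Injective (coneSimplex β).toOrderHom :=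
  fun h => hβ fun a b hab => Fin.succ_injective _ (h (a₁ := a.succ) (a₂ := b.succ) hab)

/-- The primitive `b` evaluates `c` on cones with apex `0`. In `(d c)(cone β) = 0` the face opposite
the apex gives `c β`, and the other faces are cones over the faces of `β`. The apex is the least
vertex, so a cone is always order preserving; if `β` already contains `0` the cone is merely
degenerate. -/
theorem cochainComplex_exact_succ (q : ℕ) (n : SimplexCategoryᵒᵖ)
    (c : ((cochainComplex K).X (q + 1)).obj n)
    (hc : ((cochainComplex K).d (q + 1) (q + 2)).app n c = 0) :
    ∃ b, ((cochainComplex K).d q (q + 1)).app n b = c := by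
  change normSub (simplexFunctions K n.unop) (q + 1) at c
  let c' : (⦋q + 1⦌ ⟶ n.unop) → K := c.1
  let b' : (⦋q⦌ ⟶ n.unop) → K := fun β => c' (coneSimplex β)
  let b : normSub (simplexFunctions K n.unop) q :=
    ⟨b', (normSub_simplexFunctions b').2 fun β hβ =>
      (normSub_simplexFunctions c').1 c.2 _ (not_injective_coneSimplex β hβ)⟩
  refine ⟨b, Subtype.ext (funext fun β => ?_)⟩
  refine (cochainComplex_d_apply q n b β).trans ?_
  have h := cochainComplex_d_apply (q + 1) n c (coneSimplex β)
  rw [hc, Fin.sum_univ_succ] at h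
  have h0 : (0 : K) = c' β - ∑ i : Fin (q + 2), (-1 : ℤ) ^ (i : ℕ) • b' (SimplexCategory.δ i ≫ β) := by
    refine h.trans ?_
    rw [sub_eq_add_neg, ← Finset.sum_neg_distrib]
    refine congrArg₂ (· + ·) ?_ (Finset.sum_congr rfl fun i _ => ?_)
    · rw [δ_zero_coneSimplex]
      simp [c']
    · rw [δ_succ_coneSimplex, Fin.val_succ, pow_succ]
      simp [b', c']
  exact (sub_eq_zero.1 h0.symm).symm

variable (K) in
/-- The constant simplicial vector space `K`. -/
abbrev constSimplicial : SimplicialObject (ModuleCat.{u} K) :=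
  (Functor.const _).obj (ModuleCat.of K K)

variable (K) in
/-- The constant functions among the `0`-forms. -/
def formUnit : constSimplicial K ⟶ (formComplex K).X 0 where
  app n := ModuleCat.ofHom (LinearMap.toSpanSingleton K _ (OmOne K n.unop))
  naturality m n α := ModuleCat.hom_ext (LinearMap.ext fun c : K => by
    change (c : K) • OmOne K n.unop = OmMap 0 α.unop ((c : K) • OmOne K m.unop)
    rw [map_smul, OmMap_OmOne])

variable (K) in
/-- The constant functions among the `0`-cochains. -/
def cochainUnit : constSimplicial K ⟶ (cochainComplex K).X 0 where
  app n := ModuleCat.ofHom ((LinearMap.pi fun _ : ⦋0⦌ ⟶ n.unop => LinearMap.id).codRestrict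
    (normSub (simplexFunctions K n.unop) 0) fun _ => trivial)

variable [CharZero K]

variable (K) in
/-- Polynomial forms as an injective resolution of the constant simplicial vector space. -/
def formResolution : InjectiveResolution (constSimplicial K) :=
  InjectiveResolution.ofPointwiseExact (formComplex K) formComplex_injective (formUnit K)
    (NatTrans.ext (funext fun n => by
      rw [NatTrans.comp_app, formComplex_d_app]
      refine ModuleCat.hom_ext (LinearMap.ext fun c : K => ?_)
      change OmD 0 n.unop (c • OmOne K n.unop) = 0
      rw [map_smul, OmD_OmOne, smul_zero]))
    (fun n (c c' : K) h => by
      have h1 : c • (1 : SimplexRing K (Fin (n.unop.len + 1))) = c' • 1 :=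
        congrArg (fun ω : SimplexForm K (Fin (n.unop.len + 1)) 0 => ω 0) h
      -- Constants are distinguished by their constant coefficients once the coordinate ring is
      -- identified with a polynomial ring.
      obtain ⟨φ⟩ : Nonempty (SimplexRing K (Fin (n.unop.len + 1)) →ₐ[K] MvPolynomial (Fin n.unop.len) K) :=
        ⟨(AlgEquiv.ofBijective _ affineParam_bijective).symm.toAlgHom⟩
      have h2 := congrArg φ h1
      rw [map_smul, map_smul, map_one] at h2
      have h3 := congrArg (MvPolynomial.coeff 0) h2
      simpa using h3)
    (fun n ω hω => by
      rw [formComplex_d_app] at hω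
      obtain ⟨c, hc⟩ := exists_const_of_extD_eq_zero (K := K) ω hω
      refine ⟨c, AlternatingMap.ext fun v => ?_⟩
      refine Eq.trans ?_ (hc v).symm
      exact (Algebra.algebraMap_eq_smul_one c).symm)
    (fun q n ω hω => by
      rw [formComplex_d_app] at hω
      obtain ⟨η, hη⟩ := exists_extD_eq (K := K) ω hω
      refine ⟨η, ?_⟩
      rw [formComplex_d_app]
      exact hη)

variable (K) in
/-- Normalized cochains as an injective resolution of the constant simplicial vector space. -/
def cochainResolution : InjectiveResolution (constSimplicial K) :=
  InjectiveResolution.ofPointwiseExact (cochainComplex K) cochainComplex_injective (cochainUnit K)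
    (NatTrans.ext (funext fun n => ModuleCat.hom_ext (LinearMap.ext fun c => Subtype.ext
      (funext fun β => by
        refine (cochainComplex_d_apply 0 n ((cochainUnit K).app n c) β).trans ?_
        change ∑ i : Fin 2, (-1 : ℤ) ^ (i : ℕ) • c = 0
        simp [Fin.sum_univ_succ]))))
    (fun n c c' h => congrFun (congrArg (fun x : normSub (simplexFunctions K n.unop) 0 =>
      (x.1 : (⦋0⦌ ⟶ n.unop) → K)) h) (SimplexCategory.const _ _ 0))
    (fun n c hc => by
      change normSub (simplexFunctions K n.unop) 0 at c
      let c' : (⦋0⦌ ⟶ n.unop) → K := c.1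
      refine ⟨c' (SimplexCategory.const _ _ 0), Subtype.ext (funext fun β => ?_)⟩
      have h := cochainComplex_d_apply 0 n c (coneSimplex β)
      rw [hc, Fin.sum_univ_succ] at h
      -- The cone over a vertex `β` is the edge from `0` to `β`. The cocycle condition on it says
      -- that `c` has the same value at `β` and at `0`, so `c` is constant.
      have e : SimplexCategory.δ (1 : Fin 2) ≫ coneSimplex β = SimplexCategory.const _ _ 0 := by
        refine SimplexCategory.Hom.ext _ _ (OrderHom.ext _ _ (funext fun a => ?_))
        fin_cases a
        rfl
      have h0 : (0 : K) = c' β - c' (SimplexCategory.const _ _ 0) := by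
        refine h.trans ?_
        rw [δ_zero_coneSimplex]
        simp [e, sub_eq_add_neg, c']
      exact (sub_eq_zero.1 h0.symm).symm)
    cochainComplex_exact_succ

variable (K) in
/-- Integration of forms over simplices, as a morphism of complexes. -/
def formToCochain : formComplex K ⟶ cochainComplex K where
  f q :=
    { app := fun n => ModuleCat.ofHom ((LinearMap.pi fun α : ⦋q⦌ ⟶ n.unop =>
          OmInt K q ∘ₗ OmMap q α).codRestrict (normSub (simplexFunctions K n.unop) q) fun ω =>
            (normSub_simplexFunctions _).2 fun α hα => formIntegral_degenerate q _ hα ω)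
      naturality := fun m n γ => ModuleCat.hom_ext (LinearMap.ext fun ω => Subtype.ext
        (funext fun α => congrArg (OmInt K q) (LinearMap.congr_fun (formPullback_comp (K := K)
          (γ.unop.toOrderHom : _ → _) (α.toOrderHom : _ → _) q) ω).symm)) }
  comm' q _ h := by
    obtain rfl : q + 1 = _ := h
    refine NatTrans.ext (funext fun n => ?_)
    rw [NatTrans.comp_app, NatTrans.comp_app, formComplex_d_app]
    refine ModuleCat.hom_ext (LinearMap.ext fun ω => Subtype.ext (funext fun β => ?_))
    refine (cochainComplex_d_apply q n _ β).trans ?_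
    -- This is Stokes' theorem for the pullback of `ω` along the simplex `β`.
    refine Eq.trans ?_ ((congrArg (OmInt K (q + 1)) (LinearMap.congr_fun (OmD_comp_OmMap q β) ω).symm).trans
      (LinearMap.congr_fun (OmInt_comp_OmD q) (OmMap q β ω))).symm
    rw [LinearMap.sum_apply]
    refine Finset.sum_congr rfl fun i _ => ?_
    refine congrArg _ (congrArg (OmInt K q) ?_)
    exact LinearMap.congr_fun (formPullback_comp (K := K) (β.toOrderHom : _ → _)
      ((SimplexCategory.δ i).toOrderHom : _ → _) q) ω

/-- The normalization that makes integration compatible with the two coaugmentations by constants.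
-/
theorem OmInt_OmOne : OmInt K 0 (OmOne K ⦋0⦌) = 1 := by
  change ringIntegral K 0 (Ideal.Quotient.mk _ 1) = 1
  rw [ringIntegral_mk]
  change polyIntegral K 0 (MvPolynomial.monomial 0 1) = 1
  rw [polyIntegral_monomial]
  simp

variable (K) in
/-- Integration of forms over simplices is a homotopy equivalence of complexes of simplicial
vector spaces. -/
def formToCochainEquiv : HomotopyEquiv (formComplex K) (cochainComplex K) :=
  InjectiveResolution.homotopyEquivOfHom (formResolution K) (cochainResolution K) (formToCochain K) (by
    refine HomologicalComplex.from_single_hom_ext ?_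
    refine (congrArg (· ≫ (formToCochain K).f 0) (InjectiveResolution.ofPointwiseExact_ι_f_zero
      _ _ _ _ _ _ _)).trans (Eq.trans ?_ (InjectiveResolution.ofPointwiseExact_ι_f_zero
      _ _ _ _ _ _ _).symm)
    refine NatTrans.ext (funext fun n => ModuleCat.hom_ext (LinearMap.ext fun c : K => Subtype.ext
      (funext fun α => ?_)))
    change OmInt K 0 (OmMap 0 α (c • OmOne K n.unop)) = c
    rw [map_smul, map_smul, OmMap_OmOne, OmInt_OmOne, smul_eq_mul, mul_one])

end SimplicialForms

/-! ### Completed tensor products of simplicial and cosimplicial modules -/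

namespace DirInvMod

section CTensorLinear

variable {K : Type u} [CommRing K] {A B : Type u} [AddCommGroup A] [Module K A] [AddCommGroup B]
  [Module K B]

theorem ctensorMap_add_left {M N : DirInvMod K} (f f' : A →ₗ[K] B) (g : M ⟶ N) (u : CTensor A M) :
    ctensorMap (f + f') g u = ctensorMap f g u + ctensorMap f' g u := by
  induction u using Completion.ind with
  | h x hx =>
    change Completion.mk _ _ = Completion.mk _ (add_mem (Hom.cauchy (tensorMap (discreteMap f) g) hx)
      (Hom.cauchy (tensorMap (discreteMap f') g) hx))
    congr 1
    funext n
    exact LinearMap.congr_fun (TensorProduct.map_add_left f f' g.lin) (x n)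

/-- The map `f ⊗̂ g` as an additive function of `f`. -/
def ctensorMapAddHom {M N : DirInvMod K} (g : M ⟶ N) (u : CTensor A M) :
    (A →ₗ[K] B) →+ CTensor B N :=
  AddMonoidHom.mk' (fun f => ctensorMap f g u) fun f f' => ctensorMap_add_left f f' g u

/-- An operator of rank one factors through the line `K`, so on `A ⊗̂ M` it factors through `K ⊗̂ M
≅ M`. On Cauchy sequences, the two sides differ by `b ⊗ (f(x_n) - y)`, where `y` is the limit of
`f(x_n)`, and this is a null sequence. -/
theorem ctensorMap_smulRight {M : DirInvMod K} (hM : M.EqualsCompletion) (f : A →ₗ[K] K) (b : B)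
    (u : CTensor A M) :
    ctensorMap (f.smulRight b) (𝟙 M) u = cmk hM b (cfunctional hM f u) := by
  have h := toCompletion_cfunctional hM f u
  generalize cfunctional hM f u = y at h ⊢
  induction u using Completion.ind with
  | h x hx =>
    refine (Submodule.Quotient.eq _).2 ?_
    obtain ⟨j, hj, hj'⟩ : (fun n => (contract f M).lin (x n) - y) ∈ M.null :=
      (Submodule.Quotient.eq (M.null.comap M.cauchy.subtype)).1 h.symm
    have e : ∀ n, (tensorMap (discreteMap (f.smulRight b)) (𝟙 M)).lin (x n) - (b ⊗ₜ[K] y : B ⊗[K] M) =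
        (b ⊗ₜ[K] ((contract f M).lin (x n) - y) : B ⊗[K] M) := by
      intro n
      rw [TensorProduct.tmul_sub]
      congr 1
      change TensorProduct.map (f.smulRight b) LinearMap.id (x n) =
        b ⊗ₜ[K] (TensorProduct.lid K M) (f.rTensor M (x n))
      induction (x n : A ⊗[K] M) using TensorProduct.induction_on with
      | zero => simp
      | tmul a m => simp [TensorProduct.smul_tmul]
      | add x y hx hy => simp only [map_add, hx, hy, TensorProduct.tmul_add]
    refine ⟨(PUnit.unit, j), fun n => ?_, fun i => (hj' i).imp fun n₀ h n hn => ?_⟩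
    · change (tensorMap (discreteMap (f.smulRight b)) (𝟙 M)).lin (x n) - (b ⊗ₜ[K] y : B ⊗[K] M) ∈ _
      rw [e n]
      exact Submodule.apply_mem_map₂ (TensorProduct.mk K B M) (Submodule.mem_top (x := b)) (hj n)
    · change (tensorMap (discreteMap (f.smulRight b)) (𝟙 M)).lin (x n) - (b ⊗ₜ[K] y : B ⊗[K] M) ∈ _
      rw [e n]
      exact Submodule.mem_sup_right (Submodule.apply_mem_map₂ (TensorProduct.mk K B M)
        (Submodule.mem_top (x := b)) (h n hn))

theorem cfunctional_cmk {M : DirInvMod K} (hM : M.EqualsCompletion) (f : A →ₗ[K] K) (a : A) (m : M) :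
    cfunctional hM f (cmk hM a m) = f a • m := by
  rw [cfunctional_eq_iff]
  rfl

/-- If the identity of `A` is a finite sum of operators `a ↦ f s a • e s`, then the functionals
`f s` separate the elements of `A ⊗̂ M`. -/
theorem ctensor_eq_sum {M : DirInvMod K} (hM : M.EqualsCompletion) {S : Type*} [Fintype S]
    (f : S → A →ₗ[K] K) (e : S → A) (h : ∑ s, (f s).smulRight (e s) = LinearMap.id)
    (u : CTensor A M) : u = ∑ s, cmk hM (e s) (cfunctional hM (f s) u) := by
  have h1 : ctensorMapAddHom (𝟙 M) u (∑ s, (f s).smulRight (e s)) = u := by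
    rw [h]
    exact LinearMap.congr_fun (ctensorMap_id M) u
  rw [map_sum] at h1
  refine h1.symm.trans (Finset.sum_congr rfl fun s _ => ctensorMap_smulRight hM _ _ _)

end CTensorLinear

end DirInvMod

section EndFunctor

open DirInvMod

variable {K : Type u} [Field K]

/-- The compatible families in the completed tensor products of a simplicial module with a
cosimplicial dir-inv module. -/
def endSub (B : CosimplicialObject (DirInvMod K)) (A : SimplicialObject (ModuleCat.{u} K)) :
    Submodule K (∀ n : SimplexCategory, CTensor (A.obj (op n)) (B.obj n)) where
  carrier := {u | ∀ (k l : SimplexCategory) (α : k ⟶ l),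
    ctensorMap LinearMap.id (B.map α) (u k) = ctensorMap (A.map α.op).hom (𝟙 (B.obj l)) (u l)}
  zero_mem' _ l α :=
    (map_zero (ctensorMap LinearMap.id (B.map α))).trans
      (map_zero (ctensorMap (A.map α.op).hom (𝟙 (B.obj l)))).symm
  add_mem' {u v} hu hv k l α :=
    (map_add (ctensorMap LinearMap.id (B.map α)) (u k) (v k)).trans
      ((congrArg₂ (· + ·) (hu k l α) (hv k l α)).trans
        (map_add (ctensorMap (A.map α.op).hom (𝟙 (B.obj l))) (u l) (v l)).symm)
  smul_mem' c u hu k l α :=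
    (map_smul (ctensorMap LinearMap.id (B.map α)) c (u k)).trans
      ((congrArg (c • ·) (hu k l α)).trans
        (map_smul (ctensorMap (A.map α.op).hom (𝟙 (B.obj l))) c (u l)).symm)

/-- Functoriality of `endSub` in the simplicial module. -/
def endMap (B : CosimplicialObject (DirInvMod K)) {A A' : SimplicialObject (ModuleCat.{u} K)}
    (f : A ⟶ A') : endSub B A →ₗ[K] endSub B A' where
  toFun u := ⟨fun n => ctensorMap (f.app (op n)).hom (𝟙 (B.obj n)) (u.1 n), fun k l α => by
    have h := congrArg (ctensorMap (f.app (op k)).hom (𝟙 (B.obj l))) (u.2 k l α)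
    rw [ctensorMap_ctensorMap, ctensorMap_ctensorMap, Category.comp_id, LinearMap.comp_id,
      ← ModuleCat.hom_comp, f.naturality, ModuleCat.hom_comp] at h
    rw [ctensorMap_ctensorMap, ctensorMap_ctensorMap, Category.id_comp]
    exact h⟩
  map_add' u v := Subtype.ext (funext fun n =>
    map_add (ctensorMap (f.app (op n)).hom _) (u.1 n) (v.1 n))
  map_smul' c u := Subtype.ext (funext fun n =>
    map_smul (ctensorMap (f.app (op n)).hom _) c (u.1 n))

/-- The functor of compatible families. -/
def endFunctor (B : CosimplicialObject (DirInvMod K)) :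
    SimplicialObject (ModuleCat.{u} K) ⥤ ModuleCat.{u} K where
  obj A := ModuleCat.of K (endSub B A)
  map f := ModuleCat.ofHom (endMap B f)
  map_id _ := ModuleCat.hom_ext (LinearMap.ext fun u => Subtype.ext (funext fun n =>
    LinearMap.congr_fun (ctensorMap_id (B.obj n)) (u.1 n)))
  map_comp f g := ModuleCat.hom_ext (LinearMap.ext fun u => Subtype.ext (funext fun n =>
    (ctensorMap_ctensorMap (f.app (op n)).hom (g.app (op n)).hom (𝟙 (B.obj n)) (𝟙 _) (u.1 n)).symm))

/-- Additivity is the only property of this functor that is needed, since it makes the functor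
preserve homotopy equivalences. -/
instance (B : CosimplicialObject (DirInvMod K)) : (endFunctor B).Additive where
  map_add {_ _ f g} := ModuleCat.hom_ext (LinearMap.ext fun u => Subtype.ext (funext fun n =>
    ctensorMap_add_left (f.app (op n)).hom (g.app (op n)).hom (𝟙 (B.obj n)) (u.1 n)))

variable {B : CosimplicialObject (DirInvMod K)} (hB : ∀ n, (B.obj n).EqualsCompletion)

/-- Contracting with a functional turns the compatibility of a family into an equation inside `B l`
itself, without completed tensor products. -/
theorem endSub_map_cfunctional {A : SimplicialObject (ModuleCat.{u} K)} (u : endSub B A)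
    {k l : SimplexCategory} (α : k ⟶ l) (φ : A.obj (op k) →ₗ[K] K) :
    (B.map α).lin (cfunctional (hB k) φ (u.1 k)) =
      cfunctional (hB l) (φ ∘ₗ (A.map α.op).hom) (u.1 l) := by
  have h1 := cfunctional_ctensorMap (hB k) (hB l) LinearMap.id (B.map α) φ (u.1 k)
  have h2 := cfunctional_ctensorMap (hB l) (hB l) (A.map α.op).hom (𝟙 (B.obj l)) φ (u.1 l)
  rw [u.2 k l α, h2] at h1
  exact h1.symm

/-- Evaluation of a normalized cochain at a simplex. -/
def cochainEval {q : ℕ} {n : SimplexCategory} (α : ⦋q⦌ ⟶ n) :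
    ((cochainComplex K).X q).obj (op n) →ₗ[K] K :=
  (LinearMap.proj α : ((⦋q⦌ ⟶ n) → K) →ₗ[K] K) ∘ₗ (normSub (simplexFunctions K n) q).subtype

theorem cochainEval_comp_map {q : ℕ} {n n' : SimplexCategory} (α : ⦋q⦌ ⟶ n) (γ : n ⟶ n') :
    cochainEval (K := K) α ∘ₗ (((cochainComplex K).X q).map γ.op).hom = cochainEval (α ≫ γ) := rfl

open Classical in
/-- The indicator function of a simplex, or zero if the simplex is degenerate. -/
def cochainSingle {q : ℕ} {n : SimplexCategory} (α : ⦋q⦌ ⟶ n) :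
    ((cochainComplex K).X q).obj (op n) :=
  (⟨fun β : ⦋q⦌ ⟶ n => if β = α ∧ Function.Injective α.toOrderHom then (1 : K) else 0,
    (normSub_simplexFunctions _).2 fun β hβ => if_neg fun (h : β = α ∧ _) => hβ (h.1 ▸ h.2)⟩ :
    normSub (simplexFunctions K n) q)

theorem cochainEval_cochainSingle {q : ℕ} {n : SimplexCategory} (α β : ⦋q⦌ ⟶ n) :
    open Classical in cochainEval (K := K) β (cochainSingle α) =
      if β = α ∧ Function.Injective α.toOrderHom then 1 else 0 := rfl

/-- The indicators of the nondegenerate simplices form a finite basis of the normalized cochains,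
with the evaluations as dual basis. At a degenerate simplex both the indicator and the evaluation
vanish, so the sum may run over all simplices. -/
theorem sum_cochainEval_smulRight {q : ℕ} {n : SimplexCategory} [Fintype (⦋q⦌ ⟶ n)] :
    ∑ α : ⦋q⦌ ⟶ n, (cochainEval (K := K) α).smulRight (cochainSingle α) = LinearMap.id := by
  refine LinearMap.ext fun c => Subtype.ext (funext fun β => ?_)
  have h : ∀ c c' : normSub (simplexFunctions K n) q, cochainEval β c = cochainEval β c' →
    (c.1 : (⦋q⦌ ⟶ n) → K) β = (c'.1 : (⦋q⦌ ⟶ n) → K) β := fun _ _ h => h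
  refine h _ _ ?_
  rw [LinearMap.sum_apply, map_sum, LinearMap.id_apply]
  simp only [LinearMap.smulRight_apply, map_smul, cochainEval_cochainSingle]
  rw [Finset.sum_eq_single β]
  · by_cases hβ : Function.Injective β.toOrderHom
    · simp [hβ]
    · have h0 : cochainEval β c = 0 := (normSub_simplexFunctions _).1 c.2 β hβ
      simp [h0]
  · intro α _ hα
    simp [Ne.symm hα]
  · simp

/-- The space of normalized cochains on a standard simplex is finite dimensional, so completing the
tensor product adds nothing: an element is a finite sum of its coordinates. -/
theorem ctensor_cochain_ext {q : ℕ} {n : SimplexCategory} {M : DirInvMod K}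
    (hM : M.EqualsCompletion) {u v : CTensor (((cochainComplex K).X q).obj (op n)) M}
    (h : ∀ α, cfunctional hM (cochainEval α) u = cfunctional hM (cochainEval α) v) : u = v := by
  have := Fintype.ofFinite (⦋q⦌ ⟶ n)
  rw [ctensor_eq_sum hM _ _ sum_cochainEval_smulRight u,
    ctensor_eq_sum hM _ _ sum_cochainEval_smulRight v]
  exact Finset.sum_congr rfl fun α _ => by rw [h]

theorem normSub_map_eq_zero {q : ℕ} {b : B.obj ⦋q⦌} (hb : b ∈ normSub (underlying B) q)
    {n : SimplexCategory} (α : ⦋q⦌ ⟶ n) (hα : ¬ Function.Injective α.toOrderHom) :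
    (B.map α).lin b = 0 := by
  cases q with
  | zero => exact absurd (fun a b _ => Subsingleton.elim (α := Fin 1) a b) hα
  | succ q =>
    obtain ⟨i, β, rfl⟩ := SimplexCategory.eq_σ_comp_of_not_injective α hα
    rw [B.map_comp]
    change (B.map β).lin ((B.map (SimplexCategory.σ i)).lin b) = 0
    have h := (mem_normSub_succ (underlying B)).1 hb i
    exact (congrArg (B.map β).lin h).trans (map_zero _)

theorem endSub_eval_mem (q : ℕ) (u : endSub B ((cochainComplex K).X q)) :
    cfunctional (hB ⦋q⦌) (cochainEval (𝟙 ⦋q⦌)) (u.1 ⦋q⦌) ∈ normSub (underlying B) q := by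
  cases q with
  | zero => trivial
  | succ q =>
    refine (mem_normSub_succ (underlying B)).2 fun i => ?_
    refine (endSub_map_cfunctional hB u (SimplexCategory.σ i) _).trans ?_
    rw [cochainEval_comp_map]
    have h0 : cochainEval (K := K) (𝟙 ⦋q + 1⦌ ≫ SimplexCategory.σ i) = 0 :=
      LinearMap.ext fun c => (normSub_simplexFunctions _).1 c.2 _ fun h => by
        have := Fintype.card_le_of_injective _ h
        simp at this
    rw [h0]
    exact map_zero (cfunctionalₗ (hB ⦋q⦌) (u.1 ⦋q⦌))

/-- Compatible families of normalized cochains with values in `B` are the same as normalized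
elements of `B`. -/
def endSubEval (q : ℕ) : endSub B ((cochainComplex K).X q) →ₗ[K] normSub (underlying B) q where
  toFun u := ⟨cfunctional (hB ⦋q⦌) (cochainEval (𝟙 ⦋q⦌)) (u.1 ⦋q⦌), endSub_eval_mem hB q u⟩
  map_add' u v := Subtype.ext (map_add (cfunctional (hB ⦋q⦌) _) (u.1 ⦋q⦌) (v.1 ⦋q⦌))
  map_smul' c u := Subtype.ext (map_smul (cfunctional (hB ⦋q⦌) _) c (u.1 ⦋q⦌))

/-- The Yoneda argument: evaluation at `α` is evaluation at the identity simplex precomposed with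
pullback along `α`, so a compatible family is governed by one element of `B^q`. -/
theorem cfunctional_cochainEval (q : ℕ) (u : endSub B ((cochainComplex K).X q))
    {n : SimplexCategory} (α : ⦋q⦌ ⟶ n) :
    cfunctional (hB n) (cochainEval α) (u.1 n) = (B.map α).lin (endSubEval hB q u).1 := by
  refine Eq.trans ?_ (endSub_map_cfunctional hB u α _).symm
  rw [cochainEval_comp_map, Category.id_comp]

theorem endSubEval_bijective (q : ℕ) : Function.Bijective (endSubEval hB q) := by
  constructor
  · intro u v huv
    refine Subtype.ext (funext fun n => ctensor_cochain_ext (hB n) fun α => ?_)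
    rw [cfunctional_cochainEval, cfunctional_cochainEval, huv]
  · rintro ⟨b, hb⟩
    have := fun n => Fintype.ofFinite (⦋q⦌ ⟶ n)
    change B.obj ⦋q⦌ at b
    -- The family belonging to `b` has the coordinate `α^* b` at each nondegenerate simplex `α`. At
    -- a degenerate simplex both its coordinate and `α^* b` vanish, the latter because `b` is
    -- normalized.
    let w : ∀ n, CTensor (((cochainComplex K).X q).obj (op n)) (B.obj n) := fun n =>
      ∑ α : ⦋q⦌ ⟶ n, cmk (hB n) (cochainSingle α) ((B.map α).lin b)
    have hw : ∀ n (β : ⦋q⦌ ⟶ n), cfunctional (hB n) (cochainEval β) (w n) = (B.map β).lin b := by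
      intro n β
      rw [map_sum]
      simp only [cfunctional_cmk, cochainEval_cochainSingle]
      rw [Finset.sum_eq_single β]
      · by_cases hβ : Function.Injective β.toOrderHom
        · simp [hβ]
        · simp [hβ, normSub_map_eq_zero hb β hβ]
      · intro α _ hα
        simp [Ne.symm hα]
      · simp
    refine ⟨⟨w, fun k l γ => ctensor_cochain_ext (hB l) fun α => ?_⟩, Subtype.ext ?_⟩
    · rw [cfunctional_ctensorMap (hB k), cfunctional_ctensorMap (hB l)]
      refine Eq.trans (congrArg _ (hw k α)) (Eq.trans ?_ (hw l (α ≫ γ)).symm)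
      rw [B.map_comp]
      rfl
    · refine (hw ⦋q⦌ (𝟙 _)).trans ?_
      rw [B.map_id]
      rfl

theorem cochainEval_comp_d (q : ℕ) :
    cochainEval (K := K) (𝟙 ⦋q + 1⦌) ∘ₗ (((cochainComplex K).d q (q + 1)).app (op ⦋q + 1⦌)).hom =
      ∑ i : Fin (q + 2), (-1 : ℤ) ^ (i : ℕ) • cochainEval (SimplexCategory.δ i) := by
  refine LinearMap.ext fun c => (cochainComplex_d_apply q (op ⦋q + 1⦌) c (𝟙 _)).trans ?_
  rw [LinearMap.sum_apply]
  exact Finset.sum_congr rfl fun i _ => by rw [Category.comp_id]; rfl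

theorem endSubEval_d (q : ℕ) (u : endSub B ((cochainComplex K).X q)) :
    endSubEval hB (q + 1) (endMap B ((cochainComplex K).d q (q + 1)) u) =
      normD (underlying B) q (endSubEval hB q u) := by
  refine Subtype.ext ?_
  change cfunctional (hB ⦋q + 1⦌) (cochainEval (𝟙 ⦋q + 1⦌))
      (ctensorMap (((cochainComplex K).d q (q + 1)).app (op ⦋q + 1⦌)).hom (𝟙 (B.obj ⦋q + 1⦌))
        (u.1 ⦋q + 1⦌)) =
    AlgebraicTopology.AlternatingCofaceMapComplex.objD (underlying B) q (endSubEval hB q u).1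
  rw [cfunctional_ctensorMap (hB ⦋q + 1⦌), cochainEval_comp_d]
  refine Eq.trans ?_ (objD_apply (underlying B) q _).symm
  refine (map_sum (cfunctionalₗ (hB ⦋q + 1⦌) (u.1 ⦋q + 1⦌)) _ _).trans ?_
  refine Finset.sum_congr rfl fun i _ => ?_
  rw [map_zsmul]
  congr 1
  exact cfunctional_cochainEval hB q u (SimplexCategory.δ i)

/-- Compatible families of normalized cochains with values in `B` form the standard
normalization of `B`. -/
def endCochainIso : ((endFunctor B).mapHomologicalComplex (ComplexShape.up ℕ)).obj (cochainComplex K) ≅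
    (normFunctor K).obj (underlying B) :=
  HomologicalComplex.Hom.isoOfComponents
    (fun q => (LinearEquiv.ofBijective (endSubEval hB q) (endSubEval_bijective hB q)).toModuleIso)
    fun q _ h => by
      obtain rfl : q + 1 = _ := h
      simp only [normFunctor, normComplex, CochainComplex.of_d]
      exact ModuleCat.hom_ext (LinearMap.ext fun u => (endSubEval_d hB q u).symm)

variable (B) in
/-- The complete Thom-Sullivan normalization as compatible families of forms. -/
def tsIsoEnd : (tsFunctor K).obj B ≅
    ((endFunctor B).mapHomologicalComplex (ComplexShape.up ℕ)).obj (formComplex K) :=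
  HomologicalComplex.Hom.isoOfComponents
    (fun q => Iso.refl (ModuleCat.of K (tsSub B q)))
    fun q _ h => by
      obtain rfl : q + 1 = _ := h
      simp only [tsFunctor, tsComplex, CochainComplex.of_d]
      refine ModuleCat.hom_ext (LinearMap.ext fun u => Subtype.ext (funext fun n => ?_))
      change ctensorMap (((formComplex K).d q (q + 1)).app (op n)).hom (𝟙 (B.obj n)) (u.1 n) =
        ctensorMap (OmD q n) (𝟙 (B.obj n)) (u.1 n)
      rw [formComplex_d_app]
      rfl

variable [CharZero K]

/-- The cochain of integrals of `ω`, evaluated at the identity simplex of `[q]`, is the integral of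
`ω` itself. -/
theorem integral_eq_comp : integral hB = (tsIsoEnd B).hom ≫
    ((endFunctor B).mapHomologicalComplex (ComplexShape.up ℕ)).map (formToCochain K) ≫
      (endCochainIso hB).hom := by
  refine HomologicalComplex.Hom.ext (funext fun q => ModuleCat.hom_ext (LinearMap.ext fun u =>
    Subtype.ext ?_))
  refine Eq.trans ?_ (cfunctional_ctensorMap (hB ⦋q⦌) (hB ⦋q⦌)
    (((formToCochain K).f q).app (op ⦋q⦌)).hom (𝟙 (B.obj ⦋q⦌)) (cochainEval (𝟙 ⦋q⦌))
    (u.1 ⦋q⦌)).symm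
  have h : cochainEval (𝟙 ⦋q⦌) ∘ₗ (((formToCochain K).f q).app (op ⦋q⦌)).hom = OmInt K q :=
    LinearMap.ext fun ω => congrArg (OmInt K q)
      (LinearMap.congr_fun (formPullback_id (K := K) (ι := Fin (q + 1)) q) ω)
  exact congrArg (fun φ => cfunctional (hB ⦋q⦌) φ (u.1 ⦋q⦌)) h.symm

/-- Integration over simplices is a quasi-isomorphism. -/
theorem quasiIso_integral : QuasiIso (integral hB) := by
  -- The additive functor carries the homotopy equivalence of simplicial vector spaces to one of
  -- complexes of modules.
  have h : QuasiIso (((endFunctor B).mapHomologicalComplex (ComplexShape.up ℕ)).map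
      (formToCochain K)) :=
    ((endFunctor B).mapHomotopyEquiv (formToCochainEquiv K)).quasiIso_hom
  rw [integral_eq_comp]
  infer_instance

end EndFunctor

/-! ### Quasi-isomorphisms of total complexes -/

section FilteredComplex

variable {R : Type u} [CommRing R]

/-- A filtration argument: let `f : A → B` be a morphism of complexes with bounded exhaustive
filtrations `FA`, `FB`. If the mapping cone of `f` is exact on graded pieces then `f` is a
quasi-isomorphism. -/
theorem CochainComplex.quasiIso_of_filtration {A B : CochainComplex (ModuleCat.{u} R) ℤ} (f : A ⟶ B)
    (FA : ∀ (_ : ℤ) (i : ℤ), A.X i → Prop) (FB : ∀ (_ : ℤ) (i : ℤ), B.X i → Prop) (b : ℤ)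
    (hA : ∀ i x, FA b i x) (hB : ∀ i y, FB b i y)
    (hA' : ∀ k i, i < k → ∀ x, FA k i x → x = 0) (hB' : ∀ k i, i < k → ∀ y, FB k i y → y = 0)
    (H : ∀ k i (x : A.X (i + 1)) (y : B.X i), FA k (i + 1) x → FB k i y →
      A.d (i + 1) (i + 1 + 1) x = 0 → f.f (i + 1) x = B.d i (i + 1) y →
      ∃ (w : A.X i) (z : B.X (i - 1)), FA (k + 1) (i + 1) (x - A.d i (i + 1) w) ∧
        FB (k + 1) i (y - (f.f i w - B.d (i - 1) i z))) : QuasiIso f := by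
  have comm : ∀ i j (w : A.X i), f.f j (A.d i j w) = B.d i j (f.f i w) := fun i j w =>
    (congrArg (fun g : A.X i ⟶ B.X j => g w) (f.comm i j)).symm
  have dA : ∀ i j k (w : A.X i), A.d j k (A.d i j w) = 0 := fun i j k w =>
    congrArg (fun g : A.X i ⟶ A.X k => g w) (A.d_comp_d i j k)
  have dB : ∀ i j k (w : B.X i), B.d j k (B.d i j w) = 0 := fun i j k w =>
    congrArg (fun g : B.X i ⟶ B.X k => g w) (B.d_comp_d i j k)
  -- A pair `(x, y)` with `d x = 0` and `f x = d y` is a cocycle of the cone. Each application of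
  -- `H` subtracts a coboundary of the cone and raises the filtration by one.
  have step : ∀ i (x : A.X (i + 1)) (y : B.X i), A.d (i + 1) (i + 1 + 1) x = 0 →
      f.f (i + 1) x = B.d i (i + 1) y → ∀ N : ℕ, ∃ (w : A.X i) (z : B.X (i - 1)),
        FA (b + N) (i + 1) (x - A.d i (i + 1) w) ∧
        FB (b + N) i (y - (f.f i w - B.d (i - 1) i z)) := by
    intro i x y hx hxy N
    induction N with
    | zero => exact ⟨0, 0, by simpa using hA _ _, by simpa using hB _ _⟩
    | succ N ih =>
      obtain ⟨w, z, h1, h2⟩ := ih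
      obtain ⟨w', z', h1', h2'⟩ := H _ _ _ _ h1 h2 (by rw [map_sub, hx, dA, sub_zero])
        (by rw [map_sub, map_sub, map_sub, hxy, comm, dB, sub_zero])
      refine ⟨w + w', z + z', ?_, ?_⟩
      · rw [Nat.cast_succ, ← add_assoc, map_add, ← sub_sub]
        exact h1'
      · have e : y - (f.f i (w + w') - B.d (i - 1) i (z + z')) =
            y - (f.f i w - B.d (i - 1) i z) - (f.f i w' - B.d (i - 1) i z') := by
          rw [map_add, map_add]; abel
        rw [Nat.cast_succ, ← add_assoc, e]
        exact h2'
  have main : ∀ i (x : A.X (i + 1)) (y : B.X i), A.d (i + 1) (i + 1 + 1) x = 0 →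
      f.f (i + 1) x = B.d i (i + 1) y → ∃ (w : A.X i) (z : B.X (i - 1)),
        x = A.d i (i + 1) w ∧ y = f.f i w - B.d (i - 1) i z := by
    intro i x y hx hxy
    -- After this many steps the filtration index is at least `i + 2`, beyond both degrees `i + 1`
    -- and `i` of the pair, so what remains is zero.
    obtain ⟨w, z, h1, h2⟩ := step i x y hx hxy (i + 2 - b).toNat
    exact ⟨w, z, sub_eq_zero.1 (hA' _ _ (by omega) _ h1), sub_eq_zero.1 (hB' _ _ (by omega) _ h2)⟩
  -- Exactness of the cone at `(x, y)` gives injectivity on cohomology, and at `(0, y)` it gives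
  -- surjectivity.
  refine ⟨fun i => (CochainComplex.quasiIsoAt_iff_of_moduleCat_int f i).2 ⟨?_, fun y hy => ?_⟩⟩
  · obtain ⟨i, rfl⟩ : ∃ j, i = j + 1 := ⟨i - 1, by ring⟩
    rw [add_sub_cancel_right]
    rintro x hx ⟨y, hy⟩
    obtain ⟨w, _, h, _⟩ := main i x y hx hy.symm
    exact ⟨w, h.symm⟩
  · obtain ⟨w, z, h, h'⟩ := main i 0 y (map_zero _) (by rw [map_zero, hy])
    refine ⟨w, h.symm, -z, ?_⟩
    rw [h', map_neg]; abel

/-- A description of the terms of a complex `T` as direct sums of modules `L q p`, where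
`q + p` is the degree, such that the differential of `T` is the sum of maps `dh : L q p → L (q+1) p`
and `dv : L q p → L q (p+1)`, and such that only `p ≥ bound` matter. -/
structure TotalDecomposition (T : CochainComplex (ModuleCat.{u} R) ℤ) where
  L : ℕ → ℤ → ModuleCat.{u} R
  dh : ∀ q p, L q p →ₗ[R] L (q + 1) p
  dv : ∀ q p, L q p →ₗ[R] L q (p + 1)
  ι : ∀ {q : ℕ} {p n : ℤ}, (q : ℤ) + p = n → L q p →ₗ[R] T.X n
  π : ∀ {q : ℕ} {p n : ℤ}, (q : ℤ) + p = n → T.X n →ₗ[R] L q p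
  bound : ℤ
  π_ι : ∀ {q : ℕ} {p n : ℤ} (h : (q : ℤ) + p = n) (x : L q p), π h (ι h x) = x
  π_ι_ne : ∀ {q q' : ℕ} {p p' n : ℤ} (h : (q : ℤ) + p = n) (h' : (q' : ℤ) + p' = n) (x : L q' p'),
    p ≠ p' → π h (ι h' x) = 0
  ext : ∀ {n : ℤ} (x : T.X n), (∀ (q : ℕ) (p : ℤ) (h : (q : ℤ) + p = n), π h x = 0) → x = 0
  π_zero_d : ∀ {p n n' : ℤ} (h : ((0 : ℕ) : ℤ) + p = n) (h' : ((0 : ℕ) : ℤ) + (p + 1) = n') (x : T.X n),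
    π h' (T.d n n' x) = dv 0 p (π h x)
  π_succ_d : ∀ {q : ℕ} {p n n' : ℤ} (h : (q : ℤ) + (p + 1) = n) (h₁ : ((q + 1 : ℕ) : ℤ) + p = n)
    (h' : ((q + 1 : ℕ) : ℤ) + (p + 1) = n') (x : T.X n),
    π h' (T.d n n' x) = dh q (p + 1) (π h x) + dv (q + 1) p (π h₁ x)
  π_bound : ∀ {q : ℕ} {p n : ℤ} (h : (q : ℤ) + p = n), p < bound → ∀ x, π h x = 0

namespace TotalDecomposition

variable {T : CochainComplex (ModuleCat.{u} R) ℤ} (D : TotalDecomposition T)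

/-- The elements all of whose components with `p < k` vanish. -/
def filt (k n : ℤ) (x : T.X n) : Prop :=
  ∀ (q : ℕ) (p : ℤ) (h : (q : ℤ) + p = n), p < k → D.π h x = 0

variable {D}

theorem filt_sub {k n : ℤ} {x y : T.X n} (hx : D.filt k n x) (hy : D.filt k n y) :
    D.filt k n (x - y) := fun q p h hp => by
  rw [map_sub, hx q p h hp, hy q p h hp, sub_zero]

theorem filt_succ {k n : ℤ} {x : T.X n} (hx : D.filt k n x)
    (h : ∀ (q : ℕ) (h : (q : ℤ) + k = n), D.π h x = 0) : D.filt (k + 1) n x := fun q p hp hpk => by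
  rcases (Int.lt_add_one_iff.1 hpk).lt_or_eq with hlt | rfl
  · exact hx q p hp hlt
  · exact h q hp

theorem eq_zero_of_filt {k n : ℤ} {x : T.X n} (hx : D.filt k n x) (hn : n < k) : x = 0 :=
  D.ext x fun q p h => hx q p h (by omega)

theorem filt_ι {q : ℕ} {p n : ℤ} (h : (q : ℤ) + p = n) (x : D.L q p) : D.filt p n (D.ι h x) :=
  fun _ _ h' hp => D.π_ι_ne h' h x hp.ne

/-- The differential keeps `p` or raises it, so the filtration by `p` is a filtration by
subcomplexes. -/
theorem filt_d {k n n' : ℤ} (hn : n + 1 = n') {x : T.X n} (hx : D.filt k n x) :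
    D.filt k n' (T.d n n' x) := by
  intro q p h hp
  obtain ⟨p, rfl⟩ : ∃ p', p = p' + 1 := ⟨p - 1, by ring⟩
  cases q with
  | zero =>
    have h0 : ((0 : ℕ) : ℤ) + p = n := by omega
    rw [D.π_zero_d h0 h, hx _ _ h0 (by omega), map_zero]
  | succ q =>
    have h0 : (q : ℤ) + (p + 1) = n := by push_cast at h; omega
    have h1 : ((q + 1 : ℕ) : ℤ) + p = n := by omega
    rw [D.π_succ_d h0 h1 h, hx _ _ h0 hp, hx _ _ h1 (by omega), map_zero, map_zero, add_zero]

/-- Row `0` receives only the map `dv` from column `k - 1`, which vanishes on the filtration step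
`k`. -/
theorem π_zero_d_of_filt {k n n' : ℤ} (h' : ((0 : ℕ) : ℤ) + k = n') (hn : n + 1 = n') {x : T.X n}
    (hx : D.filt k n x) : D.π h' (T.d n n' x) = 0 := by
  obtain ⟨k, rfl⟩ : ∃ p', k = p' + 1 := ⟨k - 1, by ring⟩
  have h0 : ((0 : ℕ) : ℤ) + k = n := by omega
  rw [D.π_zero_d h0 h', hx _ _ h0 (by omega), map_zero]

/-- In the leading column `p = k` the contribution of `dv` comes from column `k - 1` and vanishes,
so the graded pieces are the columns with differential `dh`. -/
theorem π_succ_d_of_filt {q : ℕ} {k n n' : ℤ} (h : (q : ℤ) + k = n)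
    (h' : ((q + 1 : ℕ) : ℤ) + k = n') {x : T.X n} (hx : D.filt k n x) :
    D.π h' (T.d n n' x) = D.dh q k (D.π h x) := by
  obtain ⟨k, rfl⟩ : ∃ p', k = p' + 1 := ⟨k - 1, by ring⟩
  have h1 : ((q + 1 : ℕ) : ℤ) + k = n := by push_cast; omega
  rw [D.π_succ_d h h1 h', hx _ _ h1 (by omega), map_zero, add_zero]

/-- The hypotheses `h₀`, `h₁`, `h₂` say that the mapping cone of each column is exact, split
according to how many terms of the cone exist near row `0`. The graded pieces of the filtration by
`p` are these columns. -/
theorem quasiIso_of_columns {T' : CochainComplex (ModuleCat.{u} R) ℤ} {D' : TotalDecomposition T'}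
    (f : T ⟶ T') (φ : ∀ q p, D.L q p →ₗ[R] D'.L q p)
    (hφ : ∀ (q : ℕ) (p n : ℤ) (h : (q : ℤ) + p = n) (x : T.X n),
      D'.π h (f.f n x) = φ q p (D.π h x))
    (h₀ : ∀ p (x : D.L 0 p), D.dh 0 p x = 0 → φ 0 p x = 0 → x = 0)
    (h₁ : ∀ p (x : D.L 1 p) (y : D'.L 0 p), D.dh 1 p x = 0 → φ 1 p x = D'.dh 0 p y →
      ∃ w, D.dh 0 p w = x ∧ φ 0 p w = y)
    (h₂ : ∀ q p (x : D.L (q + 2) p) (y : D'.L (q + 1) p), D.dh (q + 2) p x = 0 →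
      φ (q + 2) p x = D'.dh (q + 1) p y →
      ∃ w z, D.dh (q + 1) p w = x ∧ φ (q + 1) p w - D'.dh q p z = y) : QuasiIso f := by
  have comm : ∀ i j (w : T.X i), f.f j (T.d i j w) = T'.d i j (f.f i w) := fun i j w =>
    (congrArg (fun g : T.X i ⟶ T'.X j => g w) (f.comm i j)).symm
  have ff : ∀ {k n x}, D.filt k n x → D'.filt k n (f.f n x) := fun hx q p h hp => by
    rw [hφ, hx q p h hp, map_zero]
  refine CochainComplex.quasiIso_of_filtration f D.filt D'.filt (min D.bound D'.bound)
    (fun _ x q p h hp => D.π_bound h (by omega) x) (fun _ x q p h hp => D'.π_bound h (by omega) x)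
    (fun _ _ hi _ hx => eq_zero_of_filt hx hi) (fun _ _ hi _ hx => eq_zero_of_filt hx hi) ?_
  intro k i x y hx hy hdx hxy
  have hdx' : ∀ (q : ℕ) (hq : (q : ℤ) + k = i + 1), D.dh q k (D.π hq x) = 0 := fun q hq => by
    rw [← π_succ_d_of_filt hq (n' := i + 1 + 1) (by push_cast; omega) hx, hdx, map_zero]
  -- In column `k` the element `x` sits in row `i + 1 - k` and `y` in row `i - k`. Either both rows
  -- are negative, or only `x` has a component, in row `0`, or both components exist.
  rcases lt_trichotomy (i + 1) k with hik | rfl | hik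
  · refine ⟨0, 0, filt_succ ?_ fun q hq => by omega, filt_succ ?_ fun q hq => by omega⟩
    · simpa using hx
    · simpa using hy
  · refine ⟨0, 0, filt_succ ?_ fun q hq => ?_, filt_succ ?_ fun q hq => by omega⟩
    · simpa using hx
    · obtain rfl : q = 0 := by omega
      rw [map_zero, sub_zero]
      refine h₀ _ _ (hdx' 0 hq) ?_
      rw [← hφ, hxy, π_zero_d_of_filt _ rfl hy]
    · simpa using hy
  · obtain ⟨q, hq⟩ : ∃ q : ℕ, (q : ℤ) + k = i := ⟨(i - k).toNat, by omega⟩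
    have hq1 : ((q + 1 : ℕ) : ℤ) + k = i + 1 := by push_cast; omega
    have e1 : φ (q + 1) k (D.π hq1 x) = D'.dh q k (D'.π hq y) := by
      rw [← hφ, hxy, π_succ_d_of_filt hq hq1 hy]
    cases q with
    | zero =>
      obtain ⟨w, hw, hw'⟩ := h₁ k _ _ (hdx' _ hq1) e1
      refine ⟨D.ι hq w, 0, filt_succ (filt_sub hx (filt_d rfl (filt_ι hq w))) fun q' hq' => ?_,
        filt_succ (filt_sub hy ?_) fun q' hq' => ?_⟩
      · obtain rfl : q' = 1 := by omega
        rw [map_sub, π_succ_d_of_filt hq hq1 (filt_ι hq w), D.π_ι, hw, sub_self]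
      · simpa using ff (filt_ι hq w)
      · obtain rfl : q' = 0 := by omega
        rw [map_zero, sub_zero, map_sub, hφ, D.π_ι, hw', sub_self]
    | succ q =>
      obtain ⟨w, z, hw, hw'⟩ := h₂ q k _ _ (hdx' _ hq1) e1
      have hz : (q : ℤ) + k = i - 1 := by push_cast at hq; omega
      refine ⟨D.ι hq w, D'.ι hz z, filt_succ (filt_sub hx (filt_d rfl (filt_ι hq w)))
        fun q' hq' => ?_, filt_succ (filt_sub hy (filt_sub (ff (filt_ι hq w))
        (filt_d (by omega) (filt_ι hz z)))) fun q' hq' => ?_⟩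
      · obtain rfl : q' = q + 1 + 1 := by omega
        rw [map_sub, π_succ_d_of_filt hq hq1 (filt_ι hq w), D.π_ι, hw, sub_self]
      · obtain rfl : q' = q + 1 := by omega
        rw [map_sub, map_sub, hφ, D.π_ι, π_succ_d_of_filt hz hq (filt_ι hz z), D'.π_ι, hw', sub_self]

/-- The hypotheses `h₀`, `h₁`, `h₂` say that each column, augmented by `A^p`, is exact. The term
`A^p` is treated as sitting in column `p`, just in front of row `0`. -/
theorem quasiIso_of_augmentation {A : CochainComplex (ModuleCat.{u} R) ℤ} (f : A ⟶ T)
    (hb : ∀ p < D.bound, ∀ x : A.X p, x = 0) (η : ∀ p, A.X p →ₗ[R] D.L 0 p)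
    (hη : ∀ p (x : A.X p), f.f p x = D.ι (by simp) (η p x))
    (h₀ : ∀ p (x : A.X p), η p x = 0 → x = 0)
    (h₁ : ∀ p (y : D.L 0 p), D.dh 0 p y = 0 → ∃ x, η p x = y)
    (h₂ : ∀ q p (y : D.L (q + 1) p), D.dh (q + 1) p y = 0 → ∃ z, D.dh q p z = y) : QuasiIso f := by
  have fA : ∀ n (x : A.X n), D.filt n n (f.f n x) := fun n x => by
    rw [hη]; exact filt_ι _ _
  -- The filtration on `A` has a single jump in each degree: the step `k` is all of `A^n` for `k ≤
  -- n`, and zero afterwards.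
  refine CochainComplex.quasiIso_of_filtration f (fun k n x => n < k → x = 0) D.filt D.bound
    (fun i x hi => hb i hi x) (fun _ x q p h hp => D.π_bound h hp x)
    (fun _ _ hi _ hx => hx hi) (fun _ _ hi _ hx => eq_zero_of_filt hx hi) ?_
  intro k i x y hx hy hdx hxy
  rcases lt_trichotomy (i + 1) k with hik | rfl | hik
  · refine ⟨0, 0, fun _ => by simpa using hx hik, filt_succ ?_ fun q hq => by omega⟩
    simpa using hy
  · refine ⟨0, 0, fun _ => ?_, filt_succ ?_ fun q hq => by omega⟩
    · rw [map_zero, sub_zero]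
      refine h₀ _ _ ?_
      have h := π_zero_d_of_filt (D := D) (zero_add (i + 1)) rfl hy
      rw [← hxy, hη, D.π_ι] at h
      exact h
    · simpa using hy
  · obtain ⟨q, hq⟩ : ∃ q : ℕ, (q : ℤ) + k = i := ⟨(i - k).toNat, by omega⟩
    have hq1 : ((q + 1 : ℕ) : ℤ) + k = i + 1 := by push_cast; omega
    have e1 : D.dh q k (D.π hq y) = 0 := by
      rw [← π_succ_d_of_filt hq hq1 hy, ← hxy, fA _ _ _ _ _ hik]
    cases q with
    | zero =>
      obtain rfl : k = i := by simpa using hq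
      obtain ⟨w, hw⟩ := h₁ _ _ e1
      refine ⟨w, 0, fun h => by omega, filt_succ (filt_sub hy ?_) fun q' hq' => ?_⟩
      · simpa using fA _ w
      · obtain rfl : q' = 0 := by omega
        rw [map_zero, sub_zero, map_sub, hη, D.π_ι, hw, sub_self]
    | succ q =>
      obtain ⟨z, hz'⟩ := h₂ q k _ e1
      have hz : (q : ℤ) + k = i - 1 := by push_cast at hq; omega
      refine ⟨0, -D.ι hz z, fun h => by omega, filt_succ (filt_sub hy ?_) fun q' hq' => ?_⟩
      · rw [map_zero, map_neg, zero_sub, neg_neg]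
        exact filt_d (by omega) (filt_ι hz z)
      · obtain rfl : q' = q + 1 := by omega
        rw [map_zero, map_neg, zero_sub, neg_neg, map_sub,
          π_succ_d_of_filt hz hq (filt_ι hz z), D.π_ι, hz', sub_self]

end TotalDecomposition

end FilteredComplex

/-! ### Projections of the total complex of a double complex -/

namespace HomologicalComplex₂

variable {V : Type*} [Category* V] [Preadditive V]
  (L : HomologicalComplex₂ V (ComplexShape.up ℕ) (ComplexShape.up ℤ))
  [L.HasTotal (ComplexShape.up ℤ)]

open Classical in
/-- The projection from the total complex to one of its summands. -/
def πTotal (q : ℕ) (p n : ℤ) (h : (q : ℤ) + p = n) :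
    (L.total (ComplexShape.up ℤ)).X n ⟶ (L.X q).X p :=
  L.totalDesc fun q' p' (h' : (q' : ℤ) + p' = n) =>
    if e : q' = q then (L.XXIsoOfEq _ _ _ e (by subst e; omega)).hom else 0

theorem ιTotal_πTotal_self (q : ℕ) (p n : ℤ) (h : (q : ℤ) + p = n) :
    L.ιTotal (ComplexShape.up ℤ) q p n h ≫ L.πTotal q p n h = 𝟙 _ := by
  rw [πTotal, ι_totalDesc, dif_pos rfl, XXIsoOfEq_rfl, Iso.refl_hom]

theorem ιTotal_πTotal_ne (q q' : ℕ) (p p' n : ℤ) (h : (q : ℤ) + p = n) (h' : (q' : ℤ) + p' = n)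
    (hq : q' ≠ q) :
    L.ιTotal (ComplexShape.up ℤ) q' p' n h' ≫ L.πTotal q p n h = 0 := by
  rw [πTotal, ι_totalDesc, dif_neg hq]

theorem ιTotal_d (q : ℕ) (p n n' : ℤ) (h : (q : ℤ) + p = n) (h₁ : ((q + 1 : ℕ) : ℤ) + p = n')
    (h₂ : (q : ℤ) + (p + 1) = n') :
    L.ιTotal (ComplexShape.up ℤ) q p n h ≫ (L.total (ComplexShape.up ℤ)).d n n' =
      (L.d q (q + 1)).f p ≫ L.ιTotal (ComplexShape.up ℤ) (q + 1) p n' h₁ +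
        ((-1) ^ q : ℤˣ) • ((L.X q).d p (p + 1) ≫ L.ιTotal (ComplexShape.up ℤ) q (p + 1) n' h₂) := by
  have e1 := L.d₁_eq (ComplexShape.up ℤ) (show (ComplexShape.up ℕ).Rel q (q + 1) from rfl) p n' h₁
  have e2 := L.d₂_eq (ComplexShape.up ℤ) q (show (ComplexShape.up ℤ).Rel p (p + 1) from rfl) n' h₂
  rw [total_d, Preadditive.comp_add, ι_D₁, ι_D₂, e1, e2]
  exact congrArg (· + _) (one_smul _ _)

theorem d_πTotal_zero (p n n' : ℤ) (h : ((0 : ℕ) : ℤ) + p = n)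
    (h' : ((0 : ℕ) : ℤ) + (p + 1) = n') :
    (L.total (ComplexShape.up ℤ)).d n n' ≫ L.πTotal 0 (p + 1) n' h' =
      L.πTotal 0 p n h ≫ (L.X 0).d p (p + 1) := by
  refine total.hom_ext _ fun q₁ p₁ (h₁ : (q₁ : ℤ) + p₁ = n) => ?_
  have h₂ : ((q₁ + 1 : ℕ) : ℤ) + p₁ = n' := by push_cast; omega
  have h₃ : (q₁ : ℤ) + (p₁ + 1) = n' := by omega
  rw [← Category.assoc, ιTotal_d L _ _ _ _ h₁ h₂ h₃, Preadditive.add_comp, Category.assoc,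
    ιTotal_πTotal_ne _ _ _ _ _ _ _ _ (Nat.succ_ne_zero q₁), comp_zero, zero_add,
    Linear.units_smul_comp, Category.assoc, ← Category.assoc (L.ιTotal _ _ _ _ _)]
  by_cases hq : q₁ = 0
  · subst hq
    obtain rfl : p₁ = p := by omega
    rw [ιTotal_πTotal_self, ιTotal_πTotal_self, Category.comp_id, Category.id_comp, pow_zero, one_smul]
  · rw [ιTotal_πTotal_ne _ _ _ _ _ _ _ _ hq, ιTotal_πTotal_ne _ _ _ _ _ _ _ _ hq, comp_zero,
      zero_comp, smul_zero]

theorem d_πTotal_succ (q : ℕ) (p n n' : ℤ) (h : (q : ℤ) + (p + 1) = n)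
    (h₁ : ((q + 1 : ℕ) : ℤ) + p = n) (h' : ((q + 1 : ℕ) : ℤ) + (p + 1) = n') :
    (L.total (ComplexShape.up ℤ)).d n n' ≫ L.πTotal (q + 1) (p + 1) n' h' =
      L.πTotal q (p + 1) n h ≫ (L.d q (q + 1)).f (p + 1) +
        L.πTotal (q + 1) p n h₁ ≫ (((-1) ^ (q + 1) : ℤˣ) • (L.X (q + 1)).d p (p + 1)) := by
  refine total.hom_ext _ fun q₁ p₁ (h₂ : (q₁ : ℤ) + p₁ = n) => ?_
  have h₃ : ((q₁ + 1 : ℕ) : ℤ) + p₁ = n' := by push_cast at *; omega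
  have h₄ : (q₁ : ℤ) + (p₁ + 1) = n' := by omega
  rw [← Category.assoc, ιTotal_d L _ _ _ _ h₂ h₃ h₄, Preadditive.add_comp, Category.assoc,
    Preadditive.comp_add, Linear.units_smul_comp, Category.assoc, ← Category.assoc (L.ιTotal _ _ _ _ _),
    ← Category.assoc (L.ιTotal _ _ _ _ _)]
  congr 1
  · by_cases hq : q₁ = q
    · subst hq
      obtain rfl : p₁ = p + 1 := by omega
      rw [ιTotal_πTotal_self, ιTotal_πTotal_self, Category.comp_id, Category.id_comp]
    · rw [ιTotal_πTotal_ne _ _ _ _ _ _ _ _ hq, ιTotal_πTotal_ne _ _ _ _ _ _ _ _ (by omega),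
        comp_zero, zero_comp]
  · by_cases hq : q₁ = q + 1
    · subst hq
      obtain rfl : p₁ = p := by omega
      rw [ιTotal_πTotal_self, ιTotal_πTotal_self, Category.comp_id, Category.id_comp]
    · rw [ιTotal_πTotal_ne _ _ _ _ _ _ _ _ hq, ιTotal_πTotal_ne _ _ _ _ _ _ _ _ hq,
        comp_zero, zero_comp, smul_zero]

/-- In total degree `n` a summand with `p = n - q ≥ b` has `q ≤ n - b`, so only finitely many
summands are nonzero. Boundedness below is thus what turns the coproduct into a finite biproduct,
which additive functors and the sheaf condition respect. -/
theorem sum_πTotal_ιTotal (b : ℤ) (hb : ∀ q p, p < b → IsZero ((L.X q).X p)) (n : ℤ) :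
    ∑ q ∈ Finset.range (n - b + 1).toNat,
      L.πTotal q (n - q) n (by ring) ≫ L.ιTotal (ComplexShape.up ℤ) q (n - q) n
        (show (q : ℤ) + (n - q) = n by ring) = 𝟙 _ := by
  refine total.hom_ext _ fun q₁ p₁ (h₁ : (q₁ : ℤ) + p₁ = n) => ?_
  by_cases hp : p₁ < b
  · exact (hb q₁ p₁ hp).eq_of_src _ _
  · obtain rfl : p₁ = n - q₁ := by omega
    rw [Preadditive.comp_sum, Finset.sum_eq_single q₁, ← Category.assoc, ιTotal_πTotal_self,
      Category.comp_id, Category.id_comp]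
    · intro q _ hq
      rw [← Category.assoc, ιTotal_πTotal_ne _ _ _ _ _ _ _ _ hq.symm, zero_comp]
    · intro h
      exact absurd (Finset.mem_range.2 (by omega)) h

/-- The description of the total complex as a direct sum, after application of an additive functor
to modules. -/
def totalDecomposition {R : Type u} [CommRing R] (E : V ⥤ ModuleCat.{u} R) [E.Additive] (b : ℤ)
    (hb : ∀ q p, p < b → IsZero ((L.X q).X p)) :
    TotalDecomposition ((E.mapHomologicalComplex (ComplexShape.up ℤ)).obj
      (L.total (ComplexShape.up ℤ))) where
  L q p := E.obj ((L.X q).X p)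
  dh q p := (E.map ((L.d q (q + 1)).f p)).hom
  dv q p := (E.map (((-1) ^ q : ℤˣ) • (L.X q).d p (p + 1))).hom
  ι h := (E.map (L.ιTotal (ComplexShape.up ℤ) _ _ _ h)).hom
  π h := (E.map (L.πTotal _ _ _ h)).hom
  bound := b
  π_ι {q p n} h x := by
    have := congrArg (fun f => E.map f x) (L.ιTotal_πTotal_self q p n h)
    simp only [E.map_comp, E.map_id] at this
    exact this
  π_ι_ne {q q' p p' n} h h' x hp := by
    have := congrArg (fun f => E.map f x) (L.ιTotal_πTotal_ne q q' p p' n h h' (by omega))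
    simp only [E.map_comp, E.map_zero] at this
    exact this
  ext {n} x hx := by
    have := congrArg (fun f => E.map f x) (L.sum_πTotal_ιTotal b hb n)
    simp only [E.map_sum, E.map_comp, E.map_id] at this
    refine this.symm.trans (Eq.trans (LinearMap.congr_fun (ModuleCat.hom_sum _ _) _) ?_)
    refine (LinearMap.sum_apply _ _ _).trans ?_
    refine Finset.sum_eq_zero fun q _ => ?_
    exact (congrArg (E.map (L.ιTotal (ComplexShape.up ℤ) q (n - q) n _)).hom
      (hx q (n - q) (by ring))).trans (map_zero _)
  π_zero_d {p n n'} h h' x := by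
    have := congrArg (fun f => E.map f x) (L.d_πTotal_zero p n n' h h')
    simp only [E.map_comp] at this
    rw [pow_zero, one_smul]
    exact this
  π_succ_d {q p n n'} h h₁ h' x := by
    have := congrArg (fun f => E.map f x) (L.d_πTotal_succ q p n n' h h₁ h')
    simp only [E.map_comp, E.map_add] at this
    exact this
  π_bound {q p n} h hp x := by
    have := congrArg (fun f => E.map f (E.map (L.πTotal q p n h) x)) ((hb q p hp).eq_of_src (𝟙 _) 0)
    simp only [E.map_id, E.map_zero] at this
    exact this

end HomologicalComplex₂

/-! ### Exactness of the mapping cone of a quasi-isomorphism -/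

section ConeExact

variable {R : Type u} [CommRing R] {A B : CochainComplex (ModuleCat.{u} R) ℕ} (f : A ⟶ B)

/-- A primitive `w` of `x` exists by injectivity in degree `1`. Then `f w - y` is a cocycle, and
subtracting from `w` a cocycle with this image corrects `w`; in degree `0` no coboundary intervenes.
-/
theorem CochainComplex.exists_of_quasiIso_one [QuasiIso f] (x : A.X 1) (y : B.X 0)
    (hx : A.d 1 2 x = 0) (hxy : f.f 1 x = B.d 0 1 y) : ∃ w, A.d 0 1 w = x ∧ f.f 0 w = y := by
  have h1 := ((CochainComplex.quasiIsoAt_succ_iff_of_moduleCat f 0).1 inferInstance).1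
  have h0 := ((CochainComplex.quasiIsoAt_zero_iff_of_moduleCat f).1 inferInstance).2
  obtain ⟨w, hw⟩ := h1 x hx ⟨y, hxy.symm⟩
  obtain ⟨v, hv, hv'⟩ := h0 (f.f 0 w - y) (by
    rw [map_sub, ← hxy, ← hw, sub_eq_zero]
    exact congrArg (fun g : A.X 0 ⟶ B.X 1 => g w) (f.comm 0 1))
  exact ⟨w - v, by rw [map_sub, hv, hw, sub_zero], by rw [map_sub, hv', sub_sub_cancel]⟩

theorem CochainComplex.exists_of_quasiIso_add_two [QuasiIso f] (q : ℕ) (x : A.X (q + 2))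
    (y : B.X (q + 1)) (hx : A.d (q + 2) (q + 3) x = 0)
    (hxy : f.f (q + 2) x = B.d (q + 1) (q + 2) y) :
    ∃ w z, A.d (q + 1) (q + 2) w = x ∧ f.f (q + 1) w - B.d q (q + 1) z = y := by
  have h1 := ((CochainComplex.quasiIsoAt_succ_iff_of_moduleCat f (q + 1)).1 inferInstance).1
  have h0 := ((CochainComplex.quasiIsoAt_succ_iff_of_moduleCat f q).1 inferInstance).2
  obtain ⟨w, hw⟩ := h1 x hx ⟨y, hxy.symm⟩
  obtain ⟨v, hv, z, hz⟩ := h0 (f.f (q + 1) w - y) (by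
    rw [map_sub, ← hxy, ← hw, sub_eq_zero]
    exact congrArg (fun g : A.X (q + 1) ⟶ B.X (q + 2) => g w) (f.comm (q + 1) (q + 2)))
  refine ⟨w - v, z, by rw [map_sub, hv, hw, sub_zero], ?_⟩
  rw [map_sub, hz]
  abel

end ConeExact

theorem HomologicalComplex₂.total_map_πTotal {V : Type*} [Category* V] [Preadditive V]
    {L L' : HomologicalComplex₂ V (ComplexShape.up ℕ) (ComplexShape.up ℤ)}
    [L.HasTotal (ComplexShape.up ℤ)] [L'.HasTotal (ComplexShape.up ℤ)] (φ : L ⟶ L')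
    (q : ℕ) (p n : ℤ) (h : (q : ℤ) + p = n) :
    (HomologicalComplex₂.total.map φ (ComplexShape.up ℤ)).f n ≫ L'.πTotal q p n h =
      L.πTotal q p n h ≫ (φ.f q).f p := by
  refine HomologicalComplex₂.total.hom_ext _ fun q' p' (h' : (q' : ℤ) + p' = n) => ?_
  rw [← Category.assoc, ← Category.assoc, HomologicalComplex₂.ιTotal_map, Category.assoc]
  by_cases hq : q' = q
  · subst hq
    obtain rfl : p' = p := by omega
    rw [ιTotal_πTotal_self, ιTotal_πTotal_self, Category.comp_id, Category.id_comp]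
  · rw [ιTotal_πTotal_ne _ _ _ _ _ _ _ _ hq, ιTotal_πTotal_ne _ _ _ _ _ _ _ _ hq, comp_zero,
      zero_comp]

theorem isZero_functor_obj_X {C V : Type*} [Category* C] [Category* V] [HasZeroMorphisms C]
    [Preadditive V] (F : C ⥤ CochainComplex V ℕ) [F.PreservesZeroMorphisms] {M : C}
    (hM : IsZero M) (q : ℕ) : IsZero ((F.obj M).X q) := by
  refine (IsZero.iff_id_eq_zero _).2 ?_
  have h : F.map (𝟙 M) = 0 := by rw [hM.eq_of_src (𝟙 M) 0, F.map_zero]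
  rw [F.map_id] at h
  exact congrArg (fun g : F.obj M ⟶ F.obj M => g.f q) h

theorem CategoryTheory.Functor.map_apply_eq_of_comp_eq {R : Type u} [CommRing R] {V : Type*}
    [Category* V] (E : V ⥤ ModuleCat.{u} R) {A B B' C : V} {f : A ⟶ B} {g : B ⟶ C} {f' : A ⟶ B'}
    {g' : B' ⟶ C} (h : f ≫ g = f' ≫ g') (x : E.obj A) :
    E.map g (E.map f x) = E.map g' (E.map f' x) := by
  have e := congrArg (fun k => E.map k x) h
  simp only [E.map_comp] at e
  exact e

/-! ### From single objects to bounded below complexes -/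

section TotalExtension

variable {R : Type u} [CommRing R]
  {C V : Type*} [Category* C] [Category* V] [HasZeroMorphisms C] [Preadditive V]
  [∀ L : HomologicalComplex₂ V (ComplexShape.up ℕ) (ComplexShape.up ℤ),
    L.HasTotal (ComplexShape.up ℤ)]
  (E : V ⥤ ModuleCat.{u} R) [E.Additive]

/-- The double complex with terms `F^q(M^p)`. -/
abbrev doubleComplex (F : C ⥤ CochainComplex V ℕ) [F.PreservesZeroMorphisms]
    (M : CochainComplex C ℤ) : HomologicalComplex₂ V (ComplexShape.up ℕ) (ComplexShape.up ℤ) :=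
  HomologicalComplex₂.flip ((F.mapHomologicalComplex (ComplexShape.up ℤ)).obj M)

/-- The description of the extension of `F` to bounded below complexes as a direct sum. -/
def totalExtensionDecomposition (F : C ⥤ CochainComplex V ℕ) [F.PreservesZeroMorphisms]
    (M : CochainComplex C ℤ) (b : ℤ) (hb : ∀ p < b, IsZero (M.X p)) :
    TotalDecomposition ((E.mapHomologicalComplex (ComplexShape.up ℤ)).obj
      ((totalExtension F).obj M)) :=
  (doubleComplex F M).totalDecomposition E b fun q p hp => isZero_functor_obj_X F (hb p hp) q

/-- The functor `E` is evaluation at an open set in the applications; the quasi-isomorphism is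
needed only after applying it. The column of index `p` is then the complex `E F(M^p)`. -/
theorem quasiIso_totalExtensionMap {F F' : C ⥤ CochainComplex V ℕ} [F.PreservesZeroMorphisms]
    [F'.PreservesZeroMorphisms] (τ : F ⟶ F') (M : CochainComplex C ℤ) (b : ℤ)
    (hb : ∀ p < b, IsZero (M.X p))
    (hτ : ∀ p, QuasiIso ((E.mapHomologicalComplex (ComplexShape.up ℕ)).map (τ.app (M.X p)))) :
    QuasiIso ((E.mapHomologicalComplex (ComplexShape.up ℤ)).map ((totalExtensionMap τ).app M)) := by
  refine TotalDecomposition.quasiIso_of_columns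
    (D := totalExtensionDecomposition E F M b hb) (D' := totalExtensionDecomposition E F' M b hb) _
    (fun q p => (E.map ((τ.app (M.X p)).f q)).hom) ?_ ?_ ?_ ?_
  · intro q p n h x
    exact E.map_apply_eq_of_comp_eq (HomologicalComplex₂.total_map_πTotal
      ((HomologicalComplex₂.flipFunctor V (ComplexShape.up ℤ) (ComplexShape.up ℕ)).map
        ((NatTrans.mapHomologicalComplex τ (ComplexShape.up ℤ)).app M)) q p n h) x
  · intro p x hx hx'
    exact ((CochainComplex.quasiIsoAt_zero_iff_of_moduleCat
      ((E.mapHomologicalComplex (ComplexShape.up ℕ)).map (τ.app (M.X p)))).1 inferInstance).1 x hx hx'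
  · intro p x y hx hxy
    exact CochainComplex.exists_of_quasiIso_one
      ((E.mapHomologicalComplex (ComplexShape.up ℕ)).map (τ.app (M.X p))) x y hx hxy
  · intro q p x y hx hxy
    exact CochainComplex.exists_of_quasiIso_add_two
      ((E.mapHomologicalComplex (ComplexShape.up ℕ)).map (τ.app (M.X p))) q x y hx hxy

/-- The conditions express exactness of `E G(M^p) → E F^0(M^p) → E F^1(M^p) → ⋯` for every `p`. -/
theorem quasiIso_totalAugmentation {F : C ⥤ CochainComplex V ℕ} [F.PreservesZeroMorphisms]
    {G : C ⥤ V} [G.PreservesZeroMorphisms]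
    (η : G ⟶ F ⋙ HomologicalComplex.eval V (ComplexShape.up ℕ) 0)
    (hη : ∀ M, η.app M ≫ (F.obj M).d 0 1 = 0) (M : CochainComplex C ℤ) (b : ℤ)
    (hb : ∀ p < b, IsZero (M.X p))
    (h₀ : ∀ p (x : E.obj (G.obj (M.X p))), E.map (η.app (M.X p)) x = 0 → x = 0)
    (h₁ : ∀ p (y : E.obj ((F.obj (M.X p)).X 0)), E.map ((F.obj (M.X p)).d 0 1) y = 0 →
      ∃ x : E.obj (G.obj (M.X p)), E.map (η.app (M.X p)) x = y)
    (h₂ : ∀ q p (y : E.obj ((F.obj (M.X p)).X (q + 1))),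
      E.map ((F.obj (M.X p)).d (q + 1) (q + 2)) y = 0 →
      ∃ z, E.map ((F.obj (M.X p)).d q (q + 1)) z = y) :
    QuasiIso ((E.mapHomologicalComplex (ComplexShape.up ℤ)).map
      ((totalAugmentation η hη).app M)) := by
  refine TotalDecomposition.quasiIso_of_augmentation
    (D := totalExtensionDecomposition E F M b hb) _ ?_ (fun p => (E.map (η.app (M.X p))).hom)
    ?_ h₀ h₁ h₂
  · intro p hp x
    have e : E.map (G.map (𝟙 (M.X p))) = 0 := by
      rw [(hb p hp).eq_of_src (𝟙 _) 0, G.map_zero, E.map_zero]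
    rw [G.map_id, E.map_id] at e
    exact congrArg (fun f : E.obj (G.obj (M.X p)) ⟶ E.obj (G.obj (M.X p)) => f x) e
  · intro p x
    exact congrArg (fun f : E.obj (G.obj (M.X p)) ⟶ E.obj (((totalExtension F).obj M).X p) => f x)
      (E.map_comp _ _)

end TotalExtension

/-! ### Integration is a quasi-isomorphism on sections -/

section SectionwiseIntegral

variable {K : Type u} [Field K] [CharZero K] {X : TopCat.{u}} [NoetherianSpace X]
  {m : ℕ} (U : Fin (m + 1) → Opens X)

theorem quasiIso_cechIntegral_app (M : CompleteDirInvSheaf K X) (V : Opens X) :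
    QuasiIso ((((evaluation (Opens X)ᵒᵖ (ModuleCat.{u} K)).obj (op V)).mapHomologicalComplex
      (ComplexShape.up ℕ)).map ((cechIntegral U).app M)) :=
  quasiIso_integral (cech_equalsCompletion U M.property (op V))

theorem quasiIso_totalIntegral_app (M : CochainComplex (CompleteDirInvSheaf K X) ℤ)
    (hM : ∃ n, ∀ p < n, IsZero (M.X p)) (V : Opens X) :
    QuasiIso ((((evaluation (Opens X)ᵒᵖ (ModuleCat.{u} K)).obj (op V)).mapHomologicalComplex
      (ComplexShape.up ℤ)).map ((totalIntegral U).app M)) := by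
  obtain ⟨b, hb⟩ := hM
  exact quasiIso_totalExtensionMap _ _ M b hb fun p => quasiIso_cechIntegral_app U (M.X p) V

end SectionwiseIntegral

/-! ### The Čech complex over a member of the covering -/

section Insertion

variable {m : ℕ} (v : Fin (m + 1))

/-- Since `β` is monotone, the indices with value below `v` form an initial segment. The position
lies before the first vertex that is at least `v`, or at the end if there is none. -/
theorem SimplexCategory.exists_insertPos {q : ℕ} (β : ⦋q⦌ ⟶ ⦋m⦌) :
    ∃ p : Fin (q + 2), ∀ a : Fin (q + 1), β.toOrderHom a < v ↔ a.castSucc < p := by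
  classical
  by_cases h : ∃ a : Fin (q + 1), v ≤ β.toOrderHom a
  · obtain ⟨a, ha, hmin⟩ := (Finset.univ.filter fun a : Fin (q + 1) => v ≤ β.toOrderHom a).exists_min_image
      id ⟨h.choose, by simpa using h.choose_spec⟩
    refine ⟨a.castSucc, fun b => ⟨fun hb => ?_, fun hb => ?_⟩⟩
    · by_contra hab
      have hab' : a ≤ b := not_lt.1 fun h => hab (Fin.castSucc_lt_castSucc_iff.2 h)
      have h1 : v ≤ β.toOrderHom a := by simpa using ha
      exact absurd (h1.trans (β.toOrderHom.monotone hab')) hb.not_ge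
    · by_contra hb'
      exact absurd (hmin b (by simpa using hb')) (not_le.2 (Fin.castSucc_lt_castSucc_iff.1 hb))
  · push Not at h
    exact ⟨Fin.last _, fun a => ⟨fun _ => Fin.castSucc_lt_last a, fun _ => h a⟩⟩

/-- The position at which the vertex `v` is inserted into the simplex `β`. -/
def SimplexCategory.insertPos {q : ℕ} (β : ⦋q⦌ ⟶ ⦋m⦌) : Fin (q + 2) :=
  (SimplexCategory.exists_insertPos v β).choose

theorem SimplexCategory.lt_insertPos {q : ℕ} (β : ⦋q⦌ ⟶ ⦋m⦌) (a : Fin (q + 1)) :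
    β.toOrderHom a < v ↔ a.castSucc < insertPos v β :=
  (SimplexCategory.exists_insertPos v β).choose_spec a

theorem SimplexCategory.insertPos_unique {q : ℕ} (β : ⦋q⦌ ⟶ ⦋m⦌) (p : Fin (q + 2))
    (hp : ∀ a : Fin (q + 1), β.toOrderHom a < v ↔ a.castSucc < p) : insertPos v β = p := by
  have key : ∀ a : Fin (q + 1), a.castSucc < insertPos v β ↔ a.castSucc < p :=
    fun a => (lt_insertPos v β a).symm.trans (hp a)
  rcases lt_trichotomy (insertPos v β) p with h | h | h
  · have hlt : (insertPos v β : ℕ) < q + 1 := by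
      have := p.isLt; have := Fin.lt_def.1 h; omega
    exact absurd ((key ⟨_, hlt⟩).2 h) (lt_irrefl _)
  · exact h
  · have hlt : (p : ℕ) < q + 1 := by
      have := (insertPos v β).isLt; have := Fin.lt_def.1 h; omega
    exact absurd ((key ⟨_, hlt⟩).1 h) (lt_irrefl _)

theorem SimplexCategory.insertVertex_monotone {q : ℕ} (β : ⦋q⦌ ⟶ ⦋m⦌) :
    Monotone ((insertPos v β).insertNth (α := fun _ => Fin (m + 1)) v β.toOrderHom) := by
  intro x y hxy
  have hv : ∀ a : Fin (q + 1), a.castSucc < insertPos v β ↔ β.toOrderHom a < v :=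
    fun a => (lt_insertPos v β a).symm
  rcases Fin.eq_self_or_eq_succAbove (insertPos v β) x with rfl | ⟨a, rfl⟩ <;>
    rcases Fin.eq_self_or_eq_succAbove (insertPos v β) y with rfl | ⟨b, rfl⟩
  · rfl
  · simp only [Fin.insertNth_apply_same, Fin.insertNth_apply_succAbove]
    by_contra h
    have h1 := (lt_insertPos v β b).1 (not_le.1 h)
    rw [Fin.succAbove_of_castSucc_lt _ _ h1] at hxy
    exact absurd hxy (not_le.2 h1)
  · simp only [Fin.insertNth_apply_same, Fin.insertNth_apply_succAbove]
    by_contra h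
    have h1 : ¬ a.castSucc < insertPos v β := fun h' =>
      h ((lt_insertPos v β a).2 h').le
    rw [Fin.succAbove_of_le_castSucc _ _ (not_lt.1 h1)] at hxy
    have h2 := not_lt.1 h1
    rw [Fin.le_def] at hxy h2
    simp at hxy h2
    omega
  · simp only [Fin.insertNth_apply_succAbove]
    exact β.toOrderHom.monotone ((Fin.strictMono_succAbove _).le_iff_le.1 hxy)

/-- The simplex `β` with the vertex `v` inserted. -/
def SimplexCategory.insertVertex {q : ℕ} (β : ⦋q⦌ ⟶ ⦋m⦌) : ⦋q + 1⦌ ⟶ ⦋m⦌ :=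
  SimplexCategory.Hom.mk ⟨_, insertVertex_monotone v β⟩

theorem SimplexCategory.insertVertex_insertPos {q : ℕ} (β : ⦋q⦌ ⟶ ⦋m⦌) :
    (insertVertex v β).toOrderHom (insertPos v β) = v :=
  Fin.insertNth_apply_same (α := fun _ => Fin (m + 1)) _ _ _

theorem SimplexCategory.insertVertex_succAbove {q : ℕ} (β : ⦋q⦌ ⟶ ⦋m⦌) (a : Fin (q + 1)) :
    (insertVertex v β).toOrderHom ((insertPos v β).succAbove a) = β.toOrderHom a :=
  Fin.insertNth_apply_succAbove (α := fun _ => Fin (m + 1)) _ _ _ _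

theorem SimplexCategory.δ_insertPos {q : ℕ} (β : ⦋q⦌ ⟶ ⦋m⦌) :
    SimplexCategory.δ (insertPos v β) ≫ insertVertex v β = β :=
  SimplexCategory.Hom.ext _ _ (OrderHom.ext _ _ (funext fun a => insertVertex_succAbove v β a))

/-- Deleting a vertex below `v` lowers the insertion position by one; deleting any other vertex does
not change it. -/
theorem SimplexCategory.insertPos_δ {q : ℕ} (β : ⦋q + 1⦌ ⟶ ⦋m⦌) (j : Fin (q + 2)) :
    insertPos v (SimplexCategory.δ j ≫ β) = j.predAbove (insertPos v β) := by
  refine insertPos_unique v _ _ fun a => ?_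
  refine (lt_insertPos v β (j.succAbove a)).trans ?_
  generalize insertPos v β = p
  rcases lt_or_ge j.castSucc p with h | h
  · have h0 : (j : ℕ) < p := h
    rw [Fin.predAbove_of_castSucc_lt _ _ h]
    rcases lt_or_ge a.castSucc j with h' | h'
    · rw [Fin.succAbove_of_castSucc_lt _ _ h']
      simp only [Fin.lt_def, Fin.val_castSucc, Fin.val_pred] at *
      omega
    · rw [Fin.succAbove_of_le_castSucc _ _ h']
      simp only [Fin.lt_def, Fin.le_def, Fin.val_castSucc, Fin.val_pred, Fin.val_succ] at *
      omega
  · have h0 : (p : ℕ) ≤ j := h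
    rw [Fin.predAbove_of_le_castSucc _ _ h]
    rcases lt_or_ge a.castSucc j with h' | h'
    · rw [Fin.succAbove_of_castSucc_lt _ _ h']
      simp only [Fin.lt_def, Fin.val_castSucc, Fin.coe_castPred] at *
    · rw [Fin.succAbove_of_le_castSucc _ _ h']
      simp only [Fin.lt_def, Fin.le_def, Fin.val_castSucc, Fin.coe_castPred, Fin.val_succ] at *
      omega

/-- Deleting an old vertex commutes with inserting `v`. This is what makes insertion a contracting
homotopy. -/
theorem SimplexCategory.insertVertex_δ {q : ℕ} (β : ⦋q + 1⦌ ⟶ ⦋m⦌) (j : Fin (q + 2)) :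
    SimplexCategory.δ ((insertPos v β).succAbove j) ≫ insertVertex v β =
      insertVertex v (SimplexCategory.δ j ≫ β) := by
  refine SimplexCategory.Hom.ext _ _ (OrderHom.ext _ _ (funext fun a => ?_))
  change (insertVertex v β).toOrderHom (((insertPos v β).succAbove j).succAbove a) = _
  rcases Fin.eq_self_or_eq_succAbove (insertPos v (SimplexCategory.δ j ≫ β)) a with rfl | ⟨a, rfl⟩
  · rw [insertVertex_insertPos, insertPos_δ, Fin.succAbove_succAbove_predAbove, insertVertex_insertPos]
  · rw [insertVertex_succAbove, insertPos_δ, Fin.succAbove_succAbove_succAbove_predAbove,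
      insertVertex_succAbove]
    rfl

theorem SimplexCategory.injective_of_injective_insertVertex {q : ℕ} (β : ⦋q⦌ ⟶ ⦋m⦌)
    (h : Function.Injective (insertVertex v β).toOrderHom) : Function.Injective β.toOrderHom := by
  intro a b hab
  rw [← insertVertex_succAbove v β, ← insertVertex_succAbove v β] at hab
  exact Fin.succAbove_right_injective (h hab)

end Insertion

/-! ### Čech cochains of a presheaf and their contraction -/

section CechContraction

open SimplexCategory

variable {K : Type u} [Field K] {X : TopCat.{u}} {m : ℕ} {U : Fin (m + 1) → Opens X}

variable (U) in
/-- Families of sections of a presheaf over the intersections of members of a covering. -/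
abbrev CechFamily (P : ModPsh K X) (V : Opens X) (n : SimplexCategory) : Type u :=
  ∀ β : n ⟶ ⦋m⦌, P.obj (op (V ⊓ cechOpen U β))

variable {P : ModPsh K X} {V : Opens X}

/-- Sections indexed by equal simplices live in different types, so they are compared after
restriction to a common open set. -/
theorem cech_res_congr {n : SimplexCategory} (c : CechFamily U P V n) {γ γ' : n ⟶ ⦋m⦌} (h : γ = γ')
    {W : Opens X} (hW : W ≤ V ⊓ cechOpen U γ) (hW' : W ≤ V ⊓ cechOpen U γ') :
    P.res hW (c γ) = P.res hW' (c γ') := by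
  subst h; rfl

/-- The Čech differential. -/
def cechDiff {q : ℕ} (c : CechFamily U P V ⦋q⦌) : CechFamily U P V ⦋q + 1⦌ := fun β =>
  ∑ i : Fin (q + 2), (-1 : ℤ) ^ (i : ℕ) •
    P.res (inf_le_inf_left V (cechOpen_comp U (SimplexCategory.δ i) β))
      (c (SimplexCategory.δ i ≫ β))

theorem cechOpen_σ {q : ℕ} (i : Fin (q + 1)) (β : ⦋q⦌ ⟶ ⦋m⦌) :
    cechOpen U (SimplexCategory.σ i ≫ β) ≤ cechOpen U β := by
  refine (cechOpen_comp U (SimplexCategory.δ i.castSucc) (SimplexCategory.σ i ≫ β)).trans_eq ?_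
  rw [← Category.assoc, SimplexCategory.δ_comp_σ_self, Category.id_comp]

/-- A degenerate simplex has the same set of vertices, hence the same intersection of members of the
covering, so this restriction loses nothing. -/
theorem cech_eq_zero_of_res_σ {q : ℕ} (c : CechFamily U P V ⦋q + 1⦌) (i : Fin (q + 1))
    (β : ⦋q⦌ ⟶ ⦋m⦌) (h : P.res (inf_le_inf_left V (cechOpen_comp U (SimplexCategory.σ i) β))
      (c (SimplexCategory.σ i ≫ β)) = 0) : c (SimplexCategory.σ i ≫ β) = 0 := by
  have := congrArg (P.res (inf_le_inf_left V (cechOpen_σ (U := U) i β))) h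
  rwa [P.res_res, map_zero, P.res_self] at this

variable {v : Fin (m + 1)} (hV : V ≤ U v)

/-- Because `V ⊆ U v`, intersecting with `U v` does not shrink `V ∩ U_β`. This allows the
contraction to be defined without extending sections. -/
theorem le_cechOpen_insertVertex (hV : V ≤ U v) {q : ℕ} (β : ⦋q⦌ ⟶ ⦋m⦌) :
    V ⊓ cechOpen U β ≤ V ⊓ cechOpen U (insertVertex v β) := by
  refine le_inf inf_le_left (le_iInf fun a => ?_)
  rcases Fin.eq_self_or_eq_succAbove (insertPos v β) a with rfl | ⟨a, rfl⟩
  · rw [insertVertex_insertPos]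
    exact inf_le_left.trans hV
  · rw [insertVertex_succAbove]
    exact inf_le_right.trans (iInf_le (fun b => U (β.toOrderHom b)) a)

/-- The contracting homotopy of the Čech complex over a subset of `U v`. -/
def cechContract {q : ℕ} (c : CechFamily U P V ⦋q + 1⦌) : CechFamily U P V ⦋q⦌ := fun β =>
  (-1 : ℤ) ^ (insertPos v β : ℕ) • P.res (le_cechOpen_insertVertex hV β) (c (insertVertex v β))

theorem cechContract_eq_zero {q : ℕ} {c : CechFamily U P V ⦋q + 1⦌}
    (hc : ∀ β : ⦋q + 1⦌ ⟶ ⦋m⦌, ¬ Function.Injective β.toOrderHom → c β = 0) (β : ⦋q⦌ ⟶ ⦋m⦌)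
    (hβ : ¬ Function.Injective β.toOrderHom) : cechContract hV c β = 0 := by
  rw [cechContract, hc _ fun h => hβ (injective_of_injective_insertVertex v β h), map_zero, smul_zero]

/-- Evaluate `d c = 0` on `β` with `v` inserted: the face that omits `v` gives `c β`, and up to sign
the other faces are the terms of the differential of the contraction at `β`. -/
theorem cechDiff_cechContract {q : ℕ} (c : CechFamily U P V ⦋q + 1⦌) (hc : cechDiff c = 0) :
    cechDiff (cechContract hV c) = c := by
  funext β
  have h1 := congrArg (P.res (le_cechOpen_insertVertex hV β)) (congrFun hc (insertVertex v β))
  rw [cechDiff, map_sum, Fin.sum_univ_succAbove _ (insertPos v β), Pi.zero_apply, map_zero] at h1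
  simp only [map_zsmul, P.res_res] at h1
  rw [cech_res_congr c (δ_insertPos v β) _ le_rfl, P.res_self] at h1
  have h2 := congrArg ((-1 : ℤ) ^ (insertPos v β : ℕ) • ·) h1
  have hs : (-1 : ℤ) ^ (insertPos v β : ℕ) * (-1 : ℤ) ^ (insertPos v β : ℕ) = 1 := by
    rw [← mul_pow]; simp
  simp only [smul_add, smul_smul, Finset.smul_sum, hs, one_smul, smul_zero] at h2
  rw [eq_neg_of_add_eq_zero_left h2, ← Finset.sum_neg_distrib, cechDiff]
  refine Finset.sum_congr rfl fun j _ => ?_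
  rw [cechContract, map_zsmul, P.res_res, smul_smul, ← neg_smul]
  refine congrArg₂ (· • ·) ?_ (cech_res_congr c (insertVertex_δ v β j).symm _ _)
  -- The sums of indices `p + j` and `p.succAbove j + j.predAbove p` have opposite parity; this is
  -- the sign by which insertion and deletion of vertices anticommute.
  have e := Fin.neg_one_pow_succAbove_add_predAbove (R := ℤ) (insertPos v β) j
  rw [← insertPos_δ, pow_add, pow_add] at e
  have hs' : (-1 : ℤ) ^ ((insertPos v β).succAbove j : ℕ) *
      (-1 : ℤ) ^ ((insertPos v β).succAbove j : ℕ) = 1 := by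
    rw [← mul_pow]; simp
  have hs'' : (-1 : ℤ) ^ (j : ℕ) * (-1 : ℤ) ^ (j : ℕ) = 1 := by
    rw [← mul_pow]; simp
  generalize (-1 : ℤ) ^ ((insertPos v β).succAbove j : ℕ) = s at *
  generalize (-1 : ℤ) ^ (insertPos v (SimplexCategory.δ j ≫ β) : ℕ) = t at *
  generalize (-1 : ℤ) ^ (insertPos v β : ℕ) = p at *
  generalize (-1 : ℤ) ^ (j : ℕ) = r at *
  linear_combination (s * r) * e - (r * t) * hs' - (p * s) * hs''

/-- The cocycle condition on the edge joining `v` and the vertex `β` identifies `c β` with the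
restriction of the section `c v`, which is defined on all of `V` because `V ⊆ U v`. -/
theorem cech_eq_res_of_cechDiff_eq_zero (c : CechFamily U P V ⦋0⦌) (hc : cechDiff c = 0)
    (hγ : V ≤ V ⊓ cechOpen U (SimplexCategory.const ⦋0⦌ ⦋m⦌ v)) (β : ⦋0⦌ ⟶ ⦋m⦌) :
    P.res inf_le_left (P.res hγ (c (SimplexCategory.const _ _ v))) = c β := by
  have hV : V ≤ U v := hγ.trans (inf_le_right.trans (iInf_le _ (0 : Fin 1)))
  have h1 := congrArg (P.res (le_cechOpen_insertVertex hV β)) (congrFun hc (insertVertex v β))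
  rw [cechDiff, map_sum, Fin.sum_univ_succAbove _ (insertPos v β), Fin.sum_univ_one, Pi.zero_apply,
    map_zero] at h1
  simp only [map_zsmul, P.res_res] at h1
  have hδ : SimplexCategory.δ ((insertPos v β).succAbove (0 : Fin 1)) ≫ insertVertex v β =
      SimplexCategory.const _ _ v := by
    refine SimplexCategory.Hom.ext _ _ (OrderHom.ext _ _ (funext fun a => ?_))
    have ha : ((insertPos v β).succAbove (0 : Fin 1)).succAbove a = insertPos v β := by
      obtain rfl : a = (0 : Fin 1) := Subsingleton.elim (α := Fin 1) _ _
      generalize insertPos v β = p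
      revert p; decide
    change (insertVertex v β).toOrderHom (((insertPos v β).succAbove (0 : Fin 1)).succAbove a) = v
    rw [ha, insertVertex_insertPos]
  rw [cech_res_congr c (δ_insertPos v β) _ le_rfl, P.res_self,
    cech_res_congr c hδ _ (inf_le_left.trans hγ)] at h1
  rw [P.res_res]
  -- The vertex `v` may come before or after the vertex of `β`; the two orders differ by a global
  -- sign.
  have hs : ∀ p : Fin 2, (-1 : ℤ) ^ (p : ℕ) = 1 ∧ (-1 : ℤ) ^ (p.succAbove (0 : Fin 1) : ℕ) = -1 ∨
      (-1 : ℤ) ^ (p : ℕ) = -1 ∧ (-1 : ℤ) ^ (p.succAbove (0 : Fin 1) : ℕ) = 1 := by decide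
  rcases hs (insertPos v β) with ⟨e1, e2⟩ | ⟨e1, e2⟩
  · rw [e1, e2, one_smul, neg_one_smul, ← sub_eq_add_neg, sub_eq_zero] at h1
    exact h1.symm
  · rw [e1, e2, one_smul, neg_one_smul, add_comm, ← sub_eq_add_neg, sub_eq_zero] at h1
    exact h1

end CechContraction

/-! ### Exactness of the normalized Čech complex inside a member of the covering -/

section NormCech

variable {K : Type u} [Field K] {X : TopCat.{u}} {m : ℕ} (U : Fin (m + 1) → Opens X)
  (M : DirInvSheaf K X) (V : Opens X)

/-- The cosimplicial module of Čech cochains over `V`. -/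
abbrev cechModule : CosimplicialObject (ModuleCat.{u} K) :=
  underlying (((cech U).obj M).obj (op V))

variable {U M V}

theorem cech_objD_eq {q : ℕ} (c : CechFamily U M.psh V ⦋q⦌) :
    AlgebraicTopology.AlternatingCofaceMapComplex.objD (cechModule U M V) q c = cechDiff c := by
  refine (objD_apply (cechModule U M V) q c).trans (funext fun β => ?_)
  have h : ∀ g : Fin (q + 2) → CechFamily U M.psh V ⦋q + 1⦌,
      (∑ i : Fin (q + 2), (-1 : ℤ) ^ (i : ℕ) • g i) β = ∑ i : Fin (q + 2), (-1 : ℤ) ^ (i : ℕ) • g i β := fun g => by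
    rw [Finset.sum_apply]
    rfl
  exact h fun i => (cechModule U M V).δ i c

/-- Codegeneracies restrict to the same intersection, so they lose no information, and a simplex is
degenerate exactly when it is not injective. Normalized cochains are thus those supported on
strictly increasing indices. -/
theorem mem_normSub_cech {q : ℕ} (c : CechFamily U M.psh V ⦋q⦌) :
    c ∈ normSub (cechModule U M V) q ↔
      ∀ β : ⦋q⦌ ⟶ ⦋m⦌, ¬ Function.Injective β.toOrderHom → c β = 0 := by
  cases q with
  | zero =>
    exact ⟨fun _ β hβ => absurd (fun a b _ => Subsingleton.elim (α := Fin 1) a b) hβ,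
      fun _ => trivial⟩
  | succ q =>
    refine (mem_normSub_succ (cechModule U M V)).trans ⟨fun h β hβ => ?_, fun h i => ?_⟩
    · obtain ⟨i, β, rfl⟩ := SimplexCategory.eq_σ_comp_of_not_injective β hβ
      exact cech_eq_zero_of_res_σ c i β (congrFun (h i) β)
    · refine funext fun β => ?_
      refine (congrArg (M.psh.res (inf_le_inf_left V (cechOpen_comp U (SimplexCategory.σ i) β)))
        (h (SimplexCategory.σ i ≫ β) fun hβ => ?_)).trans (map_zero _)
      have hσ : Function.Injective (SimplexCategory.σ i).toOrderHom :=
        Function.Injective.of_comp (f := β.toOrderHom) hβ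
      have := Fintype.card_le_of_injective _ hσ
      simp at this

variable {v : Fin (m + 1)}

theorem exists_normD_eq (hV : V ≤ U v) {q : ℕ} (c : normSub (cechModule U M V) (q + 1))
    (hc : normD (cechModule U M V) (q + 1) c = 0) : ∃ b, normD (cechModule U M V) q b = c := by
  have h0 : cechDiff (U := U) (P := M.psh) (V := V) c.1 = 0 :=
    (cech_objD_eq (U := U) (M := M) (V := V) c.1).symm.trans (congrArg Subtype.val hc)
  refine ⟨⟨cechContract hV (P := M.psh) c.1, (mem_normSub_cech _).2
    (cechContract_eq_zero hV ((mem_normSub_cech _).1 c.2))⟩, Subtype.ext ?_⟩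
  exact (cech_objD_eq _).trans (cechDiff_cechContract hV _ h0)

theorem exists_cechAugmentation_eq (hV : V ≤ U v) (c : normSub (cechModule U M V) 0)
    (hc : normD (cechModule U M V) 0 c = 0) : ∃ s, cechAugmentation U M V ⦋0⦌ s = c.1 := by
  have h0 : cechDiff (U := U) (P := M.psh) (V := V) c.1 = 0 :=
    (cech_objD_eq (U := U) (M := M) (V := V) c.1).symm.trans (congrArg Subtype.val hc)
  exact ⟨_, funext fun β => cech_eq_res_of_cechDiff_eq_zero (v := v) c.1 h0
    (le_inf le_rfl (le_iInf fun _ => hV)) β⟩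

/-- The component at the constant simplex `v` is the section itself, since `V ∩ U v = V`. -/
theorem cechAugmentation_injective (hV : V ≤ U v) (n : SimplexCategory) :
    Function.Injective (cechAugmentation U M V n) := by
  intro s t h
  let γ : n ⟶ ⦋m⦌ := SimplexCategory.const _ _ v
  have hγ : V ≤ V ⊓ cechOpen U γ := le_inf le_rfl (le_iInf fun _ => hV)
  have h1 : M.psh.res inf_le_left s = M.psh.res inf_le_left t := congrFun h γ
  have h2 := congrArg (M.psh.res hγ) h1
  rwa [M.psh.res_res, M.psh.res_res, M.psh.res_self, M.psh.res_self] at h2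

end NormCech

/-! ### The Thom–Sullivan complex resolves sections inside a member of the covering -/

section SectionwiseUnit

variable {K : Type u} [Field K]

theorem normFunctor_d_apply (B : CosimplicialObject (ModuleCat.{u} K)) (q : ℕ) (x : normSub B q) :
    ((normFunctor K).obj B).d q (q + 1) x = normD B q x := by
  have h : ((normFunctor K).obj B).d q (q + 1) = ModuleCat.ofHom (normD B q) := by
    simp only [normFunctor, normComplex]
    exact CochainComplex.of_d _ _ q
  rw [h]
  rfl

theorem tsFunctor_d_apply (B : CosimplicialObject (DirInvMod K)) (q : ℕ) (x : tsSub B q) :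
    ((tsFunctor K).obj B).d q (q + 1) x = tsD B q x := by
  have h : ((tsFunctor K).obj B).d q (q + 1) = ModuleCat.ofHom (tsD B q) := by
    simp only [tsFunctor, tsComplex]
    exact CochainComplex.of_d _ _ q
  rw [h]
  rfl

variable [CharZero K]

/-- Integration turns the Thom–Sullivan augmentation into the ordinary one, so exactness for the
ordinary one can be transferred. -/
theorem integralAux_tsUnit {B : CosimplicialObject (DirInvMod K)}
    (hB : ∀ n, (B.obj n).EqualsCompletion)
    {A : Type u} [AddCommGroup A] [Module K A] (e : ∀ n, A →ₗ[K] B.obj n)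
    (he : ∀ {k l : SimplexCategory} (α : k ⟶ l) (a : A), (B.map α).lin (e k a) = e l a) (a : A) :
    (integralAux hB 0 (tsUnit hB e he a)).1 = e ⦋0⦌ a := by
  change DirInvMod.cfunctional (hB ⦋0⦌) (OmInt K 0)
    (DirInvMod.cmk (hB ⦋0⦌) (OmOne K ⦋0⦌) (e ⦋0⦌ a)) = _
  rw [DirInvMod.cfunctional_cmk, OmInt_OmOne, one_smul]

section

variable {B : CosimplicialObject (DirInvMod K)} (hB : ∀ n, (B.obj n).EqualsCompletion)
  {A : Type u} [AddCommGroup A] [Module K A] (e : ∀ n, A →ₗ[K] B.obj n)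
  (he : ∀ {k l : SimplexCategory} (α : k ⟶ l) (a : A), (B.map α).lin (e k a) = e l a)

theorem eq_zero_of_tsUnit_eq_zero (h : Function.Injective (e ⦋0⦌)) (a : A)
    (ha : tsUnit hB e he a = 0) : a = 0 := by
  refine h ?_
  rw [← integralAux_tsUnit hB e he a, ha, map_zero, map_zero]
  rfl

/-- The integral of a closed `y` is a cocycle, hence some `e a`. Then `y` minus the unit of `a` is
closed with integral zero, and it vanishes because `∫_Δ` is injective on cohomology in degree `0`.
-/
theorem exists_tsUnit_eq
    (h : ∀ c : normSub (underlying B) 0, normD (underlying B) 0 c = 0 → ∃ a, e ⦋0⦌ a = c.1)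
    (y : tsSub B 0) (hy : tsD B 0 y = 0) : ∃ a, tsUnit hB e he a = y := by
  have := quasiIso_integral hB
  obtain ⟨a, ha⟩ := h (integralAux hB 0 y) (by rw [← integralAux_tsD, hy, map_zero])
  refine ⟨a, (sub_eq_zero.1 (((CochainComplex.quasiIsoAt_zero_iff_of_moduleCat
    (integral hB)).1 inferInstance).1 (y - tsUnit hB e he a) ?_ ?_)).symm⟩
  · refine (tsFunctor_d_apply _ 0 _).trans ?_
    rw [map_sub, hy, tsD_tsUnit, sub_zero]
    rfl
  · refine (map_sub (integralAux hB 0) _ _).trans (sub_eq_zero.2 (Subtype.ext ?_))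
    exact ha.symm.trans (integralAux_tsUnit hB e he a).symm

/-- The integral of a closed `y` is a coboundary by hypothesis, and `∫_Δ` is injective on
cohomology. -/
theorem exists_tsD_eq (hB : ∀ n, (B.obj n).EqualsCompletion) (q : ℕ)
    (h : ∀ c : normSub (underlying B) (q + 1), normD (underlying B) (q + 1) c = 0 →
      ∃ b, normD (underlying B) q b = c)
    (y : tsSub B (q + 1)) (hy : tsD B (q + 1) y = 0) : ∃ z, tsD B q z = y := by
  have := quasiIso_integral hB
  obtain ⟨c, hc⟩ := h (integralAux hB (q + 1) y) (by rw [← integralAux_tsD, hy, map_zero])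
  obtain ⟨z, hz⟩ := ((CochainComplex.quasiIsoAt_succ_iff_of_moduleCat
    (integral hB) q).1 inferInstance).1 y ((tsFunctor_d_apply _ (q + 1) _).trans hy)
    ⟨c, (normFunctor_d_apply _ q c).trans hc⟩
  exact ⟨z, (tsFunctor_d_apply _ q _).symm.trans hz⟩

end

variable {X : TopCat.{u}} [NoetherianSpace X] {m : ℕ} (U : Fin (m + 1) → Opens X)

theorem quasiIso_totalUnit_app (M : CochainComplex (CompleteDirInvSheaf K X) ℤ)
    (hM : ∃ n, ∀ p < n, IsZero (M.X p)) {V : Opens X} {v : Fin (m + 1)} (hV : V ≤ U v) :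
    QuasiIso ((((evaluation (Opens X)ᵒᵖ (ModuleCat.{u} K)).obj (op V)).mapHomologicalComplex
      (ComplexShape.up ℤ)).map ((totalUnit U).app M)) := by
  obtain ⟨b, hb⟩ := hM
  refine quasiIso_totalAugmentation _ (commCechUnit U) (commCechUnit_d U) M b hb ?_ ?_ ?_
  · intro p s hs
    exact eq_zero_of_tsUnit_eq_zero (cech_equalsCompletion U (M.X p).property (op V)) _
      (cech_map_augmentation U (M.X p).obj (op V))
      (cechAugmentation_injective (M := (M.X p).obj) hV ⦋0⦌) s hs
  · intro p y hy
    exact exists_tsUnit_eq (cech_equalsCompletion U (M.X p).property (op V)) _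
      (cech_map_augmentation U (M.X p).obj (op V))
      (exists_cechAugmentation_eq (M := (M.X p).obj) hV) y
      ((tsFunctor_d_apply (((cech U).obj (M.X p).obj).obj (op V)) 0 y).symm.trans hy)
  · intro q p y hy
    obtain ⟨z, hz⟩ := exists_tsD_eq (cech_equalsCompletion U (M.X p).property (op V)) q
      (exists_normD_eq (M := (M.X p).obj) hV) y
      ((tsFunctor_d_apply (((cech U).obj (M.X p).obj).obj (op V)) (q + 1) y).symm.trans hy)
    exact ⟨z, (tsFunctor_d_apply (((cech U).obj (M.X p).obj).obj (op V)) q z).trans hz⟩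

end SectionwiseUnit

/-! ### Coordinates in completed tensor products -/

namespace DirInvMod

variable {K : Type u} [Field K] {A : Type u} [AddCommGroup A] [Module K A] {M : DirInvMod K}
  {I : Type u} (b : Module.Basis I K A)

/-- Every sequence that is Cauchy in `F j` converges in `F j`. -/
def ConvergesStrictly (M : DirInvMod K) : Prop :=
  ∀ (j : M.J) (x : ℕ → M), (∀ n, x n ∈ M.F j) → (∀ k, ∃ n₀, ∀ n ≥ n₀, x n - x n₀ ∈ M.G j k) →
    ∃ y : M, ∀ k, ∃ n₀, ∀ n ≥ n₀, x n - y ∈ M.G j k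

variable (M) in
/-- The coordinates of an element of `A ⊗ M` with respect to a basis of `A`. -/
def tcoord (i : I) : A ⊗[K] M →ₗ[K] M := (TensorProduct.lid K M).toLinearMap ∘ₗ (b.coord i).rTensor M

theorem tcoord_basis_tmul [DecidableEq I] (i i' : I) (y : M) :
    tcoord M b i (b i' ⊗ₜ y) = if i' = i then y else 0 := by
  simp only [tcoord, LinearMap.comp_apply, LinearMap.rTensor_tmul, LinearEquiv.coe_coe,
    TensorProduct.lid_tmul, Module.Basis.coord_apply, Module.Basis.repr_self, Finsupp.single_apply]
  split_ifs <;> simp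

theorem exists_finset_tcoord (x : A ⊗[K] M) :
    ∃ S : Finset I, (∀ i ∉ S, tcoord M b i x = 0) ∧ x = ∑ i ∈ S, b i ⊗ₜ tcoord M b i x := by
  classical
  obtain ⟨c, rfl⟩ := TensorProduct.eq_repr_basis_left b x
  have h : ∀ i, tcoord M b i (c.sum fun i m => b i ⊗ₜ[K] m) = c i := by
    intro i
    rw [Finsupp.sum, map_sum]
    simp only [tcoord_basis_tmul]
    rw [Finset.sum_ite_eq']
    split_ifs with h
    · rfl
    · exact (Finsupp.notMem_support_iff.1 h).symm
  refine ⟨c.support, fun i hi => (h i).trans (Finsupp.notMem_support_iff.1 hi), ?_⟩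
  simp only [h]
  rfl

/-- Tensoring over a field: membership in `A ⊗ Q` can be tested on the coordinates for a basis of
`A`. -/
theorem mem_map₂_top_iff (Q : Submodule K M) (x : A ⊗[K] M) :
    x ∈ Submodule.map₂ (TensorProduct.mk K A M) ⊤ Q ↔ ∀ i, tcoord M b i x ∈ Q := by
  constructor
  · intro hx i
    have : Submodule.map₂ (TensorProduct.mk K A M) ⊤ Q ≤ Q.comap (tcoord M b i) := by
      refine Submodule.map₂_le.2 fun a _ m hm => ?_
      exact Submodule.smul_mem _ _ hm
    exact this hx
  · intro h
    obtain ⟨S, _, hS⟩ := exists_finset_tcoord b x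
    rw [hS]
    exact Submodule.sum_mem _ fun i _ =>
      Submodule.apply_mem_map₂ (TensorProduct.mk K A M) Submodule.mem_top (h i)

theorem mem_tensor_F_iff (j : M.J) (x : A ⊗[K] M) :
    x ∈ (tensor (discrete (K := K) A) M).F (PUnit.unit, j) ↔ ∀ i, tcoord M b i x ∈ M.F j :=
  mem_map₂_top_iff b _ x

theorem mem_tensor_G_iff (j : M.J) (k : ℕ) (x : A ⊗[K] M) :
    x ∈ (tensor (discrete (K := K) A) M).G (PUnit.unit, j) k ↔ ∀ i, tcoord M b i x ∈ M.G j k := by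
  refine Iff.trans ?_ (mem_map₂_top_iff b _ x)
  change x ∈ Submodule.map₂ (TensorProduct.mk K A M) ⊥ (M.F j) ⊔
    Submodule.map₂ (TensorProduct.mk K A M) ⊤ (M.G j k) ↔ _
  rw [Submodule.map₂_bot_left, bot_sup_eq]

theorem cfunctional_coord_eq_iff (hM : M.EqualsCompletion) (i : I) (x : ℕ → A ⊗[K] M)
    (hx : x ∈ (tensor (discrete (K := K) A) M).cauchy) (y : M) :
    cfunctional hM (b.coord i) (Completion.mk x hx) = y ↔
      (fun n => tcoord M b i (x n) - y) ∈ M.null := by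
  rw [cfunctional_eq_iff, completionMap_mk]
  exact Submodule.Quotient.eq (M.null.comap M.cauchy.subtype)

/-- `EqualsCompletion` alone would give a limit for a larger index that may depend on the coordinate
`i`. Strict convergence keeps the index `j`, which is essential with infinitely many coordinates. -/
theorem coord_converges (hM : M.EqualsCompletion) (hs : M.ConvergesStrictly)
    (x : ℕ → A ⊗[K] M) (hx : x ∈ (tensor (discrete (K := K) A) M).cauchy) (j : M.J)
    (hj : ∀ n i, tcoord M b i (x n) ∈ M.F j)
    (hj' : ∀ k, ∃ n₀, ∀ n ≥ n₀, ∀ i, tcoord M b i (x n) - tcoord M b i (x n₀) ∈ M.G j k)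
    (i : I) (k : ℕ) : ∃ n₀, ∀ n ≥ n₀,
      tcoord M b i (x n) - cfunctional hM (b.coord i) (Completion.mk x hx) ∈ M.G j k := by
  obtain ⟨y, hy⟩ := hs j (fun n => tcoord M b i (x n)) (fun n => hj n i)
    fun k => (hj' k).imp fun n₀ h n hn => h n hn i
  have e : cfunctional hM (b.coord i) (Completion.mk x hx) = y := by
    refine (cfunctional_coord_eq_iff b hM i x hx y).2 ⟨j, fun n => ?_, hy⟩
    obtain ⟨n₀, h⟩ := hy 0
    have hyF : y ∈ M.F j := by
      have := sub_mem (hj n₀ i) (M.G_le j 0 (h n₀ le_rfl))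
      rwa [sub_sub_cancel] at this
    exact sub_mem (hj n i) hyF
  rw [e]
  exact hy k

theorem exists_cauchy_coord (u : CTensor A M) : ∃ (x : ℕ → A ⊗[K] M)
    (hx : x ∈ (tensor (discrete (K := K) A) M).cauchy) (j : M.J), u = Completion.mk x hx ∧
    (∀ n i, tcoord M b i (x n) ∈ M.F j) ∧
    ∀ k, ∃ n₀, ∀ n ≥ n₀, ∀ i, tcoord M b i (x n) - tcoord M b i (x n₀) ∈ M.G j k := by
  induction u using Completion.ind with
  | h x hx =>
    obtain ⟨⟨⟨⟩, j⟩, hj, hj'⟩ := hx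
    refine ⟨x, ⟨(PUnit.unit, j), hj, hj'⟩, j, rfl, fun n => (mem_tensor_F_iff b j _).1 (hj n),
      fun k => (hj' k).imp fun n₀ h n hn i => ?_⟩
    rw [← map_sub]
    exact (mem_tensor_G_iff b j k _).1 (h n hn) i

/-- The Cauchy condition is uniform in the coordinate, so the convergence of the coordinates is
uniform as well. -/
theorem coord_sub_mem (hM : M.EqualsCompletion) (hs : M.ConvergesStrictly)
    (x : ℕ → A ⊗[K] M) (hx : x ∈ (tensor (discrete (K := K) A) M).cauchy) (j : M.J)
    (hj : ∀ n i, tcoord M b i (x n) ∈ M.F j)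
    (hj' : ∀ k, ∃ n₀, ∀ n ≥ n₀, ∀ i, tcoord M b i (x n) - tcoord M b i (x n₀) ∈ M.G j k) (k : ℕ) :
    ∃ n₀, ∀ n ≥ n₀, ∀ i,
      tcoord M b i (x n) - cfunctional hM (b.coord i) (Completion.mk x hx) ∈ M.G j k := by
  obtain ⟨n₀, hn₀⟩ := hj' k
  refine ⟨n₀, fun n hn i => ?_⟩
  obtain ⟨n₁, hn₁⟩ := coord_converges b hM hs x hx j hj hj' i k
  -- The limit is compared through a later term of the sequence that may depend on `i`; the bound
  -- `n₀` does not.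
  have h := sub_mem (hn₀ n hn i) (hn₀ (max n₀ n₁) (le_max_left _ _) i)
  rw [sub_sub_sub_cancel_right] at h
  have := add_mem h (hn₁ (max n₀ n₁) (le_max_right _ _))
  rwa [sub_add_sub_cancel] at this

theorem ctensor_ext_coord (hM : M.EqualsCompletion) (hs : M.ConvergesStrictly) {u v : CTensor A M}
    (h : ∀ i, cfunctional hM (b.coord i) u = cfunctional hM (b.coord i) v) : u = v := by
  rw [← sub_eq_zero]
  replace h : ∀ i, cfunctional hM (b.coord i) (u - v) = 0 := fun i => by rw [map_sub, h, sub_self]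
  generalize u - v = w at h
  obtain ⟨x, hx, j, rfl, hj, hj'⟩ := exists_cauchy_coord b w
  refine (Submodule.Quotient.mk_eq_zero _).2 ?_
  refine ⟨(PUnit.unit, j), fun n => (mem_tensor_F_iff b j _).2 (hj n), fun k => ?_⟩
  obtain ⟨n₀, hn₀⟩ := coord_sub_mem b hM hs x hx j hj hj' k
  refine ⟨n₀, fun n hn => (mem_tensor_G_iff b j k _).2 fun i => ?_⟩
  have := hn₀ n hn i
  rwa [h, sub_zero] at this

/-- A term of the sequence that approximates `u` modulo `G j k` is an ordinary tensor, so it has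
only finitely many nonzero coordinates. -/
theorem exists_coord_bound (hM : M.EqualsCompletion) (hs : M.ConvergesStrictly) (u : CTensor A M) :
    ∃ j, (∀ i, cfunctional hM (b.coord i) u ∈ M.F j) ∧
      ∀ k, {i | cfunctional hM (b.coord i) u ∉ M.G j k}.Finite := by
  obtain ⟨x, hx, j, rfl, hj, hj'⟩ := exists_cauchy_coord b u
  refine ⟨j, fun i => ?_, fun k => ?_⟩
  · obtain ⟨n₀, hn₀⟩ := coord_sub_mem b hM hs x hx j hj hj' 0
    have := sub_mem (hj n₀ i) (M.G_le j 0 (hn₀ n₀ le_rfl i))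
    rwa [sub_sub_cancel] at this
  · obtain ⟨n₀, hn₀⟩ := coord_sub_mem b hM hs x hx j hj hj' k
    obtain ⟨S, hS, _⟩ := exists_finset_tcoord b (x n₀)
    refine S.finite_toSet.subset fun i hi => ?_
    by_contra hiS
    refine hi ?_
    have := hn₀ n₀ le_rfl i
    rw [hS i hiS, zero_sub] at this
    exact neg_mem_iff.1 this

/-- The converse of `exists_coord_bound`. Together with `ctensor_ext_coord` it describes `A ⊗̂ M` as
families of coordinates in one `F j`, tending to zero along the index set of the basis. -/
theorem exists_ctensor_of_coord (hM : M.EqualsCompletion) (y : I → M) (j : M.J)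
    (hj : ∀ i, y i ∈ M.F j) (hj' : ∀ k, {i | y i ∉ M.G j k}.Finite) :
    ∃ u : CTensor A M, ∀ i, cfunctional hM (b.coord i) u = y i := by
  classical
  -- The `n`-th approximation keeps the finitely many coordinates outside `G j n`.
  let x : ℕ → A ⊗[K] M := fun n => ∑ i ∈ (hj' n).toFinset, b i ⊗ₜ y i
  have hcoord : ∀ n i, tcoord M b i (x n) = if y i ∈ M.G j n then 0 else y i := by
    intro n i
    rw [map_sum]
    simp only [tcoord_basis_tmul]
    rw [Finset.sum_ite_eq']
    by_cases h : y i ∈ M.G j n <;> simp [h]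
  have hF : ∀ n i, tcoord M b i (x n) ∈ M.F j := fun n i => by
    rw [hcoord]
    split_ifs
    · exact zero_mem _
    · exact hj i
  have hG : ∀ k n, n ≥ k → ∀ i, tcoord M b i (x n) - y i ∈ M.G j k := fun k n hn i => by
    rw [hcoord]
    split_ifs with h
    · rw [zero_sub]
      exact neg_mem (M.anti j hn h)
    · rw [sub_self]
      exact zero_mem _
  have hx : x ∈ (tensor (discrete (K := K) A) M).cauchy := by
    refine ⟨(PUnit.unit, j), fun n => (mem_tensor_F_iff b j _).2 (hF n), fun k => ⟨k, fun n hn =>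
      (mem_tensor_G_iff b j k _).2 fun i => ?_⟩⟩
    have := sub_mem (hG k n hn i) (hG k k le_rfl i)
    rwa [sub_sub_sub_cancel_right, ← map_sub] at this
  refine ⟨Completion.mk x hx, fun i => (cfunctional_coord_eq_iff b hM i x hx _).2
    ⟨j, fun n => sub_mem (hF n i) (hj i), fun k => ⟨k, fun n hn => hG k n hn i⟩⟩⟩

end DirInvMod

/-! ### Gluing -/

section Gluing

variable {X : TopCat.{u}}

/-- The sheaf condition for a family of types `T V` indexed by open sets, with restriction
maps `r`. -/
structure HasGluing (T : Opens X → Type u) (r : ∀ {V W : Opens X}, V ≤ W → T W → T V) : Prop where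
  sep : ∀ {ι : Type u} {V : Opens X} {W : ι → Opens X} (hW : ∀ i, W i ≤ V)
    (_ : ∀ x ∈ V, ∃ i, x ∈ W i) {t t' : T V}, (∀ i, r (hW i) t = r (hW i) t') → t = t'
  glue : ∀ {ι : Type u} {V : Opens X} {W : ι → Opens X} (hW : ∀ i, W i ≤ V)
    (_ : ∀ x ∈ V, ∃ i, x ∈ W i) (s : ∀ i, T (W i)),
    (∀ i j Z (hi : Z ≤ W i) (hj : Z ≤ W j), r hi (s i) = r hj (s j)) → ∃ t, ∀ i, r (hW i) t = s i

variable {K : Type u} [Field K]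

/-- The form on the right makes sense for types of elements with no presheaf structure attached,
such as completed tensor products. -/
theorem ModPsh.isSheaf_iff_hasGluing (P : ModPsh K X) :
    Presheaf.IsSheaf (Opens.grothendieckTopology X) P ↔
      HasGluing (fun V => P.obj (op V)) fun h s => P.res h s := by
  constructor
  · intro hP
    let F : TopCat.Sheaf (ModuleCat.{u} K) X := ⟨P, hP⟩
    refine ⟨fun {ι V W} hW hc {t t'} h => ?_, fun {ι V W} hW hc s hs => ?_⟩
    · exact F.eq_of_locally_eq' W V (fun i => homOfLE (hW i))
        (fun x hx => Opens.mem_iSup.2 (hc x hx)) t t' h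
    · exact (F.existsUnique_gluing' W V (fun i => homOfLE (hW i))
        (fun x hx => Opens.mem_iSup.2 (hc x hx)) s fun i j => hs i j _ _ _).exists
  · intro hP
    refine (TopCat.Presheaf.isSheaf_iff_isSheafUniqueGluing P).2 fun ι W s hs => ?_
    have hc : ∀ x ∈ iSup W, ∃ i, x ∈ W i := fun x hx => Opens.mem_iSup.1 hx
    obtain ⟨t, ht⟩ := hP.glue (fun i => le_iSup W i) hc s fun i j Z hi hj => by
      have h := congrArg (P.res (le_inf hi hj)) (show P.res inf_le_left (s i) =
        P.res inf_le_right (s j) from hs i j)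
      rwa [P.res_res, P.res_res] at h
    exact ⟨t, ht, fun t' ht' => hP.sep (fun i => le_iSup W i) hc fun i =>
      (ht' i).trans (ht i).symm⟩

/-- A finite direct sum of sheaves is a sheaf. -/
theorem ModPsh.isSheaf_of_sum_eq_id {P : ModPsh K X} {S : Type*} (s : Finset S) {Q : S → ModPsh K X}
    (π : ∀ q, P ⟶ Q q) (ι : ∀ q, Q q ⟶ P) (h : ∑ q ∈ s, π q ≫ ι q = 𝟙 P)
    (hQ : ∀ q, Presheaf.IsSheaf (Opens.grothendieckTopology X) (Q q)) :
    Presheaf.IsSheaf (Opens.grothendieckTopology X) P := by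
  have hid : ∀ (V : Opens X) (t : P.obj (op V)),
      ∑ q ∈ s, (ι q).app (op V) ((π q).app (op V) t) = t := fun V t => by
    have e := congrArg (fun f : P ⟶ P => f.app (op V) t) h
    refine Eq.trans ?_ e
    change _ = (((evaluation _ _).obj (op V)).map (∑ q ∈ s, π q ≫ ι q)) t
    rw [Functor.map_sum]
    refine (Eq.trans (LinearMap.congr_fun (ModuleCat.hom_sum _ _) _) ?_).symm
    exact LinearMap.sum_apply _ _ _
  have hQ' := fun q => (Q q).isSheaf_iff_hasGluing.1 (hQ q)
  refine P.isSheaf_iff_hasGluing.2 ⟨fun {_ V W} hW hc {t t'} ht => ?_, fun {_ V W} hW hc t ht => ?_⟩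
  · rw [← hid V t, ← hid V t']
    refine Finset.sum_congr rfl fun q _ => congrArg _ ((hQ' q).sep hW hc fun i => ?_)
    rw [← ModPsh.res_app, ← ModPsh.res_app, ht]
  · choose w hw using fun q => (hQ' q).glue hW hc (fun i => (π q).app _ (t i))
      fun i j Z hi hj => by rw [← ModPsh.res_app, ← ModPsh.res_app, ht]
    refine ⟨∑ q ∈ s, (ι q).app (op V) (w q), fun i => ?_⟩
    rw [map_sum]
    refine Eq.trans (Finset.sum_congr rfl fun q _ => ?_) (hid _ (t i))
    rw [← ModPsh.res_app, hw]

end Gluing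

/-! ### Gluing in completed tensor products with sections of a complete dir-inv sheaf -/

section CTensorGluing

open DirInvMod

variable {K : Type u} [Field K] {X : TopCat.{u}} {N : DirInvSheaf K X}

theorem DirInvSheaf.hasGluing (N : DirInvSheaf K X) :
    HasGluing (fun V => N.psh.obj (op V)) fun h s => N.psh.res h s :=
  N.psh.isSheaf_iff_hasGluing.1 N.sheaf.property

/-- A subsequence of a Cauchy sequence is a compatible system of sections of the quotients `F j / G
j i`, given on the trivial covering of `V`. Completeness of `F j` provides its limit for the same
index `j`. -/
theorem DirInvSheaf.IsStrictlyComplete.convergesStrictly (hN : N.IsStrictlyComplete) (V : Opens X) :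
    (N.sections V).ConvergesStrictly := by
  intro j x hj hj'
  change ℕ → N.psh.obj (op V) at x
  change ∀ n, x n ∈ (N.F j).sec V at hj
  change ∀ i, ∃ n₀, ∀ n ≥ n₀, x n - x n₀ ∈ (N.G j i).sec V at hj'
  choose n hn using hj'
  have hcomp : ∀ i i', i ≤ i' → x (n i') - x (n i) ∈ (N.G j i).sec V := by
    intro i i' hi
    have h1 := hn i (max (n i) (n i')) (le_max_left _ _)
    have h2 := N.anti j _ _ hi V (hn i' (max (n i) (n i')) (le_max_right _ _))
    have := sub_mem h1 h2
    rwa [sub_sub_sub_cancel_left] at this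
  obtain ⟨t, _, ht'⟩ := (hN.complete j).surj V (fun _ _ => V) (fun _ _ => le_rfl)
    (fun _ x => x.2) (fun i _ => x (n i)) (fun i _ => hj (n i)) (fun i i' hi _ _ => by
      have h := (N.G j i).res_mem (inf_le_left : V ⊓ V ≤ V) (hcomp i i' hi)
      rwa [map_sub] at h)
  have key : ∀ i, t - x (n i) ∈ (N.G j i).sec V := fun i =>
    (N.G j i).mem_of_local V _ fun y hy => ⟨V, le_rfl, hy, by
      have h := ht' i ⟨y, hy⟩
      rw [ModPsh.res_self] at h ⊢
      exact h⟩
  refine ⟨t, fun i => ⟨n i, fun k hk => ?_⟩⟩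
  have := sub_mem (hn i k hk) (key i)
  rwa [sub_sub_sub_cancel_right] at this

variable [NoetherianSpace X] (A : Type u) [AddCommGroup A] [Module K A]

/-- Each coordinate is a section of the sheaf and glues. What must be checked is that the glued
coordinates again lie in one `F j₀` and are almost all in each `G j₀ k`. -/
theorem hasGluing_ctensor (hN : N.IsStrictlyComplete) : HasGluing (fun V => CTensor A (N.sections V))
    fun h u => ctensorMap LinearMap.id (N.res h) u := by
  let b := Module.Basis.ofVectorSpace K A
  let c : ∀ V (_ : Module.Basis.ofVectorSpaceIndex K A), CTensor A (N.sections V) → N.psh.obj (op V) :=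
    fun V i => cfunctional (hN.sections V) (b.coord i)
  have hres : ∀ {V W : Opens X} (h : V ≤ W) i (u : CTensor A (N.sections W)),
      c V i (ctensorMap LinearMap.id (N.res h) u) = N.psh.res h (c W i u) := fun h i u =>
    cfunctional_ctensorMap (hN.sections _) (hN.sections _) LinearMap.id (N.res h) (b.coord i) u
  have hext : ∀ {V} {u v : CTensor A (N.sections V)}, (∀ i, c V i u = c V i v) → u = v := fun h =>
    ctensor_ext_coord b (hN.sections _) (hN.convergesStrictly _) h
  refine ⟨fun {ι V W} hW hc {t t'} h => hext fun i => N.hasGluing.sep hW hc fun w => ?_,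
    fun {ι V W} hW hc s hs => ?_⟩
  · rw [← hres, ← hres, h]
  · choose y hy using fun i => N.hasGluing.glue hW hc (fun w => c (W w) i (s w))
      fun w w' Z hw hw' => by rw [← hres, ← hres, hs]
    choose j hj hj' using fun w => exists_coord_bound b (hN.sections (W w))
      (hN.convergesStrictly (W w)) (s w)
    -- A finite subcovering allows one index `j₀` above all the local indices.
    obtain ⟨S, hS⟩ := (NoetherianSpace.isCompact (V : Set X)).elim_finite_subcover
      (fun w => (W w : Set X)) (fun w => (W w).isOpen)
      (fun x hx => Set.mem_iUnion.2 (hc x hx))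
    classical
    obtain ⟨j₀, hj₀⟩ := Finset.exists_le (S.image j)
    have hS' : ∀ x ∈ V, ∃ w ∈ S, x ∈ W w := fun x hx => by
      obtain ⟨w, hw, hxw⟩ := Set.mem_iUnion₂.1 (hS hx)
      exact ⟨w, hw, hxw⟩
    have hF : ∀ i, y i ∈ (N.F j₀).sec V := fun i => (N.F j₀).mem_of_local V _ fun x hx => by
      obtain ⟨w, hw, hxw⟩ := hS' x hx
      refine ⟨W w, hW w, hxw, ?_⟩
      rw [hy]
      exact N.mono _ _ (hj₀ _ (Finset.mem_image_of_mem j hw)) _ (hj w i)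
    have hG : ∀ k, {i | y i ∉ (N.G j₀ k).sec V}.Finite := fun k => by
      choose k' hk' using fun w : S => N.incl (j w) j₀ (hj₀ _ (Finset.mem_image_of_mem j w.2)) k
      -- A coordinate that is small on every member of the subcovering is small on `V`, so the
      -- exceptional set lies in a finite union of finite sets.
      refine (Set.finite_iUnion fun w : S => hj' w.1 (k' w)).subset fun i hi => ?_
      by_contra hi'
      refine hi ((N.G j₀ k).mem_of_local V _ fun x hx => ?_)
      obtain ⟨w, hw, hxw⟩ := hS' x hx
      refine ⟨W w, hW w, hxw, ?_⟩
      rw [hy]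
      refine hk' ⟨w, hw⟩ _ ?_
      by_contra h
      exact hi' (Set.mem_iUnion.2 ⟨⟨w, hw⟩, h⟩)
    obtain ⟨u, hu⟩ := exists_ctensor_of_coord b (hN.sections V) y j₀ hF hG
    refine ⟨u, fun w => hext fun i => ?_⟩
    rw [hres, ← hy i w]
    exact congrArg (N.psh.res (hW w)) (hu i)

end CTensorGluing

/-! ### The terms of the resolutions are sheaves -/

section ProductGluing

open DirInvMod

variable {K : Type u} [Field K]

namespace DirInvMod

theorem ConvergesStrictly.pi {T : Type} [Finite T] {M : T → DirInvMod K}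
    (hM : ∀ t, (M t).ConvergesStrictly) : (DirInvMod.pi M).ConvergesStrictly := by
  intro j x hj hj'
  choose y hy using fun t => hM t (j t) (fun n => x n t) (fun n => hj n t trivial) fun k =>
    (hj' k).imp fun n₀ h n hn => h n hn t trivial
  refine ⟨y, fun k => ?_⟩
  choose n₀ hn₀ using fun t => hy t k
  obtain ⟨m, hm⟩ := (Set.finite_range n₀).bddAbove
  exact ⟨m, fun n hn t _ => hn₀ t n ((hm ⟨t, rfl⟩).trans hn)⟩

/-- The projection of a finite product onto a factor. -/
def piProj {T : Type} [Finite T] (M : T → DirInvMod K) (t : T) : DirInvMod.pi M ⟶ M t where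
  lin := LinearMap.proj t
  cont j := ⟨j t, fun _ hx => hx t trivial, fun i => ⟨i, fun _ hx => hx t trivial⟩⟩

variable {T : Type} [Finite T] {M : T → DirInvMod K} (A : Type u) [AddCommGroup A] [Module K A]

theorem ctensor_pi_ext (hM : ∀ t, (M t).EqualsCompletion) (hs : ∀ t, (M t).ConvergesStrictly)
    {u v : CTensor A (DirInvMod.pi M)} (h : ∀ t, ctensorMap LinearMap.id (piProj M t) u =
      ctensorMap LinearMap.id (piProj M t) v) : u = v := by
  refine ctensor_ext_coord (Module.Basis.ofVectorSpace K A) (EqualsCompletion.pi hM)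
    (ConvergesStrictly.pi hs) fun i => funext fun t => ?_
  have e := congrArg (cfunctional (hM t) ((Module.Basis.ofVectorSpace K A).coord i)) (h t)
  have e' := fun u => cfunctional_ctensorMap (EqualsCompletion.pi hM) (hM t) LinearMap.id
    (piProj M t) ((Module.Basis.ofVectorSpace K A).coord i) u
  exact (e' u).symm.trans (e.trans (e' v))

/-- Completed tensor products commute with finite products: finitely many local bounds and finite
exceptional sets combine into one. -/
theorem exists_ctensor_pi (hM : ∀ t, (M t).EqualsCompletion) (hs : ∀ t, (M t).ConvergesStrictly)
    (w : ∀ t, CTensor A (M t)) :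
    ∃ u : CTensor A (DirInvMod.pi M), ∀ t, ctensorMap LinearMap.id (piProj M t) u = w t := by
  let b := Module.Basis.ofVectorSpace K A
  choose j hj hj' using fun t => exists_coord_bound b (hM t) (hs t) (w t)
  obtain ⟨u, hu⟩ := exists_ctensor_of_coord b (EqualsCompletion.pi hM)
    (fun i t => cfunctional (hM t) (b.coord i) (w t)) j (fun i t _ => hj t i) fun k => by
      refine (Set.finite_iUnion fun t => hj' t k).subset fun i hi => ?_
      by_contra hi'
      refine hi fun t _ => ?_
      by_contra h
      exact hi' (Set.mem_iUnion.2 ⟨t, h⟩)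
  refine ⟨u, fun t => ctensor_ext_coord b (hM t) (hs t) fun i => ?_⟩
  refine (cfunctional_ctensorMap (EqualsCompletion.pi hM) (hM t) LinearMap.id
    (piProj M t) (b.coord i) u).trans ?_
  exact congrFun (hu i) t

end DirInvMod

variable {X : TopCat.{u}} {N : DirInvSheaf K X} {m : ℕ}
  (U : Fin (m + 1) → Opens X)

/-- Restriction of Čech cochains, as a morphism of dir-inv modules. -/
abbrev cechRes (N : DirInvSheaf K X) (n : SimplexCategory) {V W : Opens X} (h : V ≤ W) :
    cechObj U N W n ⟶ cechObj U N V n :=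
  (((cech U).obj N).map (homOfLE h).op).app n

theorem hasGluing_cechFamily (M : DirInvSheaf K X) (n : SimplexCategory) :
    HasGluing (fun V => CechFamily U M.psh V n) fun h c β => M.psh.res (inf_le_inf_right _ h) (c β) := by
  have hcov : ∀ {ι : Type u} {V : Opens X} {W : ι → Opens X} (_ : ∀ x ∈ V, ∃ i, x ∈ W i)
      (D : Opens X), ∀ x ∈ V ⊓ D, ∃ i, x ∈ W i ⊓ D := fun hc D x hx =>
    (hc x hx.1).imp fun i hi => ⟨hi, hx.2⟩
  refine ⟨fun {ι V W} hW hc {t t'} h => funext fun β => M.hasGluing.sep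
    (fun i => inf_le_inf_right _ (hW i)) (hcov hc _) fun i => congrFun (h i) β,
    fun {ι V W} hW hc s hs => ?_⟩
  choose w hw using fun β => M.hasGluing.glue (fun i => inf_le_inf_right (cechOpen U β) (hW i))
    (hcov hc (cechOpen U β)) (fun i => s i β) fun i i' Z hi hi' => by
      have e := congrArg (M.psh.res (le_inf le_rfl (hi.trans inf_le_right)))
        (congrFun (hs i i' Z (hi.trans inf_le_left) (hi'.trans inf_le_left)) β)
      rwa [M.psh.res_res, M.psh.res_res] at e
  exact ⟨w, fun i => funext fun β => hw β i⟩

/-- Čech cochains glue component by component, and vanishing on degenerate simplices is a local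
condition. -/
theorem isSheaf_normCech (M : CompleteDirInvSheaf K X) (q : ℕ) :
    Presheaf.IsSheaf (Opens.grothendieckTopology X) (((normCech U).obj M).X q) := by
  have hG := hasGluing_cechFamily U M.obj ⦋q⦌
  have hG' : HasGluing (fun V => normSub (cechModule U M.obj V) q) fun {V W} h c =>
      ⟨(fun β => M.obj.psh.res (inf_le_inf_right _ h) ((c.1 : CechFamily U M.obj.psh W ⦋q⦌) β) :
        CechFamily U M.obj.psh V ⦋q⦌), (mem_normSub_cech _).2 fun β hβ => by
          rw [(mem_normSub_cech _).1 c.2 β hβ, map_zero]⟩ := by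
    refine ⟨fun {ι V W} hW hc {t t'} h => Subtype.ext (hG.sep hW hc fun i =>
      congrArg Subtype.val (h i)), fun {ι V W} hW hc s hs => ?_⟩
    obtain ⟨w, hw⟩ := hG.glue hW hc (fun i => (s i).1) fun i j Z hi hj =>
      congrArg Subtype.val (hs i j Z hi hj)
    refine ⟨⟨w, (mem_normSub_cech w).2 fun β hβ => M.obj.hasGluing.sep
      (W := fun i => W i ⊓ cechOpen U β) (fun i => inf_le_inf_right _ (hW i))
      (fun x hx => (hc x hx.1).imp fun i hi => ⟨hi, hx.2⟩) fun i => ?_⟩,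
      fun i => Subtype.ext (hw i)⟩
    rw [map_zero]
    exact (congrFun (hw i) β).trans ((mem_normSub_cech _).1 (s i).2 β hβ)
  exact (ModPsh.isSheaf_iff_hasGluing _).2 hG'

/-- Since `M` is bounded below, each term of the total complex is a finite direct sum of the given
sheaves. -/
theorem isSheaf_totalExtension_X (F : CompleteDirInvSheaf K X ⥤ CochainComplex (ModPsh K X) ℕ)
    [F.PreservesZeroMorphisms]
    (hF : ∀ M q, Presheaf.IsSheaf (Opens.grothendieckTopology X) ((F.obj M).X q))
    (M : CochainComplex (CompleteDirInvSheaf K X) ℤ) (hM : ∃ n, ∀ p < n, IsZero (M.X p)) (i : ℤ) :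
    Presheaf.IsSheaf (Opens.grothendieckTopology X) (((totalExtension F).obj M).X i) := by
  obtain ⟨b, hb⟩ := hM
  exact ModPsh.isSheaf_of_sum_eq_id _ _ _ ((doubleComplex F M).sum_πTotal_ιTotal b
    (fun q p hp => isZero_functor_obj_X F (hb p hp) q) i) fun q => hF (M.X (i - q)) q

variable [NoetherianSpace X]

theorem hasGluing_ctensor_cech (hN : N.IsStrictlyComplete) (A : Type u) [AddCommGroup A]
    [Module K A] (n : SimplexCategory) : HasGluing (fun V => CTensor A (cechObj U N V n))
    fun h u => ctensorMap LinearMap.id (cechRes U N n h) u := by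
  let p : ∀ V (β : n ⟶ ⦋m⦌), CTensor A (cechObj U N V n) →
      CTensor A (N.sections (V ⊓ cechOpen U β)) := fun V β =>
    ctensorMap LinearMap.id (piProj (fun β : n ⟶ ⦋m⦌ => N.sections (V ⊓ cechOpen U β)) β)
  have hp : ∀ {V W : Opens X} (h : V ≤ W) β (u : CTensor A (cechObj U N W n)),
      p V β (ctensorMap LinearMap.id (cechRes U N n h) u) =
        ctensorMap LinearMap.id (N.res (inf_le_inf_right _ h)) (p W β u) := fun h β u =>
    (ctensorMap_ctensorMap _ _ _ _ _).trans (ctensorMap_ctensorMap LinearMap.id LinearMap.id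
      (piProj (fun β : n ⟶ ⦋m⦌ => N.sections (_ ⊓ cechOpen U β)) β)
      (N.res (inf_le_inf_right _ h)) u).symm
  have hext : ∀ {V} {u v : CTensor A (cechObj U N V n)}, (∀ β, p V β u = p V β v) → u = v := fun h =>
    ctensor_pi_ext A (fun _ => hN.sections _) (fun _ => hN.convergesStrictly _) h
  have hG := hasGluing_ctensor A hN
  have hrr : ∀ {V W Z : Opens X} (h : V ≤ W) (h' : W ≤ Z) (u : CTensor A (N.sections Z)),
      ctensorMap LinearMap.id (N.res h) (ctensorMap LinearMap.id (N.res h') u) =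
        ctensorMap LinearMap.id (N.res (h.trans h')) u := fun h h' u => by
    rw [ctensorMap_ctensorMap]
    congr 2
    exact DirInvMod.hom_ext fun x => N.psh.res_res _ _ _
  have hcov : ∀ {ι : Type u} {V : Opens X} {W : ι → Opens X} (_ : ∀ x ∈ V, ∃ i, x ∈ W i)
      (D : Opens X), ∀ x ∈ V ⊓ D, ∃ i, x ∈ W i ⊓ D := fun hc D x hx =>
    (hc x hx.1).imp fun i hi => ⟨hi, hx.2⟩
  refine ⟨fun {ι V W} hW hc {t t'} h => hext fun β => hG.sep (fun i => inf_le_inf_right _ (hW i))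
    (hcov hc _) fun i => ?_, fun {ι V W} hW hc s hs => ?_⟩
  · rw [← hp (hW i), ← hp (hW i), h]
  · choose w hw using fun β => hG.glue (fun i => inf_le_inf_right (cechOpen U β) (hW i))
      (hcov hc (cechOpen U β)) (fun i => p (W i) β (s i)) fun i i' Z hi hi' => by
        have key : ∀ {i} (hi : Z ≤ W i ⊓ cechOpen U β),
            ctensorMap LinearMap.id (N.res hi) (p (W i) β (s i)) =
            ctensorMap LinearMap.id (N.res (le_inf le_rfl (hi.trans inf_le_right)))
              (p Z β (ctensorMap LinearMap.id (cechRes U N n (hi.trans inf_le_left)) (s i))) :=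
          fun hi => by rw [hp, hrr]
        rw [key hi, key hi', hs]
    obtain ⟨u, hu⟩ : ∃ u : CTensor A (cechObj U N V n), ∀ β, p V β u = w β :=
      exists_ctensor_pi A (fun _ => hN.sections _) (fun _ => hN.convergesStrictly _) w
    refine ⟨u, fun i => hext fun β => ?_⟩
    rw [hp, ← hw β i, hu]

theorem isSheaf_commCech_of_isStrictlyComplete (hN : N.IsStrictlyComplete)
    (hN' : DirInvSheaf.isComplete K X N) (q : ℕ) :
    Presheaf.IsSheaf (Opens.grothendieckTopology X) (((commCech U).obj ⟨N, hN'⟩).X q) := by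
  let B : Opens X → CosimplicialObject (DirInvMod K) := fun V => ((cech U).obj N).obj (op V)
  let r : ∀ {V W : Opens X} (_ : V ≤ W), B W ⟶ B V := fun h => ((cech U).obj N).map (homOfLE h).op
  have hG : HasGluing (fun V => tsSub (B V) q) fun h u => tsMapAux (r h) q u := by
    have hG := fun n => hasGluing_ctensor_cech U hN (Om K q n) n
    refine ⟨fun {ι V W} hW hc {t t'} h => Subtype.ext (funext fun n => (hG n).sep hW hc fun i =>
      congrFun (congrArg Subtype.val (h i)) n), fun {ι V W} hW hc s hs => ?_⟩
    choose w hw using fun n => (hG n).glue hW hc (fun i => (s i).1 n) fun i j Z hi hj =>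
      congrFun (congrArg Subtype.val (hs i j Z hi hj)) n
    -- Compatibility for `α : k → l` is an equation in `Ω^q(Δ^k) ⊗̂ B^l`, where separatedness of the
    -- mixed tensor product reduces it to the members of the covering.
    refine ⟨⟨w, fun k l α => (hasGluing_ctensor_cech U hN (Om K q k) l).sep hW hc fun i => ?_⟩,
      fun i => Subtype.ext (funext fun n => hw n i)⟩
    have e := (s i).2 k l α
    rw [← hw k i, ← hw l i] at e
    erw [ctensorMap_ctensorMap, ctensorMap_ctensorMap] at e ⊢
    refine Eq.trans ?_ (e.trans ?_)
    · exact congrArg (fun f => ctensorMap _ f (w k)) ((r (hW i)).naturality α)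
    · rfl
  exact (ModPsh.isSheaf_iff_hasGluing _).2 hG

/-- Completeness only provides an isomorphism with a strictly complete object; functoriality
transports the sheaf property along it. -/
theorem isSheaf_commCech (M : CompleteDirInvSheaf K X) (q : ℕ) :
    Presheaf.IsSheaf (Opens.grothendieckTopology X) (((commCech U).obj M).X q) := by
  obtain ⟨N, ⟨e⟩, hN⟩ := M.property
  have hN' : DirInvSheaf.isComplete K X N := ⟨N, ⟨Iso.refl N⟩, hN⟩
  let e' : M ≅ ⟨N, hN'⟩ := ObjectProperty.isoMk _ e
  refine (Presheaf.isSheaf_of_iso_iff ((HomologicalComplex.eval _ _ q).mapIso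
    ((commCech U).mapIso e'))).2 ?_
  exact isSheaf_commCech_of_isStrictlyComplete U hN hN' q

end ProductGluing

/-! ### Quasi-isomorphisms of complexes of sheaves -/

section SheafQuasiIso

variable {K : Type u} [Field K] {X : TopCat.{u}}

/-- Evaluation at an open set commutes with homology of complexes of presheaves. -/
theorem ModPsh.isIso_homologyMap_app {P Q : CochainComplex (ModPsh K X) ℤ} (f : P ⟶ Q) (i : ℤ)
    (V : (Opens X)ᵒᵖ) (h : QuasiIso ((((evaluation (Opens X)ᵒᵖ (ModuleCat.{u} K)).obj
      V).mapHomologicalComplex (ComplexShape.up ℤ)).map f)) :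
    IsIso ((HomologicalComplex.homologyMap f i).app V) :=
  ((MorphismProperty.isomorphisms _).arrow_mk_iso_iff (((Functor.mapArrowFunctor _ _).mapIso
    (ShortComplex.homologyFunctorIso ((evaluation (Opens X)ᵒᵖ (ModuleCat.{u} K)).obj V))).app
      (Arrow.mk ((HomologicalComplex.shortComplexFunctor _ _ i).map f)))).1
    ((quasiIsoAt_iff_isIso_homologyMap _ i).1 (h.quasiIsoAt i))

/-- Every point of an open set has a neighbourhood in it contained in some `U i`, so bijectivity on
such sets is local bijectivity. -/
theorem ModPsh.W_of_isIso_app {ι : Type*} (U : ι → Opens X) (hU : ⨆ i, U i = ⊤) {P Q : ModPsh K X}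
    (f : P ⟶ Q) (h : ∀ (V : Opens X) i, V ≤ U i → IsIso (f.app (op V))) :
    (Opens.grothendieckTopology X).W f := by
  have hcov : ∀ x : X, ∃ i, x ∈ U i := fun x =>
    Opens.mem_iSup.1 (hU ▸ (trivial : x ∈ (⊤ : Opens X)))
  have hbij : ∀ (V : Opens X) i, V ≤ U i → Function.Bijective (f.app (op V)) := fun V i hi =>
    (ConcreteCategory.isIso_iff_bijective _).1 (h V i hi)
  refine (GrothendieckTopology.W_iff_isLocallyBijective _ f).2 ⟨⟨fun {V} x y hxy z hz => ?_⟩,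
    ⟨fun {V} s z hz => ?_⟩⟩
  · obtain ⟨i, hi⟩ := hcov z
    refine ⟨V.unop ⊓ U i, homOfLE inf_le_left, ?_, ⟨hz, hi⟩⟩
    refine (hbij _ i inf_le_right).1 ?_
    have := congrArg (Q.res (inf_le_left : V.unop ⊓ U i ≤ V.unop)) hxy
    exact (ModPsh.res_app f _ x).trans (this.trans (ModPsh.res_app f _ y).symm)
  · obtain ⟨i, hi⟩ := hcov z
    exact ⟨V ⊓ U i, homOfLE inf_le_left, (hbij _ i inf_le_right).2 _, ⟨hz, hi⟩⟩

theorem quasiIso_toSheafHom {ι : Type*} (U : ι → Opens X) (hU : ⨆ i, U i = ⊤)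
    {P Q : CochainComplex (ModPsh K X) ℤ} (f : P ⟶ Q)
    (hP : ∀ i, Presheaf.IsSheaf (Opens.grothendieckTopology X) (P.X i))
    (hQ : ∀ i, Presheaf.IsSheaf (Opens.grothendieckTopology X) (Q.X i))
    (h : ∀ (V : Opens X) i, V ≤ U i → QuasiIso ((((evaluation (Opens X)ᵒᵖ (ModuleCat.{u} K)).obj
      (op V)).mapHomologicalComplex (ComplexShape.up ℤ)).map f)) :
    QuasiIso (toSheafHom f hP hQ) := by
  let S := presheafToSheaf (Opens.grothendieckTopology X) (ModuleCat.{u} K)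
  -- Sheafification is exact, so it commutes with homology, and it inverts the locally bijective
  -- maps of homology presheaves.
  have hS : QuasiIso ((S.mapHomologicalComplex (ComplexShape.up ℤ)).map f) := by
    refine ⟨fun i => (quasiIsoAt_iff_isIso_homologyMap _ i).2 ?_⟩
    refine ((MorphismProperty.isomorphisms _).arrow_mk_iso_iff (((Functor.mapArrowFunctor _ _).mapIso
      (ShortComplex.homologyFunctorIso S)).app
      (Arrow.mk ((HomologicalComplex.shortComplexFunctor _ _ i).map f)))).2 ?_
    exact ((Opens.grothendieckTopology X).W_iff _).1 (ModPsh.W_of_isIso_app U hU _ fun V v hv =>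
      ModPsh.isIso_homologyMap_app f i (op V) (h V v hv))
  -- The terms of `P` and `Q` are already sheaves, so sheafifying gives back the original morphism
  -- of complexes of sheaves.
  let e : sheafToPresheaf (Opens.grothendieckTopology X) (ModuleCat.{u} K) ⋙ S ≅ 𝟭 _ :=
    asIso (sheafificationAdjunction (Opens.grothendieckTopology X) (ModuleCat.{u} K)).counit
  exact ((HomologicalComplex.quasiIso (ModSheaf K X) (ComplexShape.up ℤ)).arrow_mk_iso_iff
    (((Functor.mapArrowFunctor _ _).mapIso (NatIso.mapHomologicalComplex e _)).app
      (Arrow.mk (toSheafHom f hP hQ)))).1 hS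

end SheafQuasiIso

end

theorem mainTheorem3 {K : Type u} [Field K] [CharZero K] {X : TopCat.{u}} [NoetherianSpace X]
    {m : ℕ} (U : Fin (m + 1) → Opens X) (hU : ⨆ i, U i = ⊤)
    (M : CochainComplex (CompleteDirInvSheaf K X) ℤ) (hM : ∃ n, ∀ p < n, IsZero (M.X p)) :
    (∀ V : Opens X, QuasiIso
      ((((evaluation (Opens X)ᵒᵖ (ModuleCat.{u} K)).obj (op V)).mapHomologicalComplex
        (ComplexShape.up ℤ)).map ((totalIntegral U).app M))) ∧
    ∃ (hT : ∀ i, Presheaf.IsSheaf (Opens.grothendieckTopology X) (((totalCommCech U).obj M).X i))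
      (hN : ∀ i, Presheaf.IsSheaf (Opens.grothendieckTopology X) (((totalNormCech U).obj M).X i)),
      QuasiIso (toSheafHom ((totalUnit U).app M) (underlyingComplex_isSheaf M) hT) ∧
      QuasiIso (toSheafHom ((totalIntegral U).app M) hT hN) := by
  have hT := isSheaf_totalExtension_X (commCech U) (isSheaf_commCech U) M hM
  have hN := isSheaf_totalExtension_X (normCech U) (isSheaf_normCech U) M hM
  exact ⟨quasiIso_totalIntegral_app U M hM, hT, hN,
    -- The unit is a quasi-isomorphism on sections only over open sets inside a member of the
    -- covering, whereas integration is one over every open set.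
    quasiIso_toSheafHom U hU _ _ hT fun _ _ hV => quasiIso_totalUnit_app U M hM hV,
    quasiIso_toSheafHom U hU _ hT hN fun V _ _ => quasiIso_totalIntegral_app U M hM V⟩
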